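/- Conventions. Manifolds are real, finite-dimensional, smooth, Hausdorff and second countable; all bundles are smooth and of finite rank. A double vector bundle (DVB) $(W\to E;A\to M)$ is a commutative square of vector bundles $W\to E$, $W\to A$, $E\to M$, $A\to M$ such that the projection, the addition, the multiplications by scalars and the zero section of $W\to A$ are vector bundle maps covering the corresponding structure maps of $E\to M$. A section of $W\to E$ is linear if it is a vector bundle map (from $E\to M$ to $W\to A$) over a section of $A\to M$; it is a core section if it has the form $e\mapsto 0_e+_A\chi(q(e))$, where $q:E\to M$ is the projection and $\chi$ is a section of the core $C=\ker(W\to E)\cap\ker(W\to A)$. A VB-algebroid structure on the DVB is a Lie algebroid structure on $W\to E$ whose anchor is a vector bundle map from $W\to A$ to $TE\to TM$ covering a vector bundle map $A\to TM$, and whose bracket $b$ satisfies $b(\mathrm{lin},\mathrm{lin})\subset\mathrm{lin}$, $b(\mathrm{lin},\mathrm{core})\subset\mathrm{core}$, $b(\mathrm{core},\mathrm{core})=0$. For $k\ge 1$, a $k$-derivation of $W\to E$ is a skew-symmetric $\mathbb R$-multilinear map $c:\Gamma(W,E)^k\to\Gamma(W,E)$ for which there is a bundle map $\sigma_c:\wedge^{k-1}W\to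 TE$ with $c(s_1,\dots,s_{k-1},fs_k)=\sigma_c(s_1,\dots,s_{k-1})(f)\,s_k+f\,c(s_1,\dots,s_k)$. A vector bundle automorphism $\phi$ of $W\to E$ covering $\phi_E$ acts by $\phi^*s=\phi^{-1}\circ s\circ\phi_E$ on sections and by $(\phi^*c)(s_1,\dots,s_k)=\phi^*\big(c((\phi^{-1})^*s_1,\dots,(\phi^{-1})^*s_k)\big)$ on $k$-derivations; $c$ is linear if $h_\lambda^*c=c$ for all $\lambda>0$, where $h_\lambda$ is multiplication by $\lambda$ in the fibers of $W\to A$. For a $k$-derivation $c_1$ and an $l$-derivation $c_2$, the Gerstenhaber bracket is $[\![c_1,c_2]\!]=(-1)^{(k-1)(l-1)}c_1\circ c_2-c_2\circ c_1$, where $$(c_1\circ c_2)(s_1,\dots,s_{k+l-1})=\sum_{\tau}(-1)^\tau c_1\big(c_2(s_{\tau(1)},\dots,s_{\tau(l)}),s_{\tau(l+1)},\dots,s_{\tau(l+k-1)}\big),$$ the sum being over the $(l,k-1)$-shuffles $\tau$. Let $b_W$ be the bracket of a VB-algebroid structure on the DVB. The linear deformation complex $C_{\mathrm{def},\mathrm{lin}}(W)$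 consists in degree $k\ge 0$ of the linear $(k+1)$-derivations of $W\to E$, with bracket $[\![-,-]\!]$ and differential $\delta=[\![b_W,-]\!]$. A linear deformation of $b_W$ is any VB-algebroid structure on the same DVB. Two linear deformations $b_0,b_1$ are equivalent if there is a smooth path $(\phi_\epsilon)_{\epsilon\in[0,1]}$ of DVB automorphisms of $W$ with $\phi_0=\mathrm{id}_W$ and $\phi_1^*b_1=b_0$. Two Maurer–Cartan elements $c_0,c_1$ of $C_{\mathrm{def},\mathrm{lin}}(W)$, that is, $1$-cochains with $\delta c_i+\frac12[\![c_i,c_i]\!]=0$, are gauge-equivalent if they are interpolated by a smooth path $(c_\epsilon)_{\epsilon\in[0,1]}$ of $1$-cochains of $C_{\mathrm{def},\mathrm{lin}}(W)$ satisfying $$\frac{dc_\epsilon}{d\epsilon}=\delta\Delta_\epsilon+[\![c_\epsilon,\Delta_\epsilon]\!]$$ for some smooth path $(\Delta_\epsilon)_{\epsilon\in[0,1]}$ of $0$-cochains of $C_{\mathrm{def},\mathrm{lin}}(W)$. **Proposition.** Let $(W\to E;A\to M)$ be a DVB with a VB-algebroid structure with bracket $b_W$, and let $b_0=b_W+c_0$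 and $b_1=b_W+c_1$ be linear deformations of $b_W$, with $c_0,c_1$ $1$-cochains of $C_{\mathrm{def},\mathrm{lin}}(W)$. If $b_0$ and $b_1$ are equivalent, then $c_0$ and $c_1$ are (Maurer–Cartan elements that are) gauge-equivalent. If $M$ is compact, the converse is also true. -/

import Mathlib

open Set Filter Topology Bundle
open scoped Manifold ContDiff

noncomputable section

set_option linter.unusedSectionVars false

namespace VBDef

/-! ## Smooth vector bundles: fibrewise operations, sections, automorphisms -/

section Algebra

variable {B₁ B₂ : Type*} {F₁ F₂ : Type*} {E₁ : B₁ → Type*} {E₂ : B₂ → Type*}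
  [∀ b, AddCommGroup (E₁ b)] [∀ b, Module ℝ (E₁ b)]
  [∀ b, AddCommGroup (E₂ b)] [∀ b, Module ℝ (E₂ b)]

/-- `IsSum x y z`: the points `x`, `y`, `z` of the total space lie over the same base point, and
`z = x + y` in the fibre. -/
def IsSum (x y z : TotalSpace F₁ E₁) : Prop :=
  ∃ (b : B₁) (u v : E₁ b), x = ⟨b, u⟩ ∧ y = ⟨b, v⟩ ∧ z = ⟨b, u + v⟩

/-- Fibrewise multiplication by the scalar `r`, on the total space. -/
def scale (r : ℝ) (x : TotalSpace F₁ E₁) : TotalSpace F₁ E₁ := ⟨x.proj, r • x.2⟩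

/-- The map of total spaces `f` covers the map of bases `g` and is linear on each fibre. -/
structure IsFiberwiseLinear (f : TotalSpace F₁ E₁ → TotalSpace F₂ E₂) (g : B₁ → B₂) : Prop where
  proj : ∀ x, (f x).proj = g x.proj
  add : ∀ x y z, IsSum x y z → IsSum (f x) (f y) (f z)
  smul : ∀ (r : ℝ) x, f (scale r x) = scale r (f x)

theorem IsSum.proj_eq {x y z : TotalSpace F₁ E₁} (h : IsSum x y z) :
    x.proj = z.proj ∧ y.proj = z.proj := by
  obtain ⟨b, u, v, rfl, rfl, rfl⟩ := h
  exact ⟨rfl, rfl⟩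

theorem exists_isSum {x y : TotalSpace F₁ E₁} (h : x.proj = y.proj) : ∃ z, IsSum x y z := by
  obtain ⟨b, u⟩ := x
  obtain ⟨b', v⟩ := y
  obtain rfl : b = b' := h
  exact ⟨⟨b, u + v⟩, b, u, v, rfl, rfl, rfl⟩

theorem IsSum.unique {x y z z' : TotalSpace F₁ E₁} (h : IsSum x y z) (h' : IsSum x y z') :
    z = z' := by
  obtain ⟨b, u, v, rfl, rfl, rfl⟩ := h
  obtain ⟨b', u', v', h1, h2, rfl⟩ := h'
  obtain rfl : b = b' := congrArg TotalSpace.proj h1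
  obtain rfl : u = u' := by simpa using h1
  obtain rfl : v = v' := by simpa using h2
  rfl

/-- The inverse of a fibrewise linear bijection covering a bijection is fibrewise linear. -/
theorem IsFiberwiseLinear.symm (f : TotalSpace F₁ E₁ ≃ TotalSpace F₂ E₂) (g : B₁ ≃ B₂)
    (h : IsFiberwiseLinear f g) : IsFiberwiseLinear f.symm g.symm where
  proj x := by
    have := h.proj (f.symm x)
    rw [f.apply_symm_apply] at this
    rw [this, g.symm_apply_apply]
  add x y z hxyz := by
    have hp : (f.symm x).proj = (f.symm y).proj := by
      apply g.injective
      rw [← h.proj, ← h.proj, f.apply_symm_apply, f.apply_symm_apply, hxyz.proj_eq.1,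
        hxyz.proj_eq.2]
    obtain ⟨w, hw⟩ := exists_isSum hp
    have h2 := h.add _ _ _ hw
    rw [f.apply_symm_apply, f.apply_symm_apply] at h2
    rwa [hxyz.unique h2, f.symm_apply_apply]
  smul r x := by
    apply f.injective
    rw [h.smul, f.apply_symm_apply, f.apply_symm_apply]

end Algebra

section SmoothBundle

variable {EB : Type*} [NormedAddCommGroup EB] [NormedSpace ℝ EB]
  {HB : Type*} [TopologicalSpace HB] (I : ModelWithCorners ℝ EB HB)
  {B : Type*} [TopologicalSpace B] [ChartedSpace HB B]
  (F : Type*) [NormedAddCommGroup F] [NormedSpace ℝ F]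
  (E : B → Type*) [TopologicalSpace (TotalSpace F E)]
  [∀ b, AddCommGroup (E b)] [∀ b, Module ℝ (E b)] [∀ b, TopologicalSpace (E b)]
  [FiberBundle F E] [VectorBundle ℝ F E]

/-- The space `Γ(E)` of smooth sections of the vector bundle `E → B`. -/
abbrev Sec : Type _ := Cₛ^∞⟮I; F, E⟯

variable {I F E}

/-- The derivative `X(f)` of a function `f` along a tangent vector `X` at `b`. -/
def dirDeriv {b : B} (X : TangentSpace I b) (f : B → ℝ) : ℝ := mfderiv I 𝓘(ℝ, ℝ) f b X

/-- The section `f s`, where `f` is a smooth function and `s` a smooth section. -/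
def fsmul (f : C^∞⟮I, B; ℝ⟯) (s : Sec I F E) : Sec I F E :=
  ⟨fun x => f x • s x, f.contMDiff.smul_section s.contMDiff⟩

/-- The section of `E → B` determined by a smooth map `f : B → E` into the total space with
`π ∘ f = id`. -/
def secOfMap (f : B → TotalSpace F E) (hf : ∀ b, (f b).proj = b)
    (hs : ContMDiff I (I.prod 𝓘(ℝ, F)) ∞ f) : Sec I F E :=
  ⟨fun b => cast (congrArg E (hf b)) (f b).2, by
    refine hs.congr fun b => ?_
    have key : ∀ (x : TotalSpace F E) (b : B) (h : x.proj = b),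
        (⟨b, cast (congrArg E h) x.2⟩ : TotalSpace F E) = x := by
      rintro x b rfl
      rfl
    exact key (f b) b (hf b)⟩

theorem mk_secOfMap (f : B → TotalSpace F E) (hf : ∀ b, (f b).proj = b)
    (hs : ContMDiff I (I.prod 𝓘(ℝ, F)) ∞ f) (b : B) :
    (⟨b, secOfMap f hf hs b⟩ : TotalSpace F E) = f b := by
  have key : ∀ (x : TotalSpace F E) (b : B) (h : x.proj = b),
      (⟨b, cast (congrArg E h) x.2⟩ : TotalSpace F E) = x := by
    rintro x b rfl
    rfl
  exact key (f b) b (hf b)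

variable (I F E) in
/-- Vector bundle automorphisms of `E → B`: diffeomorphisms of the total space that cover a
diffeomorphism of the base and are linear on fibres. -/
structure VBAut where
  total : Diffeomorph (I.prod 𝓘(ℝ, F)) (I.prod 𝓘(ℝ, F)) (TotalSpace F E) (TotalSpace F E) ∞
  base : Diffeomorph I I B B ∞
  linear : IsFiberwiseLinear total base

/-- The inverse automorphism. -/
def VBAut.symm (φ : VBAut I F E) : VBAut I F E where
  total := φ.total.symm
  base := φ.base.symm
  linear := IsFiberwiseLinear.symm φ.total.toEquiv φ.base.toEquiv φ.linear

/-- The pull-back of sections, `φ^* s = φ⁻¹ ∘ s ∘ φ_B`. -/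
def VBAut.pullSec (φ : VBAut I F E) (s : Sec I F E) : Sec I F E :=
  secOfMap (fun b => φ.total.symm ⟨φ.base b, s (φ.base b)⟩)
    (fun b => by
      have h := φ.symm.linear.proj ⟨φ.base b, s (φ.base b)⟩
      exact h.trans (φ.base.symm_apply_apply b))
    (φ.total.symm.contMDiff.comp (s.contMDiff.comp φ.base.contMDiff))

theorem VBAut.mk_pullSec (φ : VBAut I F E) (s : Sec I F E) (b : B) :
    (⟨b, φ.pullSec s b⟩ : TotalSpace F E) = φ.total.symm ⟨φ.base b, s (φ.base b)⟩ :=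
  mk_secOfMap _ _ _ b

/-- The action of vector bundle automorphisms on maps `c : Γ(E)ⁿ → Γ(E)`:
`(φ^* c)(s₁, …, sₙ) = φ^* (c ((φ⁻¹)^* s₁, …, (φ⁻¹)^* sₙ))`. -/
def VBAut.pull (φ : VBAut I F E) {n : ℕ} (c : (Fin n → Sec I F E) → Sec I F E) :
    (Fin n → Sec I F E) → Sec I F E :=
  fun s => φ.pullSec (c fun i => φ.symm.pullSec (s i))

/-- Fibrewise multiplication by a scalar is smooth. -/
theorem contMDiff_scale [ContMDiffVectorBundle ∞ F E I] (r : ℝ) :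
    ContMDiff (I.prod 𝓘(ℝ, F)) (I.prod 𝓘(ℝ, F)) ∞ (scale r : TotalSpace F E → TotalSpace F E) := by
  intro x
  have hid : ContMDiffAt (I.prod 𝓘(ℝ, F)) (I.prod 𝓘(ℝ, F)) ∞ (id : TotalSpace F E → _) x :=
    contMDiffAt_id
  rw [contMDiffAt_totalSpace] at hid ⊢
  refine ⟨hid.1, ?_⟩
  have h2 : ContMDiffAt (I.prod 𝓘(ℝ, F)) 𝓘(ℝ, F) ∞
      (fun y : TotalSpace F E => r • (trivializationAt F E x.proj y).2) x :=
    ((contDiff_const_smul r).contMDiff.contMDiffAt (I := 𝓘(ℝ, F)) (I' := 𝓘(ℝ, F))).comp x hid.2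
  refine h2.congr_of_eventuallyEq ?_
  filter_upwards [(FiberBundle.continuous_proj F E).continuousAt.preimage_mem_nhds
    ((trivializationAt F E x.proj).open_baseSet.mem_nhds
      (FiberBundle.mem_baseSet_trivializationAt F E x.proj))] with y hy
  exact (Bundle.Trivialization.linear ℝ (trivializationAt F E x.proj) hy).2 r y.2

/-- Fibrewise multiplication by a nonzero scalar, as a diffeomorphism of the total space. -/
def scaleDiffeo [ContMDiffVectorBundle ∞ F E I] (r : ℝ) (hr : r ≠ 0) :
    Diffeomorph (I.prod 𝓘(ℝ, F)) (I.prod 𝓘(ℝ, F)) (TotalSpace F E) (TotalSpace F E) ∞ where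
  toFun := scale r
  invFun := scale r⁻¹
  left_inv x := by
    change (⟨x.proj, r⁻¹ • r • x.2⟩ : TotalSpace F E) = x
    rw [inv_smul_smul₀ hr]
  right_inv x := by
    change (⟨x.proj, r • r⁻¹ • x.2⟩ : TotalSpace F E) = x
    rw [smul_inv_smul₀ hr]
  contMDiff_toFun := contMDiff_scale r
  contMDiff_invFun := contMDiff_scale r⁻¹

/-- A `(k+1)`-derivation of `E → B`: a skew-symmetric `ℝ`-multilinear map `c` on sections with
`k + 1` entries, such that there is a bundle map `σ : ∧ᵏ E → TB` (the symbol) with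
`c(s₁, …, s_k, f t) = σ(s₁, …, s_k)(f) t + f c(s₁, …, s_k, t)`. -/
def IsMultiderivation [IsManifold I ∞ B] {k : ℕ} (c : (Sec I F E) [⋀^Fin (k + 1)]→ₗ[ℝ] (Sec I F E)) : Prop :=
  ∃ σ : ∀ b : B, (E b) [⋀^Fin k]→ₗ[ℝ] TangentSpace I b,
    (∀ s : Fin k → Sec I F E,
      ContMDiff I I.tangent ∞ fun b => (⟨b, σ b fun i => s i b⟩ : TangentBundle I B)) ∧
    ∀ (s : Fin k → Sec I F E) (f : C^∞⟮I, B; ℝ⟯) (t : Sec I F E) (b : B),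
      c (Fin.snoc (α := fun _ => Sec I F E) s (fsmul f t)) b =
        dirDeriv (σ b fun i => s i b) f • t b +
          f b • c (Fin.snoc (α := fun _ => Sec I F E) s t) b

variable (I F E) in
/-- A Lie algebroid structure on the vector bundle `E → B`. -/
structure LieAlgebroid [IsManifold I ∞ B] where
  /-- the Lie bracket on sections -/
  bracket : Sec I F E →ₗ[ℝ] Sec I F E →ₗ[ℝ] Sec I F E
  bracket_self : ∀ s, bracket s s = 0
  jacobi : ∀ s t u, bracket (bracket s t) u + bracket (bracket t u) s + bracket (bracket u s) t = 0
  /-- the anchor -/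
  anchor : ∀ b : B, E b →ₗ[ℝ] TangentSpace I b
  contMDiff_anchor : ContMDiff (I.prod 𝓘(ℝ, F)) I.tangent ∞
    fun x : TotalSpace F E => (⟨x.proj, anchor x.proj x.2⟩ : TangentBundle I B)
  leibniz : ∀ (s t : Sec I F E) (f : C^∞⟮I, B; ℝ⟯) (b : B),
    bracket s (fsmul f t) b = dirDeriv (anchor b (s b)) f • t b + f b • bracket s t b

/-- The bracket of a Lie algebroid as a map with two entries. -/
def LieAlgebroid.brk [IsManifold I ∞ B] (L : LieAlgebroid I F E) : (Fin 2 → Sec I F E) → Sec I F E :=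
  fun s => L.bracket (s 0) (s 1)

/-- The anchor of a Lie algebroid as a map `E → TB` of total spaces. -/
def LieAlgebroid.anchorMap [IsManifold I ∞ B] (L : LieAlgebroid I F E) (x : TotalSpace F E) : TangentBundle I B :=
  ⟨x.proj, L.anchor x.proj x.2⟩

/-! ### The tangent prolongation `TE → TB` of a vector bundle `E → B`

Its projection is the differential of `E → B`; multiplication by `r` is the differential of the
fibrewise multiplication by `r`; the addition is the differential of `E ×_B E → E`. -/

/-- `IsTangentSum ξ η ζ` holds when `ζ` is the sum of `ξ` and `η` in the vector bundle `TE → TB`: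
there is a tangent vector to `E ×_B E` which is mapped to `ξ`, `η` and `ζ` by the differentials of
the two projections and of the addition. -/
def IsTangentSum (ξ η ζ : TangentBundle (I.prod 𝓘(ℝ, F)) (TotalSpace F E)) : Prop :=
  ∃ θ : TangentBundle (I.prod 𝓘(ℝ, F × F)) (TotalSpace (F × F) (E ×ᵇ E)),
    tangentMap (I.prod 𝓘(ℝ, F × F)) (I.prod 𝓘(ℝ, F))
      (fun x : TotalSpace (F × F) (E ×ᵇ E) => (⟨x.proj, x.2.1⟩ : TotalSpace F E)) θ = ξ ∧
    tangentMap (I.prod 𝓘(ℝ, F × F)) (I.prod 𝓘(ℝ, F))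
      (fun x : TotalSpace (F × F) (E ×ᵇ E) => (⟨x.proj, x.2.2⟩ : TotalSpace F E)) θ = η ∧
    tangentMap (I.prod 𝓘(ℝ, F × F)) (I.prod 𝓘(ℝ, F))
      (fun x : TotalSpace (F × F) (E ×ᵇ E) => (⟨x.proj, x.2.1 + x.2.2⟩ : TotalSpace F E)) θ = ζ

end SmoothBundle

/-! ## The Gerstenhaber bracket -/

section Gerstenhaber

variable {G : Type*} [AddCommGroup G]

/-- `τ` is an `(a, b)`-shuffle: increasing on the first `a` and on the last `b` elements. -/
def IsShuffle (a b : ℕ) (τ : Equiv.Perm (Fin (a + b))) : Prop :=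
  (∀ i j : Fin a, i < j → τ (Fin.castAdd b i) < τ (Fin.castAdd b j)) ∧
    ∀ i j : Fin b, i < j → τ (Fin.natAdd a i) < τ (Fin.natAdd a j)

instance (a b : ℕ) : DecidablePred (IsShuffle a b) := fun τ => by
  unfold IsShuffle
  infer_instance

/-- The Gerstenhaber product `c₁ ∘ c₂` of a map `c₁` with `k + 1` entries and a map `c₂` with
`l` entries: the sum, over the `(l, k)`-shuffles `τ`, of
`(-1)^τ c₁(c₂(s_{τ(1)}, …, s_{τ(l)}), s_{τ(l+1)}, …, s_{τ(l+k)})`. -/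
def gerstProd {k l : ℕ} (c₁ : (Fin (k + 1) → G) → G) (c₂ : (Fin l → G) → G) :
    (Fin (l + k) → G) → G :=
  fun s => ∑ τ : Equiv.Perm (Fin (l + k)) with IsShuffle l k τ,
    (Equiv.Perm.sign τ : ℤ) •
      c₁ (Fin.cons (c₂ fun i => s (τ (Fin.castAdd k i))) fun j => s (τ (Fin.natAdd l j)))

/-- The Gerstenhaber bracket `⟦c₁, c₂⟧ = (-1)^{kl} c₁ ∘ c₂ - c₂ ∘ c₁` of a map `c₁` with `k + 1`
entries (degree `k`) and a map `c₂` with `l + 1` entries (degree `l`). -/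
def gerst {k l : ℕ} (c₁ : (Fin (k + 1) → G) → G) (c₂ : (Fin (l + 1) → G) → G) :
    (Fin (k + l + 1) → G) → G :=
  fun s => (-1 : ℤ) ^ (k * l) • gerstProd c₁ c₂ (fun i => s (Fin.cast (by omega) i)) -
    gerstProd c₂ c₁ (fun i => s (Fin.cast (by omega) i))

end Gerstenhaber

/-! ## Double vector bundles -/

section DVB

variable {EM : Type*} [NormedAddCommGroup EM] [NormedSpace ℝ EM]
  {M : Type*} [TopologicalSpace M] [ChartedSpace EM M] [IsManifold 𝓘(ℝ, EM) ∞ M]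
  -- the side bundle `E → M`
  {FE : Type*} [NormedAddCommGroup FE] [NormedSpace ℝ FE]
  {E : M → Type*} [TopologicalSpace (TotalSpace FE E)]
  [∀ x, AddCommGroup (E x)] [∀ x, Module ℝ (E x)] [∀ x, TopologicalSpace (E x)]
  [FiberBundle FE E] [VectorBundle ℝ FE E] [ContMDiffVectorBundle ∞ FE E 𝓘(ℝ, EM)]
  -- the side bundle `A → M`
  {FA : Type*} [NormedAddCommGroup FA] [NormedSpace ℝ FA]
  {A : M → Type*} [TopologicalSpace (TotalSpace FA A)]
  [∀ x, AddCommGroup (A x)] [∀ x, Module ℝ (A x)] [∀ x, TopologicalSpace (A x)]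
  [FiberBundle FA A] [VectorBundle ℝ FA A] [ContMDiffVectorBundle ∞ FA A 𝓘(ℝ, EM)]
  -- the vector bundle `W → E`
  {FV : Type*} [NormedAddCommGroup FV] [NormedSpace ℝ FV]
  {V : TotalSpace FE E → Type*} [TopologicalSpace (TotalSpace FV V)]
  [∀ e, AddCommGroup (V e)] [∀ e, Module ℝ (V e)] [∀ e, TopologicalSpace (V e)]
  [FiberBundle FV V] [VectorBundle ℝ FV V]
  [ContMDiffVectorBundle ∞ FV V (𝓘(ℝ, EM).prod 𝓘(ℝ, FE))]
  -- the vector bundle `W → A`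
  {FU : Type*} [NormedAddCommGroup FU] [NormedSpace ℝ FU]
  {U : TotalSpace FA A → Type*} [TopologicalSpace (TotalSpace FU U)]
  [∀ a, AddCommGroup (U a)] [∀ a, Module ℝ (U a)] [∀ a, TopologicalSpace (U a)]
  [FiberBundle FU U] [VectorBundle ℝ FU U]
  [ContMDiffVectorBundle ∞ FU U (𝓘(ℝ, EM).prod 𝓘(ℝ, FA))]

variable (EM FE E FA A FV V FU U) in
/-- A double vector bundle `(W → E; A → M)` with sides the vector bundles `E → M`, `A → M`,
`V` (that is, `W → E`) and `U` (that is, `W → A`). The total spaces of `V` and `U` are two copies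
of the manifold `W`, identified by the diffeomorphism `toA`. The projection, the addition, the
scalar multiplications and the zero section of `W → A` are vector bundle maps (from bundles over
`E ×_M E`, `E`, `M` to `W → E`) that cover the corresponding structure maps of `E → M`; the
projection covers `E → M`. -/
structure DoubleVectorBundle where
  toA : Diffeomorph ((𝓘(ℝ, EM).prod 𝓘(ℝ, FE)).prod 𝓘(ℝ, FV))
    ((𝓘(ℝ, EM).prod 𝓘(ℝ, FA)).prod 𝓘(ℝ, FU)) (TotalSpace FV V) (TotalSpace FU U) ∞
  /-- the projection `W → A` is a vector bundle map over `E → M` -/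
  proj_linear : IsFiberwiseLinear (fun w : TotalSpace FV V => (toA w).proj)
    (fun e : TotalSpace FE E => e.proj)
  /-- the addition `W ×_A W → W` covers the addition `E ×_M E → E` -/
  add_proj : ∀ w₁ w₂ w₃ : TotalSpace FV V, IsSum (toA w₁) (toA w₂) (toA w₃) →
    IsSum w₁.proj w₂.proj w₃.proj
  /-- the addition `W ×_A W → W` is additive over `E ×_M E → E` -/
  add_add : ∀ w₁ w₂ w₃ w₁' w₂' w₃' w₁'' w₂'' w₃'' : TotalSpace FV V,
    IsSum (toA w₁) (toA w₂) (toA w₃) → IsSum (toA w₁') (toA w₂') (toA w₃') →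
    IsSum w₁ w₁' w₁'' → IsSum w₂ w₂' w₂'' → IsSum w₃ w₃' w₃'' →
    IsSum (toA w₁'') (toA w₂'') (toA w₃'')
  /-- the addition `W ×_A W → W` is homogeneous over `E ×_M E → E` -/
  add_smul : ∀ (r : ℝ) (w₁ w₂ w₃ : TotalSpace FV V), IsSum (toA w₁) (toA w₂) (toA w₃) →
    IsSum (toA (scale r w₁)) (toA (scale r w₂)) (toA (scale r w₃))
  /-- multiplication by `r` on `W → A` is a vector bundle map over multiplication by `r` on `E` -/
  smul_linear : ∀ r : ℝ, IsFiberwiseLinear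
    (fun w : TotalSpace FV V => toA.symm (scale r (toA w))) (scale r : TotalSpace FE E → _)
  /-- the zero section `A → W` is a vector bundle map over the zero section `M → E` -/
  zero_linear : IsFiberwiseLinear (fun a : TotalSpace FA A => toA.symm (zeroSection FU U a))
    (fun x : M => zeroSection FE E x)

namespace DoubleVectorBundle

variable (D : DoubleVectorBundle EM FE E FA A FV V FU U)

/-- Addition in the fibres of `W → A`. -/
def IsSumA (w₁ w₂ w₃ : TotalSpace FV V) : Prop := IsSum (D.toA w₁) (D.toA w₂) (D.toA w₃)

/-- The homogeneity structure of `W → A`: the automorphism `h_r` (`r ≠ 0`) of the vector bundle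
`W → E` given by multiplication by `r` in the fibres of `W → A`. -/
def hom (r : ℝ) (hr : r ≠ 0) : VBAut (𝓘(ℝ, EM).prod 𝓘(ℝ, FE)) FV V where
  total := (D.toA.trans (scaleDiffeo r hr)).trans D.toA.symm
  base := scaleDiffeo r hr
  linear := D.smul_linear r

/-- The space `Γ(W, E)` of smooth sections of `W → E`. -/
abbrev Γ (_ : DoubleVectorBundle EM FE E FA A FV V FU U) : Type _ :=
  Sec (𝓘(ℝ, EM).prod 𝓘(ℝ, FE)) FV V

/-- A linear section of `W → E`: a vector bundle map from `E → M` to `W → A` covering a section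
of `A → M`. -/
def IsLinearSection (s : D.Γ) : Prop :=
  ∃ α : Sec 𝓘(ℝ, EM) FA A,
    IsFiberwiseLinear (fun e : TotalSpace FE E => D.toA ⟨e, s e⟩)
      (fun x : M => (⟨x, α x⟩ : TotalSpace FA A))

/-- A core section of `W → E`: one of the form `e ↦ 0_e +_A χ(q(e))`, where `χ` is a section of the
core, that is, a smooth map `M → W` such that `χ(x)` lies over the zero vectors of `E_x` and
of `A_x`, and `0_e` is the zero of the fibre of `W → E` over `e`. -/
def IsCoreSection (s : D.Γ) : Prop :=
  ∃ χ : M → TotalSpace FV V,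
    ContMDiff 𝓘(ℝ, EM) ((𝓘(ℝ, EM).prod 𝓘(ℝ, FE)).prod 𝓘(ℝ, FV)) ∞ χ ∧
    (∀ x, (χ x).proj = zeroSection FE E x) ∧
    (∀ x, (D.toA (χ x)).proj = zeroSection FA A x) ∧
    ∀ e : TotalSpace FE E, D.IsSumA (zeroSection FV V e) (χ e.proj) ⟨e, s e⟩

/-- A VB-algebroid structure on the double vector bundle `D`: a Lie algebroid structure on `W → E`
whose anchor is a vector bundle map from `W → A` to `TE → TM` covering a vector bundle map
`A → TM`, and whose bracket is compatible with linear and core sections. -/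
structure VBAlgebroid extends LieAlgebroid (𝓘(ℝ, EM).prod 𝓘(ℝ, FE)) FV V where
  exists_anchorA : ∃ ρ : ∀ x : M, A x →ₗ[ℝ] TangentSpace 𝓘(ℝ, EM) x,
    ContMDiff (𝓘(ℝ, EM).prod 𝓘(ℝ, FA)) 𝓘(ℝ, EM).tangent ∞
      (fun a : TotalSpace FA A => (⟨a.proj, ρ a.proj a.2⟩ : TangentBundle 𝓘(ℝ, EM) M)) ∧
    ∀ w : TotalSpace FV V,
      tangentMap (𝓘(ℝ, EM).prod 𝓘(ℝ, FE)) 𝓘(ℝ, EM) (fun e : TotalSpace FE E => e.proj)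
        (toLieAlgebroid.anchorMap w) =
      ⟨(D.toA w).proj.proj, ρ (D.toA w).proj.proj (D.toA w).proj.2⟩
  anchor_add : ∀ w₁ w₂ w₃ : TotalSpace FV V, D.IsSumA w₁ w₂ w₃ →
    IsTangentSum (toLieAlgebroid.anchorMap w₁) (toLieAlgebroid.anchorMap w₂)
      (toLieAlgebroid.anchorMap w₃)
  anchor_smul : ∀ (r : ℝ) (w : TotalSpace FV V),
    toLieAlgebroid.anchorMap (D.toA.symm (scale r (D.toA w))) =
      tangentMap (𝓘(ℝ, EM).prod 𝓘(ℝ, FE)) (𝓘(ℝ, EM).prod 𝓘(ℝ, FE))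
        (scale r : TotalSpace FE E → TotalSpace FE E) (toLieAlgebroid.anchorMap w)
  bracket_lin_lin : ∀ s t, D.IsLinearSection s → D.IsLinearSection t →
    D.IsLinearSection (bracket s t)
  bracket_lin_core : ∀ s t, D.IsLinearSection s → D.IsCoreSection t →
    D.IsCoreSection (bracket s t)
  bracket_core_core : ∀ s t, D.IsCoreSection s → D.IsCoreSection t → bracket s t = 0

/-! ## The linear deformation complex -/

/-- A multiderivation of `W → E` is linear if it is of weight `0`: `h_r^* c = c` for `r > 0`. -/
def IsLinear {n : ℕ} (c : (Fin n → D.Γ) → D.Γ) : Prop :=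
  ∀ (r : ℝ) (hr : 0 < r), (D.hom r hr.ne').pull c = c

/-- The cochains of degree `k ≥ 0` in the linear deformation complex: linear `(k+1)`-derivations
of `W → E`. -/
def LinCochain (k : ℕ) : Type _ :=
  {c : D.Γ [⋀^Fin (k + 1)]→ₗ[ℝ] D.Γ // IsMultiderivation c ∧ D.IsLinear c}

variable {D}

/-- The underlying map on sections of a linear cochain. -/
def LinCochain.fn {k : ℕ} (c : D.LinCochain k) : (Fin (k + 1) → D.Γ) → D.Γ := c.1

/-- The differential `δ c = ⟦b_W, c⟧` of the linear deformation complex. -/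
def VBAlgebroid.delta (W : D.VBAlgebroid) {k : ℕ} (c : (Fin (k + 1) → D.Γ) → D.Γ) :
    (Fin (1 + k + 1) → D.Γ) → D.Γ := gerst (k := 1) W.brk c

/-- The Maurer–Cartan equation `δ c + ½ ⟦c, c⟧ = 0`. -/
def IsMaurerCartan (W : D.VBAlgebroid) (c : D.LinCochain 1) : Prop :=
  W.delta c.fn + (1 / 2 : ℝ) • gerst c.fn c.fn = 0

/-- `b` is the linear deformation `b_W + c` of `b_W`. -/
def IsDeformation (W : D.VBAlgebroid) (c : D.LinCochain 1) (b : D.VBAlgebroid) : Prop :=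
  b.brk = W.brk + c.fn

/-- A path, parametrized by `[0, 1]`, of maps `Γ(W, E)ⁿ → Γ(W, E)` is smooth if its values on
sections of `W → E` depend smoothly on the parameter and the point of `E`. -/
def SmoothPath {n : ℕ} (c : ℝ → (Fin n → D.Γ) → D.Γ) : Prop :=
  ∀ s : Fin n → D.Γ,
    ContMDiffOn (𝓘(ℝ, ℝ).prod (𝓘(ℝ, EM).prod 𝓘(ℝ, FE)))
      ((𝓘(ℝ, EM).prod 𝓘(ℝ, FE)).prod 𝓘(ℝ, FV)) ∞
      (fun p : ℝ × TotalSpace FE E => (⟨p.2, c p.1 s p.2⟩ : TotalSpace FV V)) (Icc 0 1 ×ˢ univ)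

/-- `dc_ε/dε = c'_ε` for all `ε ∈ [0, 1]` (one-sided derivatives at the endpoints), evaluated on
sections and at points of `E`. -/
def HasPathDeriv {n : ℕ} (c c' : ℝ → (Fin n → D.Γ) → D.Γ) : Prop :=
  ∀ ε ∈ Icc (0 : ℝ) 1, ∀ (s : Fin n → D.Γ) (e : TotalSpace FE E),
    Tendsto (fun t : ℝ => (t - ε)⁻¹ • (c t s e - c ε s e)) (𝓝[Icc 0 1 \ {ε}] ε) (𝓝 (c' ε s e))

/-- Gauge equivalence of Maurer–Cartan elements `c₀`, `c₁`: they are interpolated by a smooth path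
`(c_ε)` of 1-cochains with `dc_ε/dε = δ Δ_ε + ⟦c_ε, Δ_ε⟧` for a smooth path `(Δ_ε)` of
0-cochains. -/
def GaugeEquivalent (W : D.VBAlgebroid) (c₀ c₁ : D.LinCochain 1) : Prop :=
  IsMaurerCartan W c₀ ∧ IsMaurerCartan W c₁ ∧
  ∃ (c : ℝ → D.LinCochain 1) (Δ : ℝ → D.LinCochain 0),
    SmoothPath (fun ε => (c ε).fn) ∧ SmoothPath (fun ε => (Δ ε).fn) ∧
    c 0 = c₀ ∧ c 1 = c₁ ∧
    HasPathDeriv (fun ε => (c ε).fn)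
      (fun ε => W.delta (Δ ε).fn + gerst (c ε).fn (Δ ε).fn)

/-! ## Equivalence of linear deformations -/

variable (D) in
/-- Automorphisms of the double vector bundle `(W → E; A → M)`. -/
structure DVBAut where
  onW : VBAut (𝓘(ℝ, EM).prod 𝓘(ℝ, FE)) FV V
  onE : VBAut 𝓘(ℝ, EM) FE E
  onA : VBAut 𝓘(ℝ, EM) FA A
  base_onW : onW.base = onE.total
  base_onA : onA.base = onE.base
  /-- the map `W → W` is also an automorphism of `W → A`, covering the automorphism of `A` -/
  linear_toA : IsFiberwiseLinear (fun u : TotalSpace FU U => D.toA (onW.total (D.toA.symm u)))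
    onA.total

/-- Two linear deformations `b₀`, `b₁` are equivalent if there is a DVB isotopy taking `b₀` to `b₁`:
a smooth path `(φ_ε)`, `ε ∈ [0, 1]`, of automorphisms of `D` with `φ₀ = id` and
`φ₁^* b₁ = b₀`. -/
def Equivalent (b₀ b₁ : D.VBAlgebroid) : Prop :=
  ∃ φ : ℝ → D.DVBAut,
    ContMDiffOn (𝓘(ℝ, ℝ).prod ((𝓘(ℝ, EM).prod 𝓘(ℝ, FE)).prod 𝓘(ℝ, FV)))
      ((𝓘(ℝ, EM).prod 𝓘(ℝ, FE)).prod 𝓘(ℝ, FV)) ∞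
      (fun p : ℝ × TotalSpace FV V => (φ p.1).onW.total p.2) (Icc 0 1 ×ˢ univ) ∧
    (∀ w, (φ 0).onW.total w = w) ∧
    (φ 1).onW.pull b₁.brk = b₀.brk

end DoubleVectorBundle

end DVB

end VBDef

end

/-! Both implications rest on one computation. A smooth path φ_t of DVB automorphisms acts on
sections of W → E and has a generator, a time-dependent derivation G_t with d/dt φ_t^* s = φ_t^*(G_t
s). The φ_t commute with the homotheties h_r of W → A, so G_t does too and is a 0-cochain. For a
path of brackets β_t, the equation dβ_t/dt = ⟦β_t, G_t⟧ says exactly that φ_t^* β_t is constant.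
With β_t = b_W + c_t its right side is δG_t + ⟦c_t, G_t⟧, the gauge equation.

From equivalence to gauge equivalence, take β_t = (φ_t⁻¹)^* b_0, which runs from b_0 to b_1;
`SmoothAutPath.exists_generator` and `SmoothAutPath.fibDeriv_pullBil` give the equation. That β_t −
b_W is a linear cochain requires VB-algebroid brackets to have weight zero
(`VBAlgebroid.hom_pullSec_bracket`). The defect b − h_r^* b has zero symbol, because the anchor is
homogeneous, so it is tensorial; it vanishes on linear sections (weight 0) and core sections (weight
−1), and these span every fibre (`exists_linear_add_core`). The Maurer–Cartan equation for c_i is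
the Jacobi identity for b_i.

From gauge equivalence to equivalence, the path of 0-cochains must be integrated. A derivation of
the sections of W → E is the same datum as a vector field on W that is linear over E
(`exists_totalField`), and the point is that its flow is complete although W is not compact. The
field is preserved by the homotheties of both W → E and W → A, which together contract every point
of W to the double zero section, a copy of M. When M is compact, life times near it are bounded
below, and the homotheties carry this bound to all of W (`exists_globalFlow`). The flow commutes
with the homotheties, and smooth homogeneous maps are linear on fibres
(`isFiberwiseLinear_of_homogeneous`), so it consists of DVB automorphisms. Then
`SmoothAutPath.pullBil_eq` gives φ_1^* b_1 = b_0.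

Three devices recur. Paths given only on [0,1] are composed with the smooth 2-periodic function
`cosRamp`, which fixes 0 and 1 and maps the line into [0,1]; all paths then live on ℝ, and time is
compact modulo the period. The fibres carry no norm, so derivatives of curves in them are tested on
linear functionals and smoothness on fibrewise linear functions. A derivation determines its symbol
only if W → E has positive rank; rank zero is treated apart. -/

noncomputable section

set_option linter.unusedSectionVars false

namespace VBDef

/-! ## Smooth dependence of local flows on time and initial value -/

/-! ### Superposition operators on spaces of continuous curves -/

section Nemytskii

set_option synthInstance.maxHeartbeats 400000

variable {K : Type*} [TopologicalSpace K] [CompactSpace K]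

/-- The superposition operator `γ ↦ f ∘ γ` on continuous maps. -/
def postcomp {X Y : Type*} [TopologicalSpace X] [TopologicalSpace Y] (f : X → Y)
    (hf : Continuous f) (γ : C(K, X)) : C(K, Y) := ⟨fun k => f (γ k), hf.comp γ.continuous⟩

/-- Pointwise evaluation `C(K, F →L G) → C(K, F) →L C(K, G)`, as a continuous linear map. -/
def evalPointwise (F G : Type*) [NormedAddCommGroup F] [NormedSpace ℝ F] [NormedAddCommGroup G]
    [NormedSpace ℝ G] : C(K, F →L[ℝ] G) →L[ℝ] C(K, F) →L[ℝ] C(K, G) :=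
  LinearMap.mkContinuous₂
    (LinearMap.mk₂ ℝ (fun (A : C(K, F →L[ℝ] G)) (γ : C(K, F)) => (⟨fun k => A k (γ k), by fun_prop⟩ : C(K, G)))
      (fun _ _ _ => by ext; simp) (fun _ _ _ => by ext; simp) (fun _ _ _ => by ext; simp)
      (fun _ _ _ => by ext; simp)) 1 (fun A γ => by
        rw [ContinuousMap.norm_le _ (by positivity)]
        intro k
        simp only [LinearMap.mk₂_apply, ContinuousMap.coe_mk]
        calc ‖A k (γ k)‖ ≤ ‖A k‖ * ‖γ k‖ := (A k).le_opNorm _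
          _ ≤ 1 * ‖A‖ * ‖γ‖ := by
            rw [one_mul]
            gcongr
            · exact A.norm_coe_le_norm k
            · exact γ.norm_coe_le_norm k)

/-- The pointwise mean value inequality gives the remainder estimate at each k. It is uniform in k
because `fderiv ℝ f` composed with curves is continuous in the sup norm, so the differentials along
nearby curves are uniformly close. -/
theorem hasFDerivAt_postcomp {F G : Type*} [NormedAddCommGroup F] [NormedSpace ℝ F]
    [NormedAddCommGroup G] [NormedSpace ℝ G] {f : F → G} (hf : ContDiff ℝ 1 f) (γ : C(K, F)) :
    HasFDerivAt (postcomp f hf.continuous)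
      (evalPointwise F G (postcomp (fderiv ℝ f) (hf.continuous_fderiv one_ne_zero) γ)) γ := by
  have hc := hf.continuous_fderiv one_ne_zero
  rw [hasFDerivAt_iff_isLittleO, Asymptotics.isLittleO_iff]
  intro c hc0
  have hcont : Continuous (postcomp (K := K) (fderiv ℝ f) hc) :=
    ContinuousMap.continuous_postcomp (⟨fderiv ℝ f, hc⟩ : C(F, F →L[ℝ] G))
  have hcat : Tendsto (postcomp (K := K) (fderiv ℝ f) hc) (𝓝 γ)
      (𝓝 (postcomp (K := K) (fderiv ℝ f) hc γ)) := hcont.tendsto γ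
  obtain ⟨δ, hδ, hδc⟩ := (Metric.tendsto_nhds_nhds (α := C(K, F)) (β := C(K, F →L[ℝ] G))).1 hcat c hc0
  filter_upwards [Metric.ball_mem_nhds γ hδ] with η hη
  rw [ContinuousMap.norm_le _ (by positivity)]
  intro k
  have hball : ∀ y ∈ Metric.ball (γ k) δ, ‖fderiv ℝ f y - fderiv ℝ f (γ k)‖ ≤ c := by
    intro y hy
    have h1 : dist (γ + ContinuousMap.const K (y - γ k)) γ < δ := by
      rw [dist_eq_norm, add_sub_cancel_left]
      refine lt_of_le_of_lt ((ContinuousMap.norm_le _ (norm_nonneg _)).2 fun _ => le_rfl) ?_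
      rw [Metric.mem_ball, dist_eq_norm] at hy
      exact hy
    have h2 := (ContinuousMap.dist_apply_le_dist (x := k)).trans (hδc h1).le
    simpa [postcomp, dist_eq_norm] using h2
  have hk : dist (η k) (γ k) < δ := lt_of_le_of_lt (ContinuousMap.dist_apply_le_dist k) hη
  have := (convex_ball (γ k) δ).norm_image_sub_le_of_norm_hasFDerivWithin_le' (f := f)
    (f' := fderiv ℝ f) (φ := fderiv ℝ f (γ k)) (C := c)
    (fun y _ => ((hf.differentiable one_ne_zero) y).hasFDerivAt.hasFDerivWithinAt) hball
    (Metric.mem_ball_self hδ) hk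
  calc _ = ‖f (η k) - f (γ k) - fderiv ℝ f (γ k) (η k - γ k)‖ := rfl
    _ ≤ c * ‖η k - γ k‖ := this
    _ ≤ c * ‖η - γ‖ := by
      gcongr
      exact (η - γ).norm_coe_le_norm k

universe u

/-- The derivative is again a superposition operator, that of `fderiv ℝ f`, followed by a continuous
linear map; this drives the induction. The target changes from G to F →L G at each step, hence the
quantification over spaces inside the induction and the single universe. -/
theorem contDiff_postcomp_nat (n : ℕ) : ∀ {F G : Type u} [NormedAddCommGroup F] [NormedSpace ℝ F]
    [NormedAddCommGroup G] [NormedSpace ℝ G] {f : F → G} (hf : ContDiff ℝ ∞ f),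
    ContDiff ℝ n (postcomp (K := K) f hf.continuous) := by
  induction n with
  | zero =>
    intro F G _ _ _ _ f hf
    exact contDiff_zero.2 (ContinuousMap.continuous_postcomp (⟨f, hf.continuous⟩ : C(F, G)))
  | succ n ih =>
    intro F G _ _ _ _ f hf
    have h1 : ContDiff ℝ 1 f := hf.of_le (mod_cast le_top)
    have hd : ∀ γ, HasFDerivAt (postcomp (K := K) f hf.continuous) _ γ :=
      fun γ => hasFDerivAt_postcomp h1 γ
    push_cast
    rw [contDiff_succ_iff_fderiv]
    refine ⟨fun γ => (hd γ).differentiableAt, by simp, ?_⟩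
    have : fderiv ℝ (postcomp (K := K) f hf.continuous) = fun γ => evalPointwise F G
        (postcomp (fderiv ℝ f) (h1.continuous_fderiv one_ne_zero) γ) :=
      funext fun γ => (hd γ).fderiv
    rw [this]
    have hf' : ContDiff ℝ ∞ (fderiv ℝ f) := (contDiff_infty_iff_fderiv.1 hf).2
    exact (evalPointwise F G).contDiff.comp (ih hf')

theorem contDiff_postcomp {F G : Type u} [NormedAddCommGroup F] [NormedSpace ℝ F]
    [NormedAddCommGroup G] [NormedSpace ℝ G] {f : F → G} (hf : ContDiff ℝ ∞ f) :
    ContDiff ℝ ∞ (postcomp (K := K) f hf.continuous) :=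
  contDiff_infty.2 fun n => contDiff_postcomp_nat n hf

end Nemytskii

/-! ### Local flows from the implicit function theorem -/

section LocalFlow

variable {F : Type*} [NormedAddCommGroup F] [NormedSpace ℝ F] [CompleteSpace F]

/-- Integration from `0` on `[-1, 1]`, as a continuous linear map. -/
def integralFromZero (F : Type*) [NormedAddCommGroup F] [NormedSpace ℝ F] [CompleteSpace F] :
    C(Icc (-1 : ℝ) 1, F) →L[ℝ] C(Icc (-1 : ℝ) 1, F) :=
  LinearMap.mkContinuous
    { toFun := fun g => ⟨fun s => ∫ σ in (0 : ℝ)..s, g (projIcc (-1) 1 (by norm_num) σ), by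
        have h : Continuous fun σ => g (projIcc (-1 : ℝ) 1 (by norm_num) σ) :=
          g.continuous.comp continuous_projIcc
        exact (intervalIntegral.continuous_primitive (fun a b => h.intervalIntegrable a b) 0).comp
          continuous_subtype_val⟩
      map_add' := fun g g' => by
        ext s
        have h : ∀ g : C(Icc (-1 : ℝ) 1, F),
            Continuous fun σ => g (projIcc (-1 : ℝ) 1 (by norm_num) σ) :=
          fun g => g.continuous.comp continuous_projIcc
        exact intervalIntegral.integral_add ((h g).intervalIntegrable _ _)
          ((h g').intervalIntegrable _ _)
      map_smul' := fun c g => by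
        ext s
        exact intervalIntegral.integral_smul c _ } 1 (fun g => by
      rw [ContinuousMap.norm_le _ (by positivity)]
      intro s
      refine (intervalIntegral.norm_integral_le_of_norm_le_const (C := ‖g‖)
        fun σ _ => g.norm_coe_le_norm _).trans ?_
      rw [sub_zero, one_mul]
      have : |(s : ℝ)| ≤ 1 := abs_le.2 s.2
      nlinarith [norm_nonneg g])

/-- A smooth vector field on a Banach space has a local flow that is smooth in time and initial
value. -/
theorem exists_contDiffAt_localFlow {v : F → F} (hv : ContDiff ℝ ∞ v) (x₀ : F) :
    ∃ α : ℝ × F → F, ContDiffAt ℝ ∞ α (0, x₀) ∧ ∀ᶠ p in 𝓝 ((0 : ℝ), x₀),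
      α (0, p.2) = p.2 ∧ HasDerivAt (fun t => α (t, p.2)) (v (α p)) p.1 := by
  let C := C(Icc (-1 : ℝ) 1, F)
  let cst : F →L[ℝ] C := ContinuousLinearMap.const ℝ _
  let N : C → C := postcomp v hv.continuous
  have hN : ContDiff ℝ ∞ N := contDiff_postcomp hv
  -- A zero of G is a curve with γ(s) = x + t ∫₀ˢ v(γ(σ)) dσ, that is, the integral curve from x
  -- with time rescaled by t, so that all curves live on the fixed interval [-1,1].
  let G : (ℝ × F) × C → C := fun p => p.2 - cst p.1.2 - p.1.1 • integralFromZero F (N p.2)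
  have hG : ContDiff ℝ ∞ G := by
    refine ((contDiff_snd).sub (cst.contDiff.comp (contDiff_snd.comp contDiff_fst))).sub ?_
    exact (contDiff_fst.comp contDiff_fst).smul
      ((integralFromZero F).contDiff.comp (hN.comp contDiff_snd))
  let u : (ℝ × F) × C := ((0, x₀), cst x₀)
  have hGu : G u = 0 := by simp [G, u]
  have hn : (∞ : WithTop ℕ∞) ≠ 0 := by simp
  -- At t = 0 the integral term drops out, so the partial derivative in the curve is the identity
  -- and the implicit function theorem applies.
  have hdG : fderiv ℝ G u ∘L .inr ℝ (ℝ × F) C = .id ℝ C := by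
    have h1 : HasFDerivAt G (fderiv ℝ G u) u := ((hG.differentiable hn) u).hasFDerivAt
    have h2 : HasFDerivAt (fun γ : C => ((0, x₀), γ)) (.inr ℝ (ℝ × F) C) (cst x₀) :=
      hasFDerivAt_prodMk_right _ _
    have h3 := HasFDerivAt.comp (cst x₀) (g := G) (f := fun γ : C => ((0, x₀), γ)) h1 h2
    have h4 : HasFDerivAt (G ∘ fun γ : C => (((0 : ℝ), x₀), γ)) (.id ℝ C) (cst x₀) := by
      have : (G ∘ fun γ : C => (((0 : ℝ), x₀), γ)) = fun γ => γ - cst x₀ := by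
        ext1 γ
        simp [G]
      rw [this]
      exact (hasFDerivAt_id _).sub_const _
    exact h3.unique h4
  have hinv : (fderiv ℝ G u ∘L .inr ℝ (ℝ × F) C).IsInvertible := by
    rw [hdG]
    exact ⟨ContinuousLinearEquiv.refl ℝ C, rfl⟩
  have hGA : ContDiffAt ℝ ∞ G u := hG.contDiffAt
  let ψ : ℝ × F → C := hGA.implicitFunction hn hinv
  have hψ : ContDiffAt ℝ ∞ ψ (0, x₀) := hGA.contDiffAt_implicitFunction hn hinv
  have hψ0 : ψ (0, x₀) = cst x₀ := hGA.implicitFunction_apply_self hn hinv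
  have hiff := hGA.eventually_apply_eq_iff_implicitFunction hn hinv
  rw [hGu] at hiff
  obtain ⟨δ, hδ, hball⟩ := Metric.eventually_nhds_iff_ball.1 hiff
  have hclose : ∀ᶠ p in 𝓝 ((0 : ℝ), x₀), ψ p ∈ Metric.ball (cst x₀) δ :=
    hψ.continuousAt.eventually_mem (by rw [hψ0]; exact Metric.ball_mem_nhds _ hδ)
  obtain ⟨δ', hδ', hball'⟩ := Metric.eventually_nhds_iff_ball.1 hclose
  let ε : ℝ := min δ δ' / 2
  have hε : 0 < ε := by positivity
  have hεδ : ε < δ := by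
    have := min_le_left δ δ'
    have h0 : 0 < min δ δ' := by positivity
    simp only [ε]; linarith
  have hεδ' : ε < δ' := by
    have := min_le_right δ δ'
    have h0 : 0 < min δ δ' := by positivity
    simp only [ε]; linarith
  let one : Icc (-1 : ℝ) 1 := ⟨1, by norm_num, le_rfl⟩
  -- the reparametrised curve solves the fixed point equation
  have hmem : ∀ t x, |t| ≤ ε → ‖x - x₀‖ < ε → (t, x) ∈ Metric.ball ((0 : ℝ), x₀) δ' := by
    intro t x ht hx
    rw [Metric.mem_ball, Prod.dist_eq, max_lt_iff, Real.dist_eq, sub_zero, dist_eq_norm]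
    exact ⟨ht.trans_lt hεδ', hx.trans hεδ'⟩
  have hmemu : ∀ t x (γ : C), |t| ≤ ε → ‖x - x₀‖ < ε → γ ∈ Metric.ball (cst x₀) δ →
      ((t, x), γ) ∈ Metric.ball u δ := by
    intro t x γ ht hx hγ
    rw [Metric.mem_ball, Prod.dist_eq, max_lt_iff, Prod.dist_eq, max_lt_iff, Real.dist_eq,
      sub_zero, dist_eq_norm]
    exact ⟨⟨ht.trans_lt hεδ, hx.trans hεδ⟩, hγ⟩
  have hsol : ∀ t x, |t| ≤ ε → ‖x - x₀‖ < ε → ∀ s : Icc (-1 : ℝ) 1, ψ (t, x) s =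
      x + t • ∫ σ in (0 : ℝ)..s, v (ψ (t, x) (projIcc (-1) 1 (by norm_num) σ)) := by
    intro t x ht hx s
    have h := (hball _ (hmemu t x _ ht hx (hball' _ (hmem t x ht hx)))).2 rfl
    have h2 := DFunLike.congr_fun h s
    have h3 : ψ (t, x) s - x - t • ∫ σ in (0 : ℝ)..s,
      v (ψ (t, x) (projIcc (-1) 1 (by norm_num) σ)) = 0 := h2
    rw [sub_sub, sub_eq_zero] at h3
    exact h3
  -- The curve for parameter t is the curve for ε run at speed t/ε: the slowed curve solves the
  -- equation for (t, x) and stays in the ball where solutions are unique. The dependence on t then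
  -- sits in the upper limit of an integral and can be differentiated.
  have hscale : ∀ t x, |t| ≤ ε → ‖x - x₀‖ < ε →
      ψ (t, x) one = ψ (ε, x) (projIcc (-1) 1 (by norm_num) (t / ε)) := by
    intro t x ht hx
    have hεε : |ε| ≤ ε := (abs_of_pos hε).le
    have hcon : |t / ε| ≤ 1 := by
      rw [abs_div, abs_of_pos hε]
      exact (div_le_one hε).2 ht
    have hcs : ∀ s : Icc (-1 : ℝ) 1, t / ε * s ∈ Icc (-1 : ℝ) 1 := fun s => by
      rw [mem_Icc, ← abs_le, abs_mul]
      exact mul_le_one₀ hcon (abs_nonneg _) (abs_le.2 s.2)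
    let η : C := ⟨fun s => ψ (ε, x) (projIcc (-1) 1 (by norm_num) (t / ε * s)), by
      exact (ψ (ε, x)).continuous.comp (continuous_projIcc.comp (by fun_prop))⟩
    have hη : η ∈ Metric.ball (cst x₀) δ := by
      refine lt_of_le_of_lt ?_ (Metric.mem_ball.1 (hball' _ (hmem ε x hεε hx)))
      rw [ContinuousMap.dist_le dist_nonneg]
      intro s
      exact (ContinuousMap.dist_apply_le_dist (f := ψ (ε, x)) (g := cst x₀)
        (projIcc (-1) 1 (by norm_num) (t / ε * s)))
    have hGη : G ((t, x), η) = 0 := by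
      ext s
      change η s - x - t • ∫ σ in (0 : ℝ)..s, v (η (projIcc (-1) 1 (by norm_num) σ)) = 0
      rw [sub_sub, sub_eq_zero]
      change ψ (ε, x) (projIcc (-1) 1 (by norm_num) (t / ε * s)) = _
      rw [hsol ε x hεε hx, projIcc_of_mem _ (hcs s)]
      congr 1
      change ε • ∫ σ in (0 : ℝ)..t / ε * s, _ = _
      have h1 : t • ∫ σ in (0 : ℝ)..s, v (η (projIcc (-1) 1 (by norm_num) σ)) =
          ε • ((t / ε) • ∫ σ in (0 : ℝ)..s,
            v (ψ (ε, x) (projIcc (-1) 1 (by norm_num) (t / ε * σ)))) := by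
        rw [smul_smul, mul_div_cancel₀ _ hε.ne']
        congr 1
        refine intervalIntegral.integral_congr fun σ hσ => ?_
        have hσ' : σ ∈ Icc (-1 : ℝ) 1 :=
          (uIcc_subset_Icc (by norm_num) s.2) hσ
        simp only [projIcc_of_mem _ hσ']
        rfl
      rw [h1, intervalIntegral.smul_integral_comp_mul_left
        (fun σ => v (ψ (ε, x) (projIcc (-1) 1 (by norm_num) σ))), mul_zero]
    have h := (hball _ (hmemu t x η ht hx hη)).1 hGη
    have h2 := DFunLike.congr_fun h one
    change ψ (t, x) one = _ at h2
    rw [h2]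
    change ψ (ε, x) (projIcc (-1) 1 _ (t / ε * 1)) = _
    rw [mul_one]
  refine ⟨fun p => ψ p one, ?_, ?_⟩
  · exact (ContinuousMap.evalCLM ℝ one).contDiff.contDiffAt.comp _ hψ
  · have h1 : ∀ᶠ p in 𝓝 ((0 : ℝ), x₀), |p.1| < ε ∧ ‖p.2 - x₀‖ < ε := by
      refine Filter.Eventually.and ?_ ?_
      · have : Tendsto (fun p : ℝ × F => |p.1|) (𝓝 (0, x₀)) (𝓝 |(0 : ℝ)|) :=
          (continuous_fst.abs).tendsto _
        exact this.eventually_lt_const (by simpa using hε)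
      · have : Tendsto (fun p : ℝ × F => ‖p.2 - x₀‖) (𝓝 (0, x₀)) (𝓝 ‖x₀ - x₀‖) :=
          ((continuous_snd.sub continuous_const).norm).tendsto _
        exact this.eventually_lt_const (by simpa using hε)
    filter_upwards [h1] with p hp
    obtain ⟨t, x⟩ := p
    obtain ⟨ht, hx⟩ : |t| < ε ∧ ‖x - x₀‖ < ε := hp
    constructor
    · have := hsol 0 x (by simpa using hε.le) hx one
      simpa using this
    · have hcon : t / ε ∈ Ioo (-1 : ℝ) 1 := by
        rw [mem_Ioo, ← abs_lt, abs_div, abs_of_pos hε]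
        exact (div_lt_one hε).2 ht
      let w : ℝ → F := fun σ => v (ψ (ε, x) (projIcc (-1) 1 (by norm_num) σ))
      have hw : Continuous w :=
        hv.continuous.comp ((ψ (ε, x)).continuous.comp continuous_projIcc)
      have hev : (fun t' => ψ (t', x) one) =ᶠ[𝓝 t]
          fun t' => x + ε • ∫ σ in (0 : ℝ)..t' / ε, w σ := by
        have : ∀ᶠ t' in 𝓝 t, |t'| < ε := (continuous_abs.tendsto t).eventually_lt_const ht
        filter_upwards [this] with t' ht'
        rw [hscale t' x ht'.le hx, hsol ε x (abs_of_pos hε).le hx]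
        have : t' / ε ∈ Icc (-1 : ℝ) 1 := by
          rw [mem_Icc, ← abs_le, abs_div, abs_of_pos hε]
          exact ((div_lt_one hε).2 ht').le
        rw [projIcc_of_mem _ this]
      refine HasDerivAt.congr_of_eventuallyEq ?_ hev
      have hi : HasDerivAt (fun y => ∫ σ in (0 : ℝ)..y, w σ) (w (t / ε)) (t / ε) :=
        intervalIntegral.integral_hasDerivAt_right (hw.intervalIntegrable _ _)
          (hw.stronglyMeasurableAtFilter _ _) hw.continuousAt
      have hd : HasDerivAt (fun t' : ℝ => t' / ε) (1 / ε) t := (hasDerivAt_id t).div_const ε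
      have h5 := ((hi.scomp t hd).const_smul ε).const_add x
      convert! h5 using 1
      rw [smul_smul, mul_one_div_cancel hε.ne', one_smul]
      exact congrArg v (hscale t x ht.le hx)

end LocalFlow

/-! ## Vector fields and their flows on manifolds -/

section VectorFields

variable {EN : Type*} [NormedAddCommGroup EN] [NormedSpace ℝ EN]
  {HN : Type*} [TopologicalSpace HN] {J : ModelWithCorners ℝ EN HN}
  {N : Type*} [TopologicalSpace N] [ChartedSpace HN N] [IsManifold J ∞ N]
  {EQ : Type*} [NormedAddCommGroup EQ] [NormedSpace ℝ EQ]
  {HQ : Type*} [TopologicalSpace HQ] {JQ : ModelWithCorners ℝ EQ HQ}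
  {Q : Type*} [TopologicalSpace Q] [ChartedSpace HQ Q]

/-- Smoothness of a map to the tangent bundle, tested in a chart. -/
theorem contMDiffAt_tangentBundle_iff {ν : Q → N} {ξ : ∀ q, TangentSpace J (ν q)} {q₀ : Q} {c : N}
    (hc : ν q₀ ∈ (chartAt HN c).source) :
    ContMDiffAt JQ J.tangent ∞ (fun q => (⟨ν q, ξ q⟩ : TangentBundle J N)) q₀ ↔
      ContMDiffAt JQ J ∞ ν q₀ ∧ ContMDiffAt JQ 𝓘(ℝ, EN) ∞
        (fun q => (mfderiv J 𝓘(ℝ, EN) (extChartAt J c) (ν q) (ξ q) : EN)) q₀ := by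
  have hsrc : (⟨ν q₀, ξ q₀⟩ : TangentBundle J N) ∈
      (trivializationAt EN (TangentSpace J) c).source := by
    rw [Trivialization.mem_source, TangentBundle.trivializationAt_baseSet]
    exact hc
  rw [Trivialization.contMDiffAt_iff (IB := J) (n := ∞)
    (e := trivializationAt EN (TangentSpace J) c)
    (f := fun q => (⟨ν q, ξ q⟩ : TangentBundle J N)) hsrc]
  refine and_congr_right fun hν => ?_
  refine Filter.EventuallyEq.contMDiffAt_iff ?_
  have hev : ∀ᶠ q in 𝓝 q₀, ν q ∈ (chartAt HN c).source :=
    hν.continuousAt.eventually_mem ((chartAt HN c).open_source.mem_nhds hc)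
  filter_upwards [hev] with q hq
  have hqb : ν q ∈ (trivializationAt EN (TangentSpace J) c).baseSet := by
    rwa [TangentBundle.trivializationAt_baseSet]
  have h1 := DFunLike.congr_fun
    (TangentBundle.continuousLinearMapAt_trivializationAt (𝕜 := ℝ) (I := J) hq) (ξ q)
  have h2 : (trivializationAt EN (TangentSpace J) c).continuousLinearMapAt ℝ (ν q) (ξ q) =
      (trivializationAt EN (TangentSpace J) c ⟨ν q, ξ q⟩).2 := by
    rw [Trivialization.continuousLinearMapAt_apply, Trivialization.coe_linearMapAt_of_mem _ hqb]
  exact h2.symm.trans h1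

variable [FiniteDimensional ℝ EN] [J.Boundaryless]

/-- A smooth vector field has, near every point, a flow that is smooth in time and initial value. -/
theorem exists_contMDiffAt_localFlow {X : ∀ x : N, TangentSpace J x}
    (hX : ContMDiff J J.tangent ∞ fun x => (⟨x, X x⟩ : TangentBundle J N)) (p₀ : N) :
    ∃ α : ℝ × N → N, ContMDiffAt (𝓘(ℝ, ℝ).prod J) J ∞ α (0, p₀) ∧ ∀ᶠ p in 𝓝 ((0 : ℝ), p₀),
      α (0, p.2) = p.2 ∧ HasMFDerivAt 𝓘(ℝ, ℝ) J (fun t => α (t, p.2)) p.1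
        ((1 : ℝ →L[ℝ] ℝ).smulRight (X (α p))) := by
  have : CompleteSpace EN := FiniteDimensional.complete ℝ EN
  set χ := extChartAt J p₀ with hχ
  let v' : EN → EN := fun y => mfderiv J 𝓘(ℝ, EN) χ (χ.symm y) (X (χ.symm y))
  have htarget : IsOpen χ.target := isOpen_extChartAt_target p₀
  have hv' : ∀ y ∈ χ.target, ContDiffAt ℝ ∞ v' y := by
    intro y hy
    have hys : χ.symm y ∈ (chartAt HN p₀).source := by
      have := χ.map_target hy
      rwa [hχ, extChartAt_source] at this
    have h1 := ((contMDiffAt_tangentBundle_iff (ν := fun x : N => x) (ξ := X) hys).1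
      (hX.contMDiffAt)).2
    have h2 : ContMDiffAt 𝓘(ℝ, EN) J ∞ χ.symm y :=
      (contMDiffOn_extChartAt_symm p₀).contMDiffAt (htarget.mem_nhds hy)
    exact contMDiffAt_iff_contDiffAt.1 (h1.comp y h2)
  obtain ⟨r, hr, hrsub⟩ := Metric.mem_nhds_iff.1 (htarget.mem_nhds (mem_extChartAt_target p₀))
  -- The cut-off extends the field read in the chart to all of EN. It is supported inside the chart
  -- target and leaves the field unchanged on the ball of radius r/4, where short orbits stay.
  let ρ : ContDiffBump (χ p₀) := ⟨r / 4, r / 2, by positivity, by linarith⟩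
  have hρsub : Metric.closedBall (χ p₀) (r / 2) ⊆ χ.target :=
    (Metric.closedBall_subset_ball (by linarith)).trans hrsub
  let v : EN → EN := fun y => ρ y • v' y
  have hv : ContDiff ℝ ∞ v := by
    rw [contDiff_iff_contDiffAt]
    intro y
    by_cases hy : y ∈ χ.target
    · exact ρ.contDiff.contDiffAt.smul (hv' y hy)
    · have : v =ᶠ[𝓝 y] fun _ => 0 := by
        have hy' : y ∈ (Metric.closedBall (χ p₀) (r / 2))ᶜ := fun h => hy (hρsub h)
        filter_upwards [Metric.isClosed_closedBall.isOpen_compl.mem_nhds hy'] with z hz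
        have : ρ z = 0 := ρ.zero_of_le_dist (by
          have : ¬ dist z (χ p₀) ≤ r / 2 := hz
          exact (not_le.1 this).le)
        simp [v, this]
      exact contDiffAt_const.congr_of_eventuallyEq this
  have hvv' : ∀ y ∈ Metric.ball (χ p₀) (r / 4), v y = v' y := by
    intro y hy
    have : ρ y = 1 := ρ.one_of_mem_closedBall (Metric.ball_subset_closedBall hy)
    simp [v, this]
  obtain ⟨α, hα, hαev⟩ := exists_contDiffAt_localFlow hv (χ p₀)
  have hα0 : α (0, χ p₀) = χ p₀ := hαev.self_of_nhds.1
  have hχc : ContMDiffAt J 𝓘(ℝ, EN) ∞ χ p₀ := contMDiffAt_extChartAt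
  have hpair : ContMDiffAt (𝓘(ℝ, ℝ).prod J) 𝓘(ℝ, ℝ × EN) ∞ (fun p : ℝ × N => (p.1, χ p.2))
      (0, p₀) := by
    rw [modelWithCornersSelf_prod, ← chartedSpaceSelf_prod]
    exact contMDiffAt_fst.prodMk (hχc.comp (0, p₀) contMDiffAt_snd)
  have hcomp : ContMDiffAt (𝓘(ℝ, ℝ).prod J) 𝓘(ℝ, EN) ∞ (fun p : ℝ × N => α (p.1, χ p.2))
      (0, p₀) := hα.contMDiffAt.comp (0, p₀) hpair
  have hmem : ∀ᶠ p in 𝓝 ((0 : ℝ), p₀), α (p.1, χ p.2) ∈ Metric.ball (χ p₀) (r / 4) := by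
    refine hcomp.continuousAt.eventually_mem ?_
    simp only [hα0]
    exact Metric.ball_mem_nhds _ (by positivity)
  have hball : Metric.ball (χ p₀) (r / 4) ⊆ χ.target :=
    (Metric.ball_subset_ball (by linarith)).trans hrsub
  refine ⟨fun p => χ.symm (α (p.1, χ p.2)), ?_, ?_⟩
  · refine ContMDiffAt.comp (0, p₀) (I' := 𝓘(ℝ, EN)) (g := χ.symm) ?_ hcomp
    rw [hα0]
    exact (contMDiffOn_extChartAt_symm p₀).contMDiffAt
      (htarget.mem_nhds (mem_extChartAt_target p₀))
  · have hev2 : ∀ᶠ p in 𝓝 ((0 : ℝ), p₀), α (0, χ p.2) = χ p.2 ∧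
        HasDerivAt (fun t => α (t, χ p.2)) (v (α (p.1, χ p.2))) p.1 :=
      hpair.continuousAt.eventually hαev
    have hsrc : ∀ᶠ p in 𝓝 ((0 : ℝ), p₀), p.2 ∈ χ.source :=
      continuousAt_snd.eventually_mem (extChartAt_source_mem_nhds p₀)
    filter_upwards [hev2, hmem, hsrc] with p hp hpm hps
    refine ⟨?_, ?_⟩
    · rw [hp.1, χ.left_inv hps]
    · have h1 := hp.2
      rw [hvv' _ hpm] at h1
      have hy := hball hpm
      have h2 : MDifferentiableAt 𝓘(ℝ, EN) J χ.symm (α (p.1, χ p.2)) :=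
        ((contMDiffOn_extChartAt_symm (n := ∞) p₀).contMDiffAt
          (htarget.mem_nhds hy)).mdifferentiableAt (by simp)
      have h3 := h2.hasMFDerivAt.comp p.1 h1.hasFDerivAt.hasMFDerivAt
      have h4 := mfderivWithin_extChartAt_symm_comp_mfderiv_extChartAt (I := J) hy
      rw [J.range_eq_univ, mfderivWithin_univ] at h4
      have h5 := DFunLike.congr_fun h4 (X (χ.symm (α (p.1, χ p.2))))
      refine h3.congr_mfderiv (ContinuousLinearMap.ext_ring ?_)
      refine Eq.trans ?_ (h5.trans (one_smul ℝ _).symm)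
      exact congrArg (mfderiv 𝓘(ℝ, EN) J χ.symm (α (p.1, χ p.2))) (one_smul ℝ (v' (α (p.1, χ p.2))))

end VectorFields

/-! ### Completeness and smoothness of flows with many symmetries -/

section GlobalFlow

variable {EN : Type*} [NormedAddCommGroup EN] [NormedSpace ℝ EN] [FiniteDimensional ℝ EN]
  {HN : Type*} [TopologicalSpace HN] {J : ModelWithCorners ℝ EN HN} [J.Boundaryless]
  {N : Type*} [TopologicalSpace N] [ChartedSpace HN N] [IsManifold J ∞ N] [T2Space N]

/-- A map that preserves a vector field maps integral curves to integral curves. -/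
theorem IsMIntegralCurveOn.map {X : ∀ x : N, TangentSpace J x} {γ : ℝ → N} {s : Set ℝ}
    (hγ : IsMIntegralCurveOn γ X s) {S : N → N} (hS : ContMDiff J J ∞ S)
    (hSX : ∀ x, mfderiv J J S x (X x) = X (S x)) : IsMIntegralCurveOn (S ∘ γ) X s := by
  intro t ht
  have h1 : HasMFDerivAt J J S (γ t) (mfderiv J J S (γ t)) :=
    ((hS.mdifferentiable (by simp)) (γ t)).hasMFDerivAt
  have h := HasMFDerivAt.comp_hasMFDerivWithinAt t h1 (hγ t ht)
  refine ⟨h.1, h.2.congr_fderiv (ContinuousLinearMap.ext_ring ?_)⟩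
  refine Eq.trans ?_ ((hSX (γ t)).trans (one_smul ℝ (X (S (γ t)))).symm)
  exact congrArg (mfderiv J J S (γ t)) (one_smul ℝ (X (γ t)))

/-- A smooth vector field is complete, with smooth flow, if a compact set meets every
neighbourhood-translate: every point can be moved into every neighbourhood of the compact set by a
diffeomorphism that preserves the field. -/
theorem exists_globalFlow {X : ∀ x : N, TangentSpace J x}
    (hX : ContMDiff J J.tangent ∞ fun x => (⟨x, X x⟩ : TangentBundle J N)) {K : Set N}
    (hK : IsCompact K)
    (hsym : ∀ O : Set N, K ⊆ O → IsOpen O → ∀ p, ∃ S : Diffeomorph J J N N ∞,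
      (∀ x, mfderiv J J S x (X x) = X (S x)) ∧ ∃ q ∈ O, S q = p) :
    ∃ Φ : ℝ × N → N, ContMDiff (𝓘(ℝ, ℝ).prod J) J ∞ Φ ∧ (∀ p, Φ (0, p) = p) ∧
      ∀ p, IsMIntegralCurve (fun t => Φ (t, p)) X := by
  have hX1 : ContMDiff J J.tangent 1 fun x => (⟨x, X x⟩ : TangentBundle J N) :=
    hX.of_le (mod_cast le_top)
  have huniq : ∀ {γ γ' : ℝ → N}, IsMIntegralCurve γ X → IsMIntegralCurve γ' X → γ 0 = γ' 0 →
      γ = γ' := fun h h' h0 => isMIntegralCurve_Ioo_eq_of_contMDiff_boundaryless (t₀ := 0) hX1 h h' h0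
  -- uniform statements near the compact set
  have hunif : ∀ P : ℝ × N → Prop, (∀ q ∈ K, ∀ᶠ x in 𝓝 ((0 : ℝ), q), P x) →
      ∃ ε > 0, ∃ O : Set N, K ⊆ O ∧ IsOpen O ∧ ∀ t, |t| < ε → ∀ q ∈ O, P (t, q) := by
    intro P hP
    have h1 : ∀ᶠ x in 𝓝ˢ (({0} : Set ℝ) ×ˢ K), P x := by
      rw [eventually_nhdsSet_iff_forall]
      rintro ⟨t, q⟩ ⟨ht, hq⟩
      obtain rfl : t = 0 := ht
      exact hP q hq
    rw [(isCompact_singleton (x := (0 : ℝ))).nhdsSet_prod_eq hK, nhdsSet_singleton] at h1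
    obtain ⟨U, hU, O, hO, hUO⟩ := Filter.mem_prod_iff.1 h1
    obtain ⟨ε, hε, hεU⟩ := Metric.mem_nhds_iff.1 hU
    obtain ⟨O', hO', hKO', hO'O⟩ := mem_nhdsSet_iff_exists.1 hO
    refine ⟨ε, hε, O', hKO', hO', fun t ht q hq => hUO (mk_mem_prod (hεU ?_) (hO'O hq))⟩
    rwa [Metric.mem_ball, Real.dist_eq, sub_zero]
  -- existence of local curves with a uniform life time
  have hlocal : ∀ q₀ : N, ∃ α : ℝ × N → N, ContMDiffAt (𝓘(ℝ, ℝ).prod J) J ∞ α (0, q₀) ∧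
      ∃ ε > 0, ∃ O ∈ 𝓝 q₀, ∀ q ∈ O, α (0, q) = q ∧
        IsMIntegralCurveOn (fun t => α (t, q)) X (Ioo (-ε) ε) := by
    intro q₀
    obtain ⟨α, hα, hev⟩ := exists_contMDiffAt_localFlow hX q₀
    refine ⟨α, hα, ?_⟩
    rw [nhds_prod_eq] at hev
    obtain ⟨U, hU, O, hO, hUO⟩ := Filter.mem_prod_iff.1 hev
    obtain ⟨ε, hε, hεU⟩ := Metric.mem_nhds_iff.1 hU
    refine ⟨ε, hε, O, hO, fun q hq => ⟨(hUO (mk_mem_prod (mem_of_mem_nhds hU) hq)).1, ?_⟩⟩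
    intro t ht
    have htU : t ∈ U := hεU (by rwa [Real.ball_eq_Ioo, zero_sub, zero_add])
    exact (hUO (mk_mem_prod htU hq)).2.hasMFDerivWithinAt
  have hcurve : ∃ ε > 0, ∀ p : N, ∃ γ : ℝ → N, γ 0 = p ∧ IsMIntegralCurveOn γ X (Ioo (-ε) ε) := by
    -- The life time is encoded as a property of pairs (t, q), namely that a curve through q
    -- survives beyond every |s| ≤ |t|, so that the uniformity statement near K applies to it.
    obtain ⟨ε, hε, O, hKO, hO, h⟩ := hunif (fun x => ∀ s, |s| ≤ |x.1| → ∃ δ > |s|, ∃ γ : ℝ → N,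
        γ 0 = x.2 ∧ IsMIntegralCurveOn γ X (Ioo (-δ) δ)) (by
      intro q₀ _
      obtain ⟨α, -, ε, hε, O, hO, h⟩ := hlocal q₀
      have h1 : ∀ᶠ x in 𝓝 ((0 : ℝ), q₀), |x.1| < ε := by
        have : Tendsto (fun p : ℝ × N => |p.1|) (𝓝 (0, q₀)) (𝓝 |(0 : ℝ)|) :=
          (continuous_fst.abs).tendsto _
        exact this.eventually_lt_const (by simpa using hε)
      have h2 : ∀ᶠ x in 𝓝 ((0 : ℝ), q₀), x.2 ∈ O := continuousAt_snd.eventually_mem hO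
      filter_upwards [h1, h2] with x hx1 hx2 s hs
      exact ⟨ε, hs.trans_lt hx1, fun t => α (t, x.2), (h x.2 hx2).1, (h x.2 hx2).2⟩)
    refine ⟨ε / 2, by positivity, fun p => ?_⟩
    -- A symmetry carries the curve through a point q near K to one through p, with the same life
    -- time.
    obtain ⟨S, hSX, q, hq, rfl⟩ := hsym O hKO hO p
    have hε2 : |ε / 2| = ε / 2 := abs_of_pos (by positivity)
    obtain ⟨δ, hδ, γ, hγ0, hγ⟩ := h (ε / 2) (by rw [hε2]; linarith) q hq (ε / 2) le_rfl
    rw [hε2] at hδ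
    refine ⟨S ∘ γ, congrArg S hγ0, IsMIntegralCurveOn.map (hγ.mono ?_) S.contMDiff hSX⟩
    exact Ioo_subset_Ioo (by linarith) hδ.le
  obtain ⟨ε₀, hε₀, hcurve⟩ := hcurve
  choose Φ' hΦ0 hΦ using fun p => exists_isMIntegralCurve_of_isMIntegralCurveOn hX1 hε₀ hcurve p
  let Φ : ℝ × N → N := fun x => Φ' x.2 x.1
  have hgroup : ∀ s t p, Φ (s + t, p) = Φ (s, Φ (t, p)) := by
    intro s t p
    have h1 : IsMIntegralCurve (fun s => Φ' p (s + t)) X := (hΦ p).comp_add t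
    exact congrFun (huniq h1 (hΦ (Φ' p t)) (by
      simp only [zero_add]; exact (hΦ0 _).symm)) s
  have hequiv : ∀ S : Diffeomorph J J N N ∞, (∀ x, mfderiv J J S x (X x) = X (S x)) →
      ∀ t q, Φ (t, S q) = S (Φ (t, q)) := by
    intro S hS t q
    have h1 : IsMIntegralCurve (S ∘ Φ' q) X := by
      rw [isMIntegralCurve_iff_isMIntegralCurveOn]
      exact IsMIntegralCurveOn.map ((hΦ q).isMIntegralCurveOn _) S.contMDiff hS
    exact congrFun (huniq (hΦ (S q)) h1 (by rw [hΦ0, Function.comp_apply, hΦ0])) t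
  have hzero : ∀ p, ContMDiffAt (𝓘(ℝ, ℝ).prod J) J ∞ Φ (0, p) := by
    intro p
    obtain ⟨α, hα, ε, hε, O, hO, h⟩ := hlocal p
    refine hα.congr_of_eventuallyEq ?_
    have h1 : Ioo (-ε) ε ×ˢ O ∈ 𝓝 ((0 : ℝ), p) :=
      prod_mem_nhds (Ioo_mem_nhds (by linarith) hε) hO
    filter_upwards [h1] with x hx
    have h2 := isMIntegralCurveOn_Ioo_eqOn_of_contMDiff_boundaryless (t₀ := 0)
      (a := -ε) (b := ε) ⟨by linarith, hε⟩ hX1 ((hΦ x.2).isMIntegralCurveOn _) (h x.2 hx.2).2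
      (by rw [hΦ0, (h x.2 hx.2).1])
    exact h2 hx.1
  refine ⟨Φ, ?_, hΦ0, hΦ⟩
  -- Being C^n at a point is an open condition for finite n only, so smoothness is proved order by
  -- order. The short time on which it is known depends on n.
  rw [contMDiff_infty]
  intro n
  have hn : ((n : ℕ∞) : WithTop ℕ∞) ≠ ∞ := by
    intro h
    exact absurd (WithTop.coe_injective h) (by simp)
  obtain ⟨ε, hε, O, hKO, hO, h⟩ := hunif (fun x => ContMDiffAt (𝓘(ℝ, ℝ).prod J) J n Φ x) (by
    intro q _
    have : IsManifold J n N := IsManifold.of_le (n := ∞) (mod_cast le_top)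
    exact (contMDiffAt_iff_contMDiffAt_nhds hn).1 ((hzero q).of_le (mod_cast le_top)))
  have hshort : ∀ t, |t| < ε → ∀ p, ContMDiffAt (𝓘(ℝ, ℝ).prod J) J n Φ (t, p) := by
    intro t ht p
    obtain ⟨S, hSX, q, hq, rfl⟩ := hsym O hKO hO p
    have h1 : Φ = fun x => S (Φ (x.1, S.symm x.2)) := by
      ext x
      rw [← hequiv S hSX, S.apply_symm_apply]
    rw [h1]
    have h2 : ContMDiffAt (𝓘(ℝ, ℝ).prod J) (𝓘(ℝ, ℝ).prod J) n
        (fun x : ℝ × N => (x.1, S.symm x.2)) (t, S q) :=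
      contMDiffAt_fst.prodMk
        (((S.symm.contMDiff).of_le (mod_cast le_top)).contMDiffAt.comp _ contMDiffAt_snd)
    have h3 : ContMDiffAt (𝓘(ℝ, ℝ).prod J) J n Φ (t, S.symm (S q)) := by
      rw [S.symm_apply_apply]
      exact h t ht q hq
    exact (((S.contMDiff).of_le (mod_cast le_top)).contMDiffAt).comp _
      (ContMDiffAt.comp (t, S q) (g := Φ) h3 h2)
  have hlong : ∀ m : ℕ, ∀ t, |t| < (m + 1) * ε → ∀ p,
      ContMDiffAt (𝓘(ℝ, ℝ).prod J) J n Φ (t, p) := by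
    intro m
    induction m with
    | zero => intro t ht; exact hshort t (by simpa using ht)
    | succ m ih =>
      intro t ht p
      push_cast at ht
      have hm : (0 : ℝ) < m + 1 + 1 := by positivity
      -- The group law splits time t into a piece t/(m+2), which is short, and a piece t(m+1)/(m+2),
      -- to which the induction hypothesis applies.
      have h1 : Φ = fun x => Φ (x.1 * ((m + 1) / (m + 1 + 1)), Φ (x.1 * (1 / (m + 1 + 1)), x.2)) := by
        ext x
        rw [← hgroup]
        congr 2
        field_simp
      rw [h1]
      have ha : |t * (1 / (m + 1 + 1))| < ε := by
        rw [abs_mul, abs_of_pos (by positivity : (0 : ℝ) < 1 / (m + 1 + 1)), mul_one_div,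
          div_lt_iff₀ hm]
        linarith
      have hb : |t * ((m + 1) / (m + 1 + 1))| < (m + 1) * ε := by
        rw [abs_mul, abs_of_pos (by positivity : (0 : ℝ) < (m + 1) / (m + 1 + 1)), mul_div_assoc',
          div_lt_iff₀ hm]
        have : (0 : ℝ) < m + 1 := by positivity
        nlinarith
      have hmul : ∀ c : ℝ, ContMDiffAt (𝓘(ℝ, ℝ).prod J) 𝓘(ℝ, ℝ) n
          (fun x : ℝ × N => x.1 * c) (t, p) := by
        intro c
        have : ContDiff ℝ n (fun s : ℝ => s * c) := contDiff_id.mul contDiff_const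
        exact this.contMDiff.contMDiffAt.comp (t, p) contMDiffAt_fst
      have h2 : ContMDiffAt (𝓘(ℝ, ℝ).prod J) J n
          (fun x : ℝ × N => Φ (x.1 * (1 / (m + 1 + 1)), x.2)) (t, p) :=
        ContMDiffAt.comp (t, p) (g := Φ) (hshort _ ha p) ((hmul _).prodMk contMDiffAt_snd)
      exact ContMDiffAt.comp (t, p) (g := Φ) (ih _ hb _) ((hmul _).prodMk h2)
  rintro ⟨t, p⟩
  obtain ⟨m, hm⟩ := exists_nat_gt (|t| / ε)
  refine hlong m t ?_ p
  rw [div_lt_iff₀ hε] at hm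
  nlinarith

end GlobalFlow

/-! ## Global frames, fibrewise linear functions and coordinate families -/

section CoordFamily

variable {EN : Type*} [NormedAddCommGroup EN] [NormedSpace ℝ EN] [FiniteDimensional ℝ EN]
  {HN : Type*} [TopologicalSpace HN] {J : ModelWithCorners ℝ EN HN}
  {N : Type*} [TopologicalSpace N] [ChartedSpace HN N] [IsManifold J ∞ N]
  {EQ : Type*} [NormedAddCommGroup EQ] [NormedSpace ℝ EQ]
  {HQ : Type*} [TopologicalSpace HQ] {JQ : ModelWithCorners ℝ EQ HQ}
  {Q : Type*} [TopologicalSpace Q] [ChartedSpace HQ Q]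

variable (J) in
/-- A family of smooth functions from which the charts can be recovered linearly, near every
point. -/
structure IsCoordFamily (G : Set (N → ℝ)) : Prop where
  smooth : ∀ g ∈ G, ContMDiff J 𝓘(ℝ, ℝ) ∞ g
  chart : ∀ x₀ : N, ∃ (n : ℕ) (g : Fin n → N → ℝ) (v : Fin n → EN), (∀ k, g k ∈ G) ∧
    (extChartAt J x₀ : N → EN) =ᶠ[𝓝 x₀] fun x => ∑ k, g k x • v k

/-- Where the chart is a constant-coefficient combination of the functions g k, its differential on
X is the same combination of the derivatives X(g k). Hence tangent vectors, and smoothness of maps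
into the tangent bundle, can be tested on the functions of a coordinate family. -/
theorem mfderiv_extChartAt_eq_sum {n : ℕ} {g : Fin n → N → ℝ} {v : Fin n → EN} {x₀ x : N}
    (hg : ∀ k, ContMDiff J 𝓘(ℝ, ℝ) ∞ (g k))
    (h : (extChartAt J x₀ : N → EN) =ᶠ[𝓝 x] fun x => ∑ k, g k x • v k) (X : TangentSpace J x) :
    (mfderiv J 𝓘(ℝ, EN) (extChartAt J x₀) x X : EN) = ∑ k, dirDeriv X (g k) • v k := by
  have h1 : ∀ k, HasMFDerivAt J 𝓘(ℝ, ℝ) (g k) x (mfderiv J 𝓘(ℝ, ℝ) (g k) x) := fun k =>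
    ((hg k).mdifferentiable (by simp) x).hasMFDerivAt
  have h2 : HasMFDerivAt J 𝓘(ℝ, EN) (fun x => ∑ k, g k x • v k) x
      (∑ k, (ContinuousLinearMap.smulRight (1 : ℝ →L[ℝ] ℝ) (v k)).comp
        (mfderiv J 𝓘(ℝ, ℝ) (g k) x : EN →L[ℝ] ℝ) : EN →L[ℝ] EN) := by
    have h3 : HasMFDerivAt J 𝓘(ℝ, EN) (∑ k, fun x => g k x • v k) x
        (∑ k, (ContinuousLinearMap.smulRight (1 : ℝ →L[ℝ] ℝ) (v k)).comp
        (mfderiv J 𝓘(ℝ, ℝ) (g k) x : EN →L[ℝ] ℝ) : EN →L[ℝ] EN) := by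
      refine HasMFDerivAt.sum (t := Finset.univ) fun k _ => ?_
      exact ((ContinuousLinearMap.smulRight (1 : ℝ →L[ℝ] ℝ) (v k)).hasMFDerivAt).comp x (h1 k)
    refine h3.congr_of_eventuallyEq (Eventually.of_forall fun y => ?_)
    simp
  have h4 := (h2.congr_of_eventuallyEq h).mfderiv
  refine (DFunLike.congr_fun h4 X).trans ?_
  exact sum_apply (F := EN →L[ℝ] EN) (s := Finset.univ) (f := fun k =>
    (ContinuousLinearMap.smulRight (1 : ℝ →L[ℝ] ℝ) (v k)).comp
        (mfderiv J 𝓘(ℝ, ℝ) (g k) x : EN →L[ℝ] ℝ)) (x := (X : EN))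

theorem IsCoordFamily.contMDiffAt_tangent {G : Set (N → ℝ)} (hG : IsCoordFamily J G) {ν : Q → N}
    {ξ : ∀ q, TangentSpace J (ν q)} {q₀ : Q} (hν : ContMDiffAt JQ J ∞ ν q₀)
    (h : ∀ g ∈ G, ContMDiffAt JQ 𝓘(ℝ, ℝ) ∞ (fun q => dirDeriv (ξ q) g) q₀) :
    ContMDiffAt JQ J.tangent ∞ (fun q => (⟨ν q, ξ q⟩ : TangentBundle J N)) q₀ := by
  obtain ⟨n, g, v, hg, hchart⟩ := hG.chart (ν q₀)
  rw [contMDiffAt_tangentBundle_iff (mem_chart_source HN (ν q₀))]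
  refine ⟨hν, ?_⟩
  have h1 : ContMDiffAt JQ 𝓘(ℝ, EN) ∞ (fun q => ∑ k, dirDeriv (ξ q) (g k) • v k) q₀ := by
    refine ContMDiffAt.sum fun k _ => ?_
    exact (h _ (hg k)).smul contMDiffAt_const
  refine h1.congr_of_eventuallyEq ?_
  filter_upwards [hν.continuousAt.eventually (eventually_eventually_nhds.2 hchart)] with q hq
  exact mfderiv_extChartAt_eq_sum (fun k => hG.smooth _ (hg k)) hq (ξ q)

theorem IsCoordFamily.contMDiff_tangent {G : Set (N → ℝ)} (hG : IsCoordFamily J G) {ν : Q → N}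
    {ξ : ∀ q, TangentSpace J (ν q)} (hν : ContMDiff JQ J ∞ ν)
    (h : ∀ g ∈ G, ContMDiff JQ 𝓘(ℝ, ℝ) ∞ (fun q => dirDeriv (ξ q) g)) :
    ContMDiff JQ J.tangent ∞ (fun q => (⟨ν q, ξ q⟩ : TangentBundle J N)) := fun q =>
  hG.contMDiffAt_tangent (hν q) fun g hg => h g hg q

theorem IsCoordFamily.tangent_ext {G : Set (N → ℝ)} (hG : IsCoordFamily J G) {x : N}
    {X Y : TangentSpace J x} (h : ∀ g ∈ G, dirDeriv X g = dirDeriv Y g) : X = Y := by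
  obtain ⟨n, g, v, hg, hchart⟩ := hG.chart x
  have hinv := isInvertible_mfderiv_extChartAt (I := J) (mem_extChartAt_source (I := J) x)
  apply hinv.injective
  have h1 := fun Z => mfderiv_extChartAt_eq_sum (fun k => hG.smooth _ (hg k)) hchart Z
  refine (h1 X).trans (Eq.trans ?_ (h1 Y).symm)
  exact Finset.sum_congr rfl fun k _ => by rw [h _ (hg k)]

-- Components of the chart, cut off by a bump function equal to one near the point, are globally
-- smooth functions.
variable (J N) in
theorem isCoordFamily_contMDiff [T2Space N] :
    IsCoordFamily J {g : N → ℝ | ContMDiff J 𝓘(ℝ, ℝ) ∞ g} where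
  smooth _ hg := hg
  chart x₀ := by
    let χ : SmoothBumpFunction J x₀ := Classical.arbitrary _
    let β := Module.finBasis ℝ EN
    have hβ : ∀ k, ContMDiff 𝓘(ℝ, EN) 𝓘(ℝ, ℝ) ∞ (fun x => β.repr x k) := fun k =>
      ((β.coord k).toContinuousLinearMap.contDiff).contMDiff
    refine ⟨_, fun k x => χ x • β.repr (extChartAt J x₀ x) k, β, fun k => ?_, ?_⟩
    · refine χ.contMDiff_smul ?_
      exact ((hβ k).contMDiffOn (s := univ)).comp (contMDiffOn_extChartAt (n := ∞)) fun _ _ => mem_univ _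
    · filter_upwards [χ.eventuallyEq_one] with x hx
      simp only [hx, Pi.one_apply, one_smul]
      exact (β.sum_repr _).symm

/-- The linear coordinates on the real line. -/
theorem IsCoordFamily.prod_real {G : Set (N → ℝ)} (hG : IsCoordFamily J G) :
    IsCoordFamily (𝓘(ℝ, ℝ).prod J)
      (insert (fun p : ℝ × N => p.1) ((fun (g : N → ℝ) (p : ℝ × N) => g p.2) '' G)) where
  smooth := by
    rintro _ (rfl | ⟨g, hg, rfl⟩)
    · exact contMDiff_fst
    · exact (hG.smooth g hg).comp contMDiff_snd
  chart := by
    rintro ⟨t₀, x₀⟩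
    obtain ⟨n, g, v, hg, hchart⟩ := hG.chart x₀
    refine ⟨n + 1, Fin.cons (fun p => p.1) fun k p => g k p.2, Fin.cons (1, 0) fun k => (0, v k),
      fun k => ?_, ?_⟩
    · refine Fin.cases ?_ (fun k => ?_) k
      · exact mem_insert _ _
      · exact mem_insert_of_mem _ ⟨g k, hg k, rfl⟩
    · have h1 : ∀ᶠ p in 𝓝 (t₀, x₀), extChartAt J x₀ p.2 = ∑ k, g k p.2 • v k :=
        (continuousAt_snd (p := (t₀, x₀))).eventually hchart
      filter_upwards [h1] with p hp
      simp only [extChartAt_prod, PartialEquiv.prod_coe, Fin.sum_univ_succ, Fin.cons_zero,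
        Fin.cons_succ, hp]
      ext
      · simp [Prod.fst_sum, chartAt_self_eq]
      · simp [Prod.snd_sum]

/-- The directional derivatives of a smooth family of functions along a smooth family of tangent
vectors form a smooth function. -/
theorem contMDiff_dirDeriv [IsManifold JQ ∞ Q] {f : Q → N → ℝ}
    (hf : ContMDiff (JQ.prod J) 𝓘(ℝ, ℝ) ∞ fun p : Q × N => f p.1 p.2) {ν : Q → N}
    {ξ : ∀ q, TangentSpace J (ν q)}
    (hξ : ContMDiff JQ J.tangent ∞ fun q => (⟨ν q, ξ q⟩ : TangentBundle J N)) :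
    ContMDiff JQ 𝓘(ℝ, ℝ) ∞ fun q => dirDeriv (ξ q) (f q) := by
  -- Differentiating f q along ξ q is applying the differential of f on Q × N to the vector (0, ξ
  -- q), and the tangent map of a smooth map is smooth.
  have h0 : ContMDiff JQ JQ.tangent ∞ (fun q => (⟨q, 0⟩ : TangentBundle JQ Q)) :=
    Bundle.contMDiff_zeroSection ℝ (TangentSpace JQ)
  have h1 : ContMDiff JQ (JQ.prod J).tangent ∞
      (fun q => (equivTangentBundleProd JQ Q J N).symm (⟨q, 0⟩, ⟨ν q, ξ q⟩)) :=
    contMDiff_equivTangentBundleProd_symm.comp (h0.prodMk hξ)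
  have h2 := (ContMDiff.contMDiff_tangentMap (m := ∞) hf (by simp)).comp h1
  have h3 := (contMDiff_snd_tangentBundle_modelSpace (n := ∞) ℝ 𝓘(ℝ, ℝ)).comp h2
  refine h3.congr fun q => ?_
  have hd := (hf.mdifferentiable (by simp) (q, ν q))
  have h4 : HasMFDerivAt J (JQ.prod J) (fun x : N => (q, x)) (ν q) _ :=
    (hasMFDerivAt_const q (ν q)).prodMk (hasMFDerivAt_id (ν q))
  have h5 := (HasMFDerivAt.comp (ν q) (g := fun p : Q × N => f p.1 p.2) hd.hasMFDerivAt h4).mfderiv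
  exact (DFunLike.congr_fun h5 (ξ q))

/-- The partial derivative with respect to a real parameter is smooth. -/
theorem contMDiff_deriv_fst [IsManifold JQ ∞ Q] {f : ℝ → Q → ℝ}
    (hf : ContMDiff (𝓘(ℝ, ℝ).prod JQ) 𝓘(ℝ, ℝ) ∞ fun p : ℝ × Q => f p.1 p.2) :
    ContMDiff (𝓘(ℝ, ℝ).prod JQ) 𝓘(ℝ, ℝ) ∞ fun p : ℝ × Q => deriv (fun t => f t p.2) p.1 := by
  have h1 : ContMDiff 𝓘(ℝ, ℝ) 𝓘(ℝ, ℝ).tangent ∞ (fun t : ℝ => (⟨t, (1 : ℝ)⟩ : TangentBundle 𝓘(ℝ, ℝ) ℝ)) := by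
    exact contMDiff_vectorSpace_iff_contDiff (V := fun _ => (1 : ℝ)) |>.2 contDiff_const
  have h2 := h1.comp (contMDiff_fst (I := 𝓘(ℝ, ℝ)) (J := JQ) (M := ℝ) (N := Q))
  have h3 : ContMDiff ((𝓘(ℝ, ℝ).prod JQ).prod 𝓘(ℝ, ℝ)) 𝓘(ℝ, ℝ) ∞
      fun p : (ℝ × Q) × ℝ => f p.2 p.1.2 :=
    hf.comp (contMDiff_snd.prodMk (contMDiff_snd.comp contMDiff_fst))
  refine (contMDiff_dirDeriv (f := fun (q : ℝ × Q) t => f t q.2) h3 (ν := fun q => q.1)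
    (ξ := fun _ => (1 : ℝ)) h2).congr fun q => ?_
  unfold dirDeriv
  rw [mfderiv_eq_fderiv]
  exact fderiv_apply_one_eq_deriv.symm

theorem dirDeriv_eq_fderiv [J.Boundaryless] {x : N} (X : TangentSpace J x) {f : N → ℝ}
    (hf : MDifferentiableAt J 𝓘(ℝ, ℝ) f x) :
    dirDeriv X f = fderiv ℝ (f ∘ (extChartAt J x).symm) (extChartAt J x x) X := by
  have h1 : mfderiv J 𝓘(ℝ, ℝ) f x =
      fderivWithin ℝ (f ∘ (extChartAt J x).symm) (range J) (extChartAt J x x) := hf.mfderiv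
  rw [J.range_eq_univ, fderivWithin_univ] at h1
  exact DFunLike.congr_fun h1 X

/-- Both iterated derivatives are values of the second differential of h on (1, 0) and (0, v), so
this is the symmetry of second derivatives. -/
theorem hasDerivAt_fderiv_snd {h : ℝ × EN → ℝ} {t : ℝ} {y : EN} (hh : ContDiffAt ℝ ∞ h (t, y))
    (v : EN) : HasDerivAt (fun τ => fderiv ℝ (fun y => h (τ, y)) y v)
      (fderiv ℝ (fun y => deriv (fun τ => h (τ, y)) t) y v) t := by
  have hd : ∀ᶠ p in 𝓝 (t, y), DifferentiableAt ℝ h p := by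
    filter_upwards [(hh.of_le (m := 1) (by exact_mod_cast le_top)).eventually (by decide)] with p hp
    exact hp.differentiableAt (by simp)
  have hd2 : DifferentiableAt ℝ (fderiv ℝ h) (t, y) :=
    (hh.fderiv_right (m := ∞) (by simp)).differentiableAt (by simp)
  have hsymm : fderiv ℝ (fderiv ℝ h) (t, y) (1, 0) (0, v) =
      fderiv ℝ (fderiv ℝ h) (t, y) (0, v) (1, 0) :=
    (hh.isSymmSndFDerivAt (by simpa using ENat.LEInfty.out)) (1, 0) (0, v)
  have e1 : (fun τ => fderiv ℝ (fun y => h (τ, y)) y v) =ᶠ[𝓝 t] fun τ => fderiv ℝ h (τ, y) (0, v) := by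
    have : ContinuousAt (fun τ : ℝ => (τ, y)) t := by fun_prop
    filter_upwards [this.eventually hd] with τ hτ
    have h1 : HasFDerivAt (fun y : EN => (τ, y)) (ContinuousLinearMap.inr ℝ ℝ EN) y :=
      hasFDerivAt_prodMk_right τ y
    have h2 := (HasFDerivAt.comp y (g := h) hτ.hasFDerivAt h1).fderiv
    exact DFunLike.congr_fun h2 v
  have e2 : (fun y => deriv (fun τ => h (τ, y)) t) =ᶠ[𝓝 y] fun y => fderiv ℝ h (t, y) (1, 0) := by
    have : ContinuousAt (fun y : EN => (t, y)) y := by fun_prop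
    filter_upwards [this.eventually hd] with y hy
    have h1 : HasFDerivAt (fun τ : ℝ => (τ, y)) (ContinuousLinearMap.inl ℝ ℝ EN) t :=
      hasFDerivAt_prodMk_left t y
    exact ((HasFDerivAt.comp t (g := h) hy.hasFDerivAt h1).hasDerivAt).deriv
  have f1 : HasDerivAt (fun τ => fderiv ℝ h (τ, y) (0, v)) (fderiv ℝ (fderiv ℝ h) (t, y) (1, 0) (0, v)) t := by
    have h1 : HasFDerivAt (fun τ : ℝ => (τ, y)) (ContinuousLinearMap.inl ℝ ℝ EN) t :=
      hasFDerivAt_prodMk_left t y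
    have h2 := (HasFDerivAt.comp t (g := fderiv ℝ h) hd2.hasFDerivAt h1).hasDerivAt
    exact (h2.clm_apply (hasDerivAt_const t ((0 : ℝ), v))).congr_deriv (by simp)
  have f2 : fderiv ℝ (fun y => fderiv ℝ h (t, y) (1, 0)) y v = fderiv ℝ (fderiv ℝ h) (t, y) (0, v) (1, 0) := by
    have h1 : HasFDerivAt (fun y : EN => (t, y)) (ContinuousLinearMap.inr ℝ ℝ EN) y :=
      hasFDerivAt_prodMk_right t y
    have h2 := (HasFDerivAt.comp y (g := fderiv ℝ h) hd2.hasFDerivAt h1)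
    have h3 := ((ContinuousLinearMap.apply ℝ ℝ ((1 : ℝ), (0 : EN))).hasFDerivAt.comp y h2).fderiv
    exact DFunLike.congr_fun h3 v
  rw [e2.fderiv_eq, f2, ← hsymm]
  exact f1.congr_of_eventuallyEq e1

/-- Differentiation in a parameter commutes with directional derivatives. -/
theorem hasDerivAt_dirDeriv [J.Boundaryless] {f : ℝ → N → ℝ}
    (hf : ContMDiff (𝓘(ℝ, ℝ).prod J) 𝓘(ℝ, ℝ) ∞ fun p : ℝ × N => f p.1 p.2) {x : N}
    (X : TangentSpace J x) (t : ℝ) :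
    HasDerivAt (fun τ => dirDeriv X (f τ)) (dirDeriv X fun x => deriv (fun τ => f τ x) t) t := by
  have hft : ∀ τ, ContMDiff J 𝓘(ℝ, ℝ) ∞ (f τ) := fun τ =>
    hf.comp (contMDiff_const.prodMk contMDiff_id)
  have hfd : ContMDiff J 𝓘(ℝ, ℝ) ∞ (fun x => deriv (fun τ => f τ x) t) :=
    (contMDiff_deriv_fst hf).comp (contMDiff_const.prodMk contMDiff_id)
  rw [dirDeriv_eq_fderiv X (hfd.mdifferentiable (by simp) x)]
  have h1 : (fun τ => dirDeriv X (f τ)) = fun τ =>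
      fderiv ℝ (f τ ∘ (extChartAt J x).symm) (extChartAt J x x) X :=
    funext fun τ => dirDeriv_eq_fderiv X ((hft τ).mdifferentiable (by simp) x)
  rw [h1]
  refine hasDerivAt_fderiv_snd (h := fun p : ℝ × EN => f p.1 ((extChartAt J x).symm p.2)) ?_ X
  rw [← contMDiffAt_iff_contDiffAt, modelWithCornersSelf_prod, ← chartedSpaceSelf_prod]
  have h2 : ContMDiffAt 𝓘(ℝ, EN) J ∞ (extChartAt J x).symm (extChartAt J x x) :=
    (contMDiffOn_extChartAt_symm x).contMDiffAt
      ((isOpen_extChartAt_target x).mem_nhds (mem_extChartAt_target x))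
  exact (hf _).comp (t, extChartAt J x x)
    (contMDiffAt_fst.prodMk (ContMDiffAt.comp (t, extChartAt J x x) h2 contMDiffAt_snd))

end CoordFamily

/-! ### Frames, dual frames and fibrewise linear functions -/

section Frames

variable {EB : Type*} [NormedAddCommGroup EB] [NormedSpace ℝ EB]
  {HB : Type*} [TopologicalSpace HB] {I : ModelWithCorners ℝ EB HB}
  {B : Type*} [TopologicalSpace B] [ChartedSpace HB B]
  {F : Type*} [NormedAddCommGroup F] [NormedSpace ℝ F]
  {V : B → Type*} [TopologicalSpace (TotalSpace F V)]
  [∀ b, AddCommGroup (V b)] [∀ b, Module ℝ (V b)] [∀ b, TopologicalSpace (V b)]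
  [FiberBundle F V] [VectorBundle ℝ F V]

variable (I F V) in
/-- Smooth functions on the total space of a vector bundle which are linear on the fibres. -/
structure FibreLin where
  toFun : TotalSpace F V → ℝ
  smooth : ContMDiff (I.prod 𝓘(ℝ, F)) 𝓘(ℝ, ℝ) ∞ toFun
  linear : ∀ b, IsLinearMap ℝ fun v : V b => toFun ⟨b, v⟩

instance : CoeFun (FibreLin I F V) fun _ => TotalSpace F V → ℝ := ⟨FibreLin.toFun⟩

/-- The restriction of a fibrewise linear function to a fibre. -/
def FibreLin.at (L : FibreLin I F V) (b : B) : Module.Dual ℝ (V b) :=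
  IsLinearMap.mk' _ (L.linear b)

@[simp] theorem FibreLin.at_apply (L : FibreLin I F V) (b : B) (v : V b) : L.at b v = L ⟨b, v⟩ :=
  rfl

variable (I F V) in
/-- Evaluation of sections at a point. -/
def evalSec (b : B) : Sec I F V →ₗ[ℝ] V b where
  toFun s := s b
  map_add' _ _ := rfl
  map_smul' _ _ := rfl

/-- Total spaces serve below as base manifolds, where bump functions are needed, and as phase spaces
of flows, where integral curves must be unique; both require the Hausdorff property. -/
instance t2Space_totalSpace [T2Space B] : T2Space (TotalSpace F V) := by
  refine ⟨fun x y hxy => ?_⟩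
  by_cases h : x.proj = y.proj
  · let e := trivializationAt F V x.proj
    have hx : x ∈ e.source := FiberBundle.mem_trivializationAt_proj_source
    have hy : y ∈ e.source := by
      rw [e.mem_source, ← h]
      exact FiberBundle.mem_baseSet_trivializationAt F V x.proj
    obtain ⟨u, v, hu, hv, hxu, hyv, huv⟩ := t2_separation (e.injOn.ne hx hy hxy)
    exact ⟨_, _, e.continuousOn_toFun.isOpen_inter_preimage e.open_source hu,
      e.continuousOn_toFun.isOpen_inter_preimage e.open_source hv, ⟨hx, hxu⟩, ⟨hy, hyv⟩,
      (huv.preimage e).mono inter_subset_right inter_subset_right⟩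
  · obtain ⟨u, v, hu, hv, hxu, hyv, huv⟩ := t2_separation h
    have hc := FiberBundle.continuous_proj F V
    exact ⟨_, _, hu.preimage hc, hv.preimage hc, hxu, hyv, huv.preimage _⟩

variable [FiniteDimensional ℝ EB] [IsManifold I ∞ B] [T2Space B] [FiniteDimensional ℝ F]
  [ContMDiffVectorBundle ∞ F V I]

theorem exists_smoothBump (b₀ : B) {O : Set B} (hO : O ∈ 𝓝 b₀) : ∃ χ : C^∞⟮I, B; ℝ⟯,
    (∀ᶠ b in 𝓝 b₀, χ b = 1) ∧ tsupport χ ⊆ O := by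
  obtain ⟨χ, -, hχ⟩ := (SmoothBumpFunction.nhds_basis_tsupport (I := I) b₀).mem_iff.1 hO
  exact ⟨⟨χ, χ.contMDiff⟩, χ.eventuallyEq_one, hχ⟩

variable (I F V) in
/-- Near every point there are a frame and a dual frame which extend to the whole bundle. -/
theorem exists_frame (b₀ : B) : ∃ (e : Fin (Module.finrank ℝ F) → Sec I F V)
    (L : Fin (Module.finrank ℝ F) → FibreLin I F V), ∀ᶠ b in 𝓝 b₀, ∀ v : V b,
      v = ∑ i, L i ⟨b, v⟩ • e i b ∧
      (trivializationAt F V b₀ ⟨b, v⟩).2 = ∑ i, L i ⟨b, v⟩ • Module.finBasis ℝ F i := by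
  let τ := trivializationAt F V b₀
  let β := Module.finBasis ℝ F
  have hb₀ : b₀ ∈ τ.baseSet := FiberBundle.mem_baseSet_trivializationAt F V b₀
  obtain ⟨χ, hχ1, hχ⟩ := exists_smoothBump (I := I) b₀ (τ.open_baseSet.mem_nhds hb₀)
  have hβ : ∀ k, ContMDiff 𝓘(ℝ, F) 𝓘(ℝ, ℝ) ∞ (fun x => β.repr x k) := fun k =>
    ((β.coord k).toContinuousLinearMap.contDiff).contMDiff
  -- Both the local frame and its dual are multiplied by χ, which makes them global; the duality
  -- relation survives where χ = 1.
  refine ⟨fun i => ⟨(χ : B → ℝ) • τ.localFrame β i, ?_⟩, fun i => ⟨fun v => χ v.proj * β.repr (τ v).2 i, ?_, ?_⟩, ?_⟩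
  · exact ContMDiffOn.smul_section_of_tsupport χ.contMDiff.contMDiffOn τ.open_baseSet hχ
      (τ.contMDiffOn_localFrame_baseSet ∞ β i)
  · have hπ : ContMDiff (I.prod 𝓘(ℝ, F)) I ∞ (fun v : TotalSpace F V => v.proj) :=
      Bundle.contMDiff_proj V
    refine contMDiff_of_tsupport fun x hx => ?_
    have hx1 : x.proj ∈ tsupport χ := by
      have h1 : tsupport (fun v : TotalSpace F V => χ v.proj * β.repr (τ v).2 i) ⊆
          (fun v : TotalSpace F V => v.proj) ⁻¹' tsupport χ := by
        refine closure_minimal (fun v hv => ?_)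
          ((isClosed_tsupport χ).preimage (FiberBundle.continuous_proj F V))
        exact subset_tsupport _ fun h0 => hv (by simp [h0])
      exact h1 hx
    refine (χ.contMDiff.comp hπ).contMDiffAt.mul ?_
    have h2 : ContMDiffAt (I.prod 𝓘(ℝ, F)) 𝓘(ℝ, F) ∞ (fun v : TotalSpace F V => (τ v).2) x :=
      ((Trivialization.contMDiffAt_iff (IB := I) (n := ∞) (e := τ) (f := id) (x₀ := x)
        (τ.mem_source.2 (hχ hx1))).1 contMDiffAt_id).2
    exact (hβ i).contMDiffAt.comp x h2
  · intro b
    by_cases hb : b ∈ τ.baseSet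
    · have h3 := τ.linear ℝ hb
      constructor
      · intro v w
        have := h3.map_add v w
        simp only [this, map_add, Finsupp.add_apply, mul_add]
      · intro r v
        have := h3.map_smul r v
        simp only [this, map_smul, Finsupp.smul_apply, smul_eq_mul]
        ring
    · have h0 : χ b = 0 := image_eq_zero_of_notMem_tsupport fun h => hb (hχ h)
      constructor <;> intros <;> simp [h0]
  · filter_upwards [hχ1, τ.open_baseSet.mem_nhds hb₀] with b hb hbτ v
    have h4 : (τ ⟨b, v⟩).2 = ∑ i, β.repr (τ ⟨b, v⟩).2 i • β i := (β.sum_repr _).symm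
    refine ⟨?_, ?_⟩
    · have h5 := (τ.basisAt β hbτ).sum_repr v
      refine h5.symm.trans (Finset.sum_congr rfl fun i _ => ?_)
      have : τ.localFrame β i b = τ.basisAt β hbτ i := τ.localFrame_apply_of_mem_baseSet β hbτ
      change _ = (χ b * _) • (χ b • τ.localFrame β i b)
      rw [hb, this]
      simp only [one_smul, one_mul]
      congr 1
    · simpa only [hb, one_mul] using h4

/-- The fibre component in a trivialization is locally a constant-coefficient combination of
fibrewise linear functions, namely of the dual frame. -/
theorem contMDiffAt_totalSpace_iff {EQ : Type*} [NormedAddCommGroup EQ] [NormedSpace ℝ EQ]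
    {HQ : Type*} [TopologicalSpace HQ] {JQ : ModelWithCorners ℝ EQ HQ}
    {Q : Type*} [TopologicalSpace Q] [ChartedSpace HQ Q] {g : Q → TotalSpace F V} {q : Q} :
    ContMDiffAt JQ (I.prod 𝓘(ℝ, F)) ∞ g q ↔ ContMDiffAt JQ I ∞ (fun q => (g q).proj) q ∧
      ∀ L : FibreLin I F V, ContMDiffAt JQ 𝓘(ℝ, ℝ) ∞ (fun q => L (g q)) q := by
  refine ⟨fun h => ⟨(Bundle.contMDiff_proj V).contMDiffAt.comp q h,
    fun L => L.smooth.contMDiffAt.comp q h⟩, fun h => ?_⟩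
  rw [Bundle.contMDiffAt_totalSpace]
  refine ⟨h.1, ?_⟩
  obtain ⟨e, L, hL⟩ := exists_frame I F V (g q).proj
  have h1 : ContMDiffAt JQ 𝓘(ℝ, F) ∞ (fun q => ∑ i, L i (g q) • Module.finBasis ℝ F i) q :=
    ContMDiffAt.sum fun i _ => (h.2 (L i)).smul contMDiffAt_const
  refine h1.congr_of_eventuallyEq ?_
  filter_upwards [h.1.continuousAt.eventually hL] with q' hq'
  exact (hq' (g q').2).2

theorem contMDiff_totalSpace_iff {EQ : Type*} [NormedAddCommGroup EQ] [NormedSpace ℝ EQ]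
    {HQ : Type*} [TopologicalSpace HQ] {JQ : ModelWithCorners ℝ EQ HQ}
    {Q : Type*} [TopologicalSpace Q] [ChartedSpace HQ Q] {g : Q → TotalSpace F V} :
    ContMDiff JQ (I.prod 𝓘(ℝ, F)) ∞ g ↔ ContMDiff JQ I ∞ (fun q => (g q).proj) ∧
      ∀ L : FibreLin I F V, ContMDiff JQ 𝓘(ℝ, ℝ) ∞ (fun q => L (g q)) :=
  ⟨fun h => ⟨fun q => (contMDiffAt_totalSpace_iff.1 (h q)).1,
    fun L q => (contMDiffAt_totalSpace_iff.1 (h q)).2 L⟩,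
    fun h q => contMDiffAt_totalSpace_iff.2 ⟨h.1 q, fun L => h.2 L q⟩⟩

variable (I) in
/-- Vectors are separated by fibrewise linear functions. -/
theorem fibreLin_ext {b : B} {v w : V b} (h : ∀ L : FibreLin I F V, L ⟨b, v⟩ = L ⟨b, w⟩) :
    v = w := by
  obtain ⟨e, L, hL⟩ := exists_frame I F V b
  rw [(hL.self_of_nhds v).1, (hL.self_of_nhds w).1]
  exact Finset.sum_congr rfl fun i _ => by rw [h]

variable (I F) in
theorem exists_sec_eq {b : B} (v : V b) : ∃ s : Sec I F V, s b = v := by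
  obtain ⟨e, L, hL⟩ := exists_frame I F V b
  refine ⟨∑ i, L i ⟨b, v⟩ • e i, ?_⟩
  have h1 : evalSec I F V b (∑ i, L i ⟨b, v⟩ • e i) = ∑ i, L i ⟨b, v⟩ • e i b := by
    rw [map_sum]
    rfl
  exact h1.trans (hL.self_of_nhds v).1.symm

variable (I F V) in
/-- The functions lifted from the base and the fibrewise linear functions form a coordinate
family. -/
theorem isCoordFamily_totalSpace : IsCoordFamily (I.prod 𝓘(ℝ, F))
    ({g : TotalSpace F V → ℝ | ∃ f : C^∞⟮I, B; ℝ⟯, g = fun v => f v.proj} ∪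
      {g | ∃ L : FibreLin I F V, g = L}) where
  smooth := by
    rintro _ (⟨f, rfl⟩ | ⟨L, rfl⟩)
    · exact f.contMDiff.comp (Bundle.contMDiff_proj V)
    · exact L.smooth
  chart x₀ := by
    obtain ⟨n, g, v, hg, hchart⟩ := (isCoordFamily_contMDiff I B).chart x₀.proj
    obtain ⟨e, L, hL⟩ := exists_frame I F V x₀.proj
    refine ⟨n + Module.finrank ℝ F, Fin.append (fun k x => g k x.proj) (fun i => L i),
      Fin.append (fun k => (v k, 0)) (fun i => (0, Module.finBasis ℝ F i)), fun k => ?_, ?_⟩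
    · refine Fin.addCases (fun k => ?_) (fun i => ?_) k
      · rw [Fin.append_left]
        exact Or.inl ⟨⟨g k, hg k⟩, rfl⟩
      · rw [Fin.append_right]
        exact Or.inr ⟨L i, rfl⟩
    · have hc : ContinuousAt (fun v : TotalSpace F V => v.proj) x₀ :=
        (FiberBundle.continuous_proj F V).continuousAt
      filter_upwards [hc.eventually hL, hc.eventually hchart,
        hc.eventually ((trivializationAt F V x₀.proj).open_baseSet.mem_nhds
          (FiberBundle.mem_baseSet_trivializationAt F V x₀.proj))] with x hx hx' hxb
      have h1 := (hx x.2).2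
      simp only [FiberBundle.extChartAt, Fin.sum_univ_add, Fin.append_left, Fin.append_right]
      have h3 : (trivializationAt F V x₀.proj x).1 = x.proj :=
        (trivializationAt F V x₀.proj).coe_fst' hxb
      ext
      · simpa [Prod.fst_sum, h3] using hx'
      · simpa [Prod.snd_sum] using h1

end Frames

/-! ## Derivatives of curves in a vector space without topology -/

section FibDeriv

variable {X Y : Type*} [AddCommGroup X] [Module ℝ X] [AddCommGroup Y] [Module ℝ Y]

/-- The curve `u` in the real vector space `X` has the derivative `v` at `t`, tested on linear
functionals. -/
def FibDeriv (u : ℝ → X) (v : X) (t : ℝ) : Prop :=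
  ∀ l : Module.Dual ℝ X, HasDerivAt (fun τ => l (u τ)) (l v) t

/-- Linear functionals separate the points of any real vector space. -/
theorem FibDeriv.unique {u : ℝ → X} {v v' : X} {t : ℝ} (h : FibDeriv u v t)
    (h' : FibDeriv u v' t) : v = v' := by
  rw [← sub_eq_zero]
  refine (Module.forall_dual_apply_eq_zero_iff ℝ _).1 fun l => ?_
  rw [map_sub, (h l).unique (h' l), sub_self]

theorem FibDeriv.map {u : ℝ → X} {v : X} {t : ℝ} (h : FibDeriv u v t) (f : X →ₗ[ℝ] Y) :
    FibDeriv (fun τ => f (u τ)) (f v) t := fun l => h (l.comp f)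

theorem FibDeriv.add {u u' : ℝ → X} {v v' : X} {t : ℝ} (h : FibDeriv u v t)
    (h' : FibDeriv u' v' t) : FibDeriv (fun τ => u τ + u' τ) (v + v') t := fun l => by
  simpa only [map_add] using (h l).fun_add (h' l)

theorem FibDeriv.sub {u u' : ℝ → X} {v v' : X} {t : ℝ} (h : FibDeriv u v t)
    (h' : FibDeriv u' v' t) : FibDeriv (fun τ => u τ - u' τ) (v - v') t := fun l => by
  simpa only [map_sub] using (h l).fun_sub (h' l)

theorem FibDeriv.neg {u : ℝ → X} {v : X} {t : ℝ} (h : FibDeriv u v t) :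
    FibDeriv (fun τ => -u τ) (-v) t := fun l => by
  simpa only [map_neg] using (h l).fun_neg

theorem FibDeriv.sum {ι : Type*} {s : Finset ι} {u : ι → ℝ → X} {v : ι → X} {t : ℝ}
    (h : ∀ i ∈ s, FibDeriv (u i) (v i) t) :
    FibDeriv (fun τ => ∑ i ∈ s, u i τ) (∑ i ∈ s, v i) t := fun l => by
  simpa only [map_sum] using HasDerivAt.fun_sum fun i hi => h i hi l

theorem FibDeriv.smul {f : ℝ → ℝ} {f' : ℝ} {u : ℝ → X} {v : X} {t : ℝ} (hf : HasDerivAt f f' t)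
    (h : FibDeriv u v t) : FibDeriv (fun τ => f τ • u τ) (f' • u t + f t • v) t := fun l => by
  simpa only [map_smul, map_add, smul_eq_mul] using hf.fun_mul (h l)

theorem fibDeriv_const (v : X) (t : ℝ) : FibDeriv (fun _ => v) 0 t := fun l => by
  simpa only [map_zero] using hasDerivAt_const t (l v)

theorem HasDerivAt.smul_fibDeriv {f : ℝ → ℝ} {f' : ℝ} {t : ℝ} (hf : HasDerivAt f f' t) (v : X) :
    FibDeriv (fun τ => f τ • v) (f' • v) t := by
  simpa using FibDeriv.smul hf (fibDeriv_const v t)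

theorem FibDeriv.congr_deriv {u : ℝ → X} {v v' : X} {t : ℝ} (h : FibDeriv u v t) (hv : v = v') :
    FibDeriv u v' t := hv ▸ h

/-- A curve all of whose derivatives vanish is constant. -/
theorem eq_of_fibDeriv_zero {u : ℝ → X} (h : ∀ t, FibDeriv u 0 t) (s t : ℝ) : u s = u t := by
  rw [← sub_eq_zero]
  refine (Module.forall_dual_apply_eq_zero_iff ℝ _).1 fun l => ?_
  have h1 : ∀ t, HasDerivAt (fun τ => l (u τ)) 0 t := fun t => by simpa using h t l
  rw [map_sub, sub_eq_zero]
  exact is_const_of_deriv_eq_zero (fun t => (h1 t).differentiableAt) (fun t => (h1 t).deriv) s t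

/-- The derivative of a function of two variables along the diagonal. -/
theorem hasDerivAt_diag {g : ℝ × ℝ → ℝ} {t a b : ℝ} (hg : DifferentiableAt ℝ g (t, t))
    (h1 : HasDerivAt (fun τ => g (τ, t)) a t) (h2 : HasDerivAt (fun τ => g (t, τ)) b t) :
    HasDerivAt (fun τ => g (τ, τ)) (a + b) t := by
  have e1 := ((HasFDerivAt.comp t (g := g) (f := fun τ => (τ, t)) hg.hasFDerivAt
    (hasFDerivAt_prodMk_left t t)).hasDerivAt).unique h1
  have e2 := ((HasFDerivAt.comp t (g := g) (f := fun τ => (t, τ)) hg.hasFDerivAt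
    (hasFDerivAt_prodMk_right t t)).hasDerivAt).unique h2
  have e3 := HasFDerivAt.comp_hasDerivAt t (f := fun τ => (τ, τ)) hg.hasFDerivAt
    ((hasDerivAt_id t).prodMk (hasDerivAt_id t))
  refine e3.congr_deriv ?_
  rw [← e1, ← e2]
  have : ((1 : ℝ), (1 : ℝ)) = (1, 0) + (0, 1) := by simp
  rw [this, map_add]
  rfl

end FibDeriv

/-! ## Smooth families of sections and of derivations -/

section Families

variable {EB : Type*} [NormedAddCommGroup EB] [NormedSpace ℝ EB]
  {HB : Type*} [TopologicalSpace HB] {I : ModelWithCorners ℝ EB HB}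
  {B : Type*} [TopologicalSpace B] [ChartedSpace HB B]
  {F : Type*} [NormedAddCommGroup F] [NormedSpace ℝ F]
  {V : B → Type*} [TopologicalSpace (TotalSpace F V)]
  [∀ b, AddCommGroup (V b)] [∀ b, Module ℝ (V b)] [∀ b, TopologicalSpace (V b)]
  [FiberBundle F V] [VectorBundle ℝ F V]
  {EQ : Type*} [NormedAddCommGroup EQ] [NormedSpace ℝ EQ]
  {HQ : Type*} [TopologicalSpace HQ] {JQ : ModelWithCorners ℝ EQ HQ}
  {Q : Type*} [TopologicalSpace Q] [ChartedSpace HQ Q]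
  {ER : Type*} [NormedAddCommGroup ER] [NormedSpace ℝ ER]
  {HR : Type*} [TopologicalSpace HR] {JR : ModelWithCorners ℝ ER HR}
  {R : Type*} [TopologicalSpace R] [ChartedSpace HR R]

variable (JQ) in
/-- Smooth families of sections, parametrized by a manifold `Q`. -/
def SmoothFam (s : Q → Sec I F V) : Prop :=
  ContMDiff (JQ.prod I) (I.prod 𝓘(ℝ, F)) ∞ fun p : Q × B => (⟨p.2, s p.1 p.2⟩ : TotalSpace F V)

theorem smoothFam_const (s : Sec I F V) : SmoothFam JQ fun _ : Q => s :=
  s.contMDiff.comp contMDiff_snd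

theorem SmoothFam.comp {s : Q → Sec I F V} (hs : SmoothFam JQ s) {g : R → Q}
    (hg : ContMDiff JR JQ ∞ g) : SmoothFam JR fun r => s (g r) :=
  ContMDiff.comp (g := fun p : Q × B => (⟨p.2, s p.1 p.2⟩ : TotalSpace F V)) hs
    ((hg.comp contMDiff_fst).prodMk contMDiff_snd)

/-- The composition of a section with a fibrewise linear function. -/
def FibreLin.compSec (L : FibreLin I F V) (s : Sec I F V) : C^∞⟮I, B; ℝ⟯ :=
  ⟨fun b => L ⟨b, s b⟩, L.smooth.comp s.contMDiff⟩

@[simp] theorem FibreLin.compSec_apply (L : FibreLin I F V) (s : Sec I F V) (b : B) :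
    L.compSec s b = L ⟨b, s b⟩ := rfl

@[simp] theorem fsmul_apply (f : C^∞⟮I, B; ℝ⟯) (s : Sec I F V) (b : B) :
    fsmul f s b = f b • s b := rfl

/-- `D` is a derivation of the module of sections, with symbol the vector field `X`. -/
def IsDerivation (D : Sec I F V →ₗ[ℝ] Sec I F V) (X : ∀ b : B, TangentSpace I b) : Prop :=
  ∀ (f : C^∞⟮I, B; ℝ⟯) (s : Sec I F V) (b : B),
    D (fsmul f s) b = dirDeriv (X b) f • s b + f b • D s b

variable [FiniteDimensional ℝ EB] [IsManifold I ∞ B] [T2Space B] [FiniteDimensional ℝ F]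
  [ContMDiffVectorBundle ∞ F V I]

theorem smoothFam_iff {s : Q → Sec I F V} : SmoothFam JQ s ↔
    ∀ L : FibreLin I F V,
      ContMDiff (JQ.prod I) 𝓘(ℝ, ℝ) ∞ fun p : Q × B => L ⟨p.2, s p.1 p.2⟩ := by
  refine contMDiff_totalSpace_iff.trans ⟨fun h => h.2, fun h => ⟨contMDiff_snd, h⟩⟩

theorem SmoothFam.add {s s' : Q → Sec I F V} (h : SmoothFam JQ s) (h' : SmoothFam JQ s') :
    SmoothFam JQ fun q => s q + s' q := by
  rw [smoothFam_iff] at *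
  intro L
  exact ((h L).add (h' L)).congr fun p => (L.linear p.2).map_add _ _

theorem SmoothFam.smul {f : Q → ℝ} {s : Q → Sec I F V} (hf : ContMDiff JQ 𝓘(ℝ, ℝ) ∞ f)
    (h : SmoothFam JQ s) : SmoothFam JQ fun q => f q • s q := by
  rw [smoothFam_iff] at *
  intro L
  exact ((hf.comp contMDiff_fst).mul (h L)).congr fun p => (L.linear p.2).map_smul _ _

theorem SmoothFam.neg {s : Q → Sec I F V} (h : SmoothFam JQ s) : SmoothFam JQ fun q => -s q := by
  rw [smoothFam_iff] at *
  intro L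
  exact ((h L).neg).congr fun p => (L.linear p.2).map_neg _

theorem SmoothFam.sub {s s' : Q → Sec I F V} (h : SmoothFam JQ s) (h' : SmoothFam JQ s') :
    SmoothFam JQ fun q => s q - s' q := by
  rw [smoothFam_iff] at *
  intro L
  exact ((h L).sub (h' L)).congr fun p => (L.linear p.2).map_sub _ _

-- Every functional on a single fibre is a combination of the dual frame at that point, so
-- functionals that extend to smooth fibrewise linear functions are enough.
variable (I) in
theorem fibDeriv_iff_fibreLin {b : B} {u : ℝ → V b} {v : V b} {t : ℝ} : FibDeriv u v t ↔
    ∀ L : FibreLin I F V, HasDerivAt (fun τ => L ⟨b, u τ⟩) (L ⟨b, v⟩) t := by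
  refine ⟨fun h L => h (L.at b), fun h l => ?_⟩
  obtain ⟨e, L, hL⟩ := exists_frame I F V b
  have h1 : ∀ w : V b, l w = ∑ i, L i ⟨b, w⟩ * l (e i b) := fun w => by
    conv_lhs => rw [(hL.self_of_nhds w).1]
    simp
  rw [show (fun τ => l (u τ)) = fun τ => ∑ i, L i ⟨b, u τ⟩ * l (e i b) from funext fun τ => h1 _,
    h1 v]
  exact HasDerivAt.fun_sum fun i _ => (h (L i)).mul_const _

/-- The derivative exists pointwise by expansion in a frame. It is smooth because its composition
with a fibrewise linear L is the time derivative of L on the family. -/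
theorem SmoothFam.exists_deriv {s : ℝ → Sec I F V} (hs : SmoothFam 𝓘(ℝ, ℝ) s) :
    ∃ s' : ℝ → Sec I F V, SmoothFam 𝓘(ℝ, ℝ) s' ∧ ∀ t b, FibDeriv (fun τ => s τ b) (s' t b) t := by
  have hL := smoothFam_iff.1 hs
  have hd : ∀ (L : FibreLin I F V) b t, HasDerivAt (fun τ => L ⟨b, s τ b⟩)
      (deriv (fun τ => L ⟨b, s τ b⟩) t) t := fun L b t => by
    have h1 : ContMDiff 𝓘(ℝ, ℝ) 𝓘(ℝ, ℝ) ∞ (fun τ => L ⟨b, s τ b⟩) :=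
      (hL L).comp (contMDiff_id.prodMk contMDiff_const)
    exact ((contMDiff_iff_contDiff.1 h1).differentiable (by simp) t).hasDerivAt
  have hex : ∀ t b, ∃ v : V b, FibDeriv (fun τ => s τ b) v t := fun t b => by
    obtain ⟨e, L, hLe⟩ := exists_frame I F V b
    refine ⟨∑ i, deriv (fun τ => L i ⟨b, s τ b⟩) t • e i b, ?_⟩
    have h2 : (fun τ => s τ b) = fun τ => ∑ i, L i ⟨b, s τ b⟩ • e i b :=
      funext fun τ => (hLe.self_of_nhds _).1
    rw [h2]
    exact FibDeriv.sum fun i _ => HasDerivAt.smul_fibDeriv (hd (L i) b t) _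
  choose w hw using hex
  have hLw : ∀ (L : FibreLin I F V) t b, L ⟨b, w t b⟩ = deriv (fun τ => L ⟨b, s τ b⟩) t :=
    fun L t b => ((hw t b (L.at b)).unique (hd L b t))
  have hsm : ContMDiff (𝓘(ℝ, ℝ).prod I) (I.prod 𝓘(ℝ, F)) ∞
      fun p : ℝ × B => (⟨p.2, w p.1 p.2⟩ : TotalSpace F V) := by
    rw [contMDiff_totalSpace_iff]
    refine ⟨contMDiff_snd, fun L => ?_⟩
    simp only [hLw]
    exact contMDiff_deriv_fst (f := fun t b => L ⟨b, s t b⟩) (hL L)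
  exact ⟨fun t => ⟨w t, hsm.comp (contMDiff_const.prodMk contMDiff_id)⟩, hsm, hw⟩

/-- All product rules for moving sections, brackets and automorphisms come from this: vary one
argument at a time, then restrict a jointly smooth two-parameter family to the diagonal. -/
theorem fibDeriv_diag {u : ℝ × ℝ → Sec I F V} (hu : SmoothFam (𝓘(ℝ, ℝ).prod 𝓘(ℝ, ℝ)) u) {b : B}
    {t : ℝ} {v v' : V b} (h : FibDeriv (fun τ => u (τ, t) b) v t)
    (h' : FibDeriv (fun τ => u (t, τ) b) v' t) : FibDeriv (fun τ => u (τ, τ) b) (v + v') t := by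
  rw [fibDeriv_iff_fibreLin I (F := F)] at h h'
  rw [fibDeriv_iff_fibreLin I (F := F)]
  intro L
  have h1 : ContMDiff (𝓘(ℝ, ℝ).prod 𝓘(ℝ, ℝ)) 𝓘(ℝ, ℝ) ∞ (fun p : ℝ × ℝ => L ⟨b, u p b⟩) :=
    (smoothFam_iff.1 hu L).comp (contMDiff_id.prodMk contMDiff_const)
  have h2 := h1.mdifferentiable (by simp)
  rw [← modelWithCornersSelf_prod] at h1
  rw [chartedSpaceSelf_prod] at h1
  exact (hasDerivAt_diag ((contMDiff_iff_contDiff.1 h1).differentiable (by simp) (t, t)) (h L) (h' L)).congr_deriv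
    ((L.linear b).map_add _ _).symm

/-- A derivation is a local operator. -/
theorem IsDerivation.congr {D : Sec I F V →ₗ[ℝ] Sec I F V} {X : ∀ b : B, TangentSpace I b}
    (hD : IsDerivation D X) {s s' : Sec I F V} {b : B} (h : ∀ᶠ y in 𝓝 b, s y = s' y) :
    D s b = D s' b := by
  obtain ⟨χ, hχ1, hχ⟩ := exists_smoothBump (I := I) b h
  have h1 : fsmul (1 - χ) (s - s') = s - s' := by
    ext y
    by_cases hy : y ∈ tsupport χ
    · have : (s - s') y = 0 := sub_eq_zero.2 (hχ hy)
      rw [fsmul_apply, this, smul_zero]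
    · have : (1 - χ) y = 1 := by
        have : χ y = 0 := image_eq_zero_of_notMem_tsupport hy
        simp [this]
      rw [fsmul_apply, this, one_smul]
  have h2 := hD (1 - χ) (s - s') b
  have h3 : (s - s') b = 0 := sub_eq_zero.2 h.self_of_nhds
  have h4 : (1 - χ) b = 0 := sub_eq_zero.2 hχ1.self_of_nhds.symm
  rw [h1, h3, h4, smul_zero, zero_smul, add_zero, map_sub] at h2
  exact sub_eq_zero.1 h2

/-- By locality s may be replaced by its expansion in the frame, to which the Leibniz rule applies.
A derivation is thus locally determined by its symbol and its values on a frame. -/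
theorem IsDerivation.eq_sum {D : Sec I F V →ₗ[ℝ] Sec I F V} {X : ∀ b : B, TangentSpace I b}
    (hD : IsDerivation D X) {n : ℕ} {e : Fin n → Sec I F V} {L : Fin n → FibreLin I F V} {b : B}
    (h : ∀ᶠ y in 𝓝 b, ∀ v : V y, v = ∑ i, L i ⟨y, v⟩ • e i y) (s : Sec I F V) :
    D s b = ∑ i, (dirDeriv (X b) ((L i).compSec s) • e i b + L i ⟨b, s b⟩ • D (e i) b) := by
  have hsum : ∀ (y : B) (w : Fin n → Sec I F V), (∑ i, w i) y = ∑ i, w i y := fun y w =>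
    map_sum (evalSec I F V y) w _
  have h1 : D s b = D (∑ i, fsmul ((L i).compSec s) (e i)) b := by
    refine hD.congr (h.mono fun y hy => ?_)
    rw [hsum]
    exact hy (s y)
  rw [h1, map_sum, hsum]
  exact Finset.sum_congr rfl fun i _ => hD _ _ _

/-- A smooth family of derivations, applied to a smooth family of sections. -/
theorem SmoothFam.derivation [IsManifold JQ ∞ Q] {D : Q → Sec I F V →ₗ[ℝ] Sec I F V}
    {X : Q → ∀ b : B, TangentSpace I b} (hD : ∀ q, IsDerivation (D q) (X q))
    (hDs : ∀ s, SmoothFam JQ fun q => D q s)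
    (hX : ContMDiff (JQ.prod I) I.tangent ∞ fun p : Q × B => (⟨p.2, X p.1 p.2⟩ : TangentBundle I B))
    {s : Q → Sec I F V} (hs : SmoothFam JQ s) : SmoothFam JQ fun q => D q (s q) := by
  rw [smoothFam_iff]
  rintro L ⟨q₀, b₀⟩
  obtain ⟨e, l, hl⟩ := exists_frame I F V b₀
  have h1 : ContMDiff (JQ.prod I) 𝓘(ℝ, ℝ) ∞ fun p : Q × B =>
      ∑ i, (dirDeriv (X p.1 p.2) ((l i).compSec (s p.1)) * L ⟨p.2, e i p.2⟩ +
        l i ⟨p.2, s p.1 p.2⟩ * L ⟨p.2, D p.1 (e i) p.2⟩) := by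
    refine ContMDiff.sum fun i _ => ContMDiff.add (ContMDiff.mul ?_ ?_) (ContMDiff.mul ?_ ?_)
    · refine contMDiff_dirDeriv (f := fun (p : Q × B) (y : B) => l i ⟨y, s p.1 y⟩) ?_ hX
      exact (smoothFam_iff.1 hs (l i)).comp ((contMDiff_fst.comp contMDiff_fst).prodMk contMDiff_snd)
    · exact (L.compSec (e i)).contMDiff.comp contMDiff_snd
    · exact smoothFam_iff.1 hs (l i)
    · exact smoothFam_iff.1 (hDs (e i)) L
  refine (h1 (q₀, b₀)).congr_of_eventuallyEq ?_
  have hl' : ∀ᶠ b in 𝓝 b₀, ∀ᶠ y in 𝓝 b, ∀ v : V y, v = ∑ i, l i ⟨y, v⟩ • e i y :=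
    eventually_eventually_nhds.2 (hl.mono fun y hy v => (hy v).1)
  filter_upwards [(continuousAt_snd (p := (q₀, b₀))).eventually hl'] with p hp
  rw [(hD p.1).eq_sum hp]
  change L.at p.2 _ = _
  simp only [map_sum, map_add, map_smul, FibreLin.at_apply, smul_eq_mul]

/-- The symbol of a smooth family of derivations is smooth. -/
theorem contMDiff_symbol [Nontrivial F] {D : Q → Sec I F V →ₗ[ℝ] Sec I F V}
    {X : Q → ∀ b : B, TangentSpace I b} (hD : ∀ q, IsDerivation (D q) (X q))
    (hDs : ∀ s, SmoothFam JQ fun q => D q s) :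
    ContMDiff (JQ.prod I) I.tangent ∞ fun p : Q × B => (⟨p.2, X p.1 p.2⟩ : TangentBundle I B) := by
  rintro ⟨q₀, b₀⟩
  refine (isCoordFamily_contMDiff I B).contMDiffAt_tangent contMDiffAt_snd fun f hf => ?_
  -- The symbol is recovered from X(f) L(s) = L(D(fs)) − f L(Ds) after division by L(s), which needs
  -- a section and a fibrewise linear function with L(s) ≠ 0 at the point; this is where the rank
  -- must be positive.
  have hnt : Nontrivial (V b₀) :=
    ((trivializationAt F V b₀).linearEquivAt (R := ℝ) b₀
      (FiberBundle.mem_baseSet_trivializationAt F V b₀)).toEquiv.nontrivial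
  obtain ⟨v, hv⟩ := exists_ne (0 : V b₀)
  obtain ⟨s, hs⟩ := exists_sec_eq I F v
  have hLex : ∃ L : FibreLin I F V, L ⟨b₀, s b₀⟩ ≠ 0 := by
    by_contra! hcon
    refine hv (fibreLin_ext I (F := F) fun L => ?_)
    rw [← hs, hcon L]
    exact ((L.at b₀).map_zero).symm
  obtain ⟨L, hL⟩ := hLex
  have hLs : ContMDiff (JQ.prod I) 𝓘(ℝ, ℝ) ∞ fun p : Q × B => L.compSec s p.2 :=
    (L.compSec s).contMDiff.comp contMDiff_snd
  have h1 : ContMDiff (JQ.prod I) 𝓘(ℝ, ℝ) ∞ fun p : Q × B =>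
      L ⟨p.2, D p.1 (fsmul ⟨f, hf⟩ s) p.2⟩ - f p.2 * L ⟨p.2, D p.1 s p.2⟩ :=
    (smoothFam_iff.1 (hDs _) L).sub ((hf.comp contMDiff_snd).mul (smoothFam_iff.1 (hDs _) L))
  have h2 := (h1 (q₀, b₀)).div₀ (hLs (q₀, b₀)) hL
  refine h2.congr_of_eventuallyEq ?_
  filter_upwards [(hLs (q₀, b₀)).continuousAt.eventually_ne hL] with p hp
  have h3 : L ⟨p.2, D p.1 (fsmul ⟨f, hf⟩ s) p.2⟩ =
      dirDeriv (X p.1 p.2) f * L.compSec s p.2 + f p.2 * L ⟨p.2, D p.1 s p.2⟩ := by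
    refine (congrArg (L.at p.2) (hD p.1 ⟨f, hf⟩ s p.2)).trans ?_
    simp only [map_add, map_smul, FibreLin.at_apply, smul_eq_mul]
    rfl
  rw [Pi.div_apply, h3, add_sub_cancel_right, mul_div_cancel_right₀ _ hp]

/-- Derivations commute with differentiation in a parameter. -/
theorem IsDerivation.fibDeriv [I.Boundaryless] {D : Sec I F V →ₗ[ℝ] Sec I F V}
    {X : ∀ b : B, TangentSpace I b} (hD : IsDerivation D X) {s : ℝ → Sec I F V}
    (hs : SmoothFam 𝓘(ℝ, ℝ) s) {s' : Sec I F V} {t : ℝ}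
    (hs' : ∀ b, FibDeriv (fun τ => s τ b) (s' b) t) (b : B) :
    FibDeriv (fun τ => D (s τ) b) (D s' b) t := by
  obtain ⟨e, l, hl⟩ := exists_frame I F V b
  have hl' := hD.eq_sum (hl.mono fun y hy v => (hy v).1)
  have h0 : (fun τ => D (s τ) b) = fun τ => ∑ i, (dirDeriv (X b) ((l i).compSec (s τ)) • e i b +
      l i ⟨b, s τ b⟩ • D (e i) b) := funext fun τ => hl' (s τ)
  rw [h0, hl' s']
  refine FibDeriv.sum fun i _ => FibDeriv.add (HasDerivAt.smul_fibDeriv ?_ _)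
    (HasDerivAt.smul_fibDeriv (hs' b ((l i).at b)) _)
  have h1 := hasDerivAt_dirDeriv (f := fun τ y => l i ⟨y, s τ y⟩) (smoothFam_iff.1 hs (l i)) (X b) t
  have h2 : (fun y => deriv (fun τ => l i ⟨y, s τ y⟩) t) = (l i).compSec s' :=
    funext fun y => (hs' y ((l i).at y)).deriv
  rw [h2] at h1
  exact h1

end Families

/-! ## Homogeneous smooth maps are fibrewise linear -/

/-- The target fibre is over any c with g b = c, so the linear map can have the wanted type when
base points agree only propositionally, for instance after applying a diffeomorphism and its
inverse. -/
theorem IsFiberwiseLinear.exists_fibre {B₁ B₂ : Type*} {F₁ F₂ : Type*} {E₁ : B₁ → Type*}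
    {E₂ : B₂ → Type*} [∀ b, AddCommGroup (E₁ b)] [∀ b, Module ℝ (E₁ b)]
    [∀ b, AddCommGroup (E₂ b)] [∀ b, Module ℝ (E₂ b)] {f : TotalSpace F₁ E₁ → TotalSpace F₂ E₂}
    {g : B₁ → B₂} (h : IsFiberwiseLinear f g) {b : B₁} {c : B₂} (hc : g b = c) :
    ∃ l : E₁ b →ₗ[ℝ] E₂ c, ∀ v, (⟨c, l v⟩ : TotalSpace F₂ E₂) = f ⟨b, v⟩ := by
  subst hc
  have h1 : ∀ v : E₁ b, ∃ w : E₂ (g b), (⟨g b, w⟩ : TotalSpace F₂ E₂) = f ⟨b, v⟩ := fun v => by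
    have h2 := h.proj ⟨b, v⟩
    rcases hx : f ⟨b, v⟩ with ⟨y, w⟩
    rw [hx] at h2
    obtain rfl : y = g b := h2
    exact ⟨w, rfl⟩
  choose l hl using h1
  refine ⟨{ toFun := l, map_add' := fun v w => ?_, map_smul' := fun r v => ?_ }, hl⟩
  · have h3 := h.add ⟨b, v⟩ ⟨b, w⟩ ⟨b, v + w⟩ ⟨b, v, w, rfl, rfl, rfl⟩
    rw [← hl, ← hl, ← hl] at h3
    have h4 := h3.unique ⟨g b, l v, l w, rfl, rfl, rfl⟩
    simpa using h4
  · have h3 := h.smul r ⟨b, v⟩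
    have h4 : f ⟨b, r • v⟩ = scale r (f ⟨b, v⟩) := h3
    rw [← hl, ← hl] at h4
    simpa [scale] using h4

/-- A smooth positively homogeneous function on a vector space is additive. -/
theorem additive_of_homogeneous {G : Type*} [NormedAddCommGroup G] [NormedSpace ℝ G] {h : G → ℝ}
    (hd : DifferentiableAt ℝ h 0) (hh : ∀ r : ℝ, 0 < r → ∀ y, h (r • y) = r * h y) (y : G) :
    h y = fderiv ℝ h 0 y := by
  have h0 : h 0 = 0 := by
    have := hh 2 (by norm_num) 0
    rw [smul_zero] at this
    linarith
  have h1 : HasDerivAt (fun r : ℝ => h (r • y)) (fderiv ℝ h 0 y) 0 := by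
    have h2 : HasDerivAt (fun r : ℝ => r • y) y 0 := by
      simpa using (hasDerivAt_id (0 : ℝ)).smul_const y
    have h3 : HasFDerivAt h (fderiv ℝ h 0) ((0 : ℝ) • y) := by
      rw [zero_smul]
      exact hd.hasFDerivAt
    exact h3.comp_hasDerivAt 0 h2
  have h2 : Tendsto (fun r : ℝ => r⁻¹ • (h (r • y) - h ((0 : ℝ) • y))) (𝓝[>] 0) (𝓝 (fderiv ℝ h 0 y)) := by
    have := h1.hasDerivWithinAt (s := Ioi 0)
    rw [hasDerivWithinAt_iff_tendsto_slope' (by simp)] at this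
    refine this.congr fun r => ?_
    rw [slope_def_module, sub_zero]
  -- By homogeneity the difference quotient along y is constantly h y for r > 0, so it equals its
  -- limit, the derivative at 0.
  refine tendsto_nhds_unique (tendsto_const_nhds.congr' ?_) h2
  filter_upwards [self_mem_nhdsWithin] with r hr
  have hr' : (0 : ℝ) < r := hr
  rw [zero_smul, h0, sub_zero, hh r hr', smul_eq_mul, inv_mul_cancel_left₀ hr'.ne']

section Homogeneous

variable {EB : Type*} [NormedAddCommGroup EB] [NormedSpace ℝ EB] [FiniteDimensional ℝ EB]
  {HB : Type*} [TopologicalSpace HB] {I : ModelWithCorners ℝ EB HB}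
  {B : Type*} [TopologicalSpace B] [ChartedSpace HB B] [IsManifold I ∞ B] [T2Space B]
  {F : Type*} [NormedAddCommGroup F] [NormedSpace ℝ F] [FiniteDimensional ℝ F]
  {V : B → Type*} [TopologicalSpace (TotalSpace F V)]
  [∀ b, AddCommGroup (V b)] [∀ b, Module ℝ (V b)] [∀ b, TopologicalSpace (V b)]
  [FiberBundle F V] [VectorBundle ℝ F V] [ContMDiffVectorBundle ∞ F V I]
  {EB' : Type*} [NormedAddCommGroup EB'] [NormedSpace ℝ EB'] [FiniteDimensional ℝ EB']
  {HB' : Type*} [TopologicalSpace HB'] {I' : ModelWithCorners ℝ EB' HB'}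
  {B' : Type*} [TopologicalSpace B'] [ChartedSpace HB' B'] [IsManifold I' ∞ B'] [T2Space B']
  {F' : Type*} [NormedAddCommGroup F'] [NormedSpace ℝ F'] [FiniteDimensional ℝ F']
  {V' : B' → Type*} [TopologicalSpace (TotalSpace F' V')]
  [∀ b, AddCommGroup (V' b)] [∀ b, Module ℝ (V' b)] [∀ b, TopologicalSpace (V' b)]
  [FiberBundle F' V'] [VectorBundle ℝ F' V'] [ContMDiffVectorBundle ∞ F' V' I']

variable (I V) in
theorem contMDiff_fibre {G : Type*} [NormedAddCommGroup G] [NormedSpace ℝ G]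
    [FiniteDimensional ℝ G] (b : B) (l : G →ₗ[ℝ] V b) :
    ContMDiff 𝓘(ℝ, G) (I.prod 𝓘(ℝ, F)) ∞ (fun y => (⟨b, l y⟩ : TotalSpace F V)) := by
  rw [contMDiff_totalSpace_iff]
  exact ⟨contMDiff_const,
    fun L => (((L.at b).comp l).toContinuousLinearMap.contDiff).contMDiff⟩

variable (I) in
theorem contMDiff_scale_left (x : TotalSpace F V) :
    ContMDiff 𝓘(ℝ, ℝ) (I.prod 𝓘(ℝ, F)) ∞ (fun r : ℝ => scale r x) :=
  contMDiff_fibre I V x.proj (LinearMap.toSpanSingleton ℝ _ x.2)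

variable (V) in
theorem exists_linearEquiv_fibre (b : B) : Nonempty (V b ≃ₗ[ℝ] F) :=
  ⟨(trivializationAt F V b).linearEquivAt (R := ℝ) b
      (FiberBundle.mem_baseSet_trivializationAt F V b)⟩

/-- A smooth map between total spaces of vector bundles which commutes with the multiplication by
positive scalars is linear on fibres. -/
theorem isFiberwiseLinear_of_homogeneous {f : TotalSpace F V → TotalSpace F' V'}
    (hf : ContMDiff (I.prod 𝓘(ℝ, F)) (I'.prod 𝓘(ℝ, F')) ∞ f)
    (hh : ∀ r : ℝ, 0 < r → ∀ x, f (scale r x) = scale r (f x)) :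
    IsFiberwiseLinear f fun b => (f ⟨b, 0⟩).proj := by
  -- The base point of f (r x) does not depend on r > 0; letting r tend to 0 identifies it with that
  -- of the image of the zero vector, since limits in B' are unique.
  have hproj : ∀ x, (f x).proj = (f ⟨x.proj, 0⟩).proj := fun x => by
    have h1 : Continuous fun r : ℝ => (f (scale r x)).proj :=
      (FiberBundle.continuous_proj F' V').comp
        (hf.continuous.comp (contMDiff_scale_left I x).continuous)
    have h2 : Tendsto (fun r : ℝ => (f (scale r x)).proj) (𝓝[>] 0) (𝓝 (f (scale 0 x)).proj) :=
      (h1.tendsto 0).mono_left nhdsWithin_le_nhds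
    have h3 : scale 0 x = ⟨x.proj, 0⟩ := by simp [scale]
    rw [h3] at h2
    refine tendsto_nhds_unique (tendsto_const_nhds.congr' ?_) h2
    filter_upwards [self_mem_nhdsWithin] with r hr
    rw [hh r hr]
    rfl
  have hex : ∀ (b : B) (v : V b), ∃ w : V' (f ⟨b, 0⟩).proj, f ⟨b, v⟩ = ⟨_, w⟩ := fun b v => by
    have h2 := hproj ⟨b, v⟩
    generalize (f ⟨(⟨b, v⟩ : TotalSpace F V).proj, 0⟩).proj = c at h2
    subst h2
    exact ⟨_, rfl⟩
  choose l hl using hex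
  have hlin : ∀ b, ∀ L : FibreLin I' F' V', ∃ m : V b →ₗ[ℝ] ℝ, ∀ v, L ⟨_, l b v⟩ = m v := by
    intro b L
    obtain ⟨A⟩ := exists_linearEquiv_fibre (F := F) V b
    let h : F → ℝ := fun y => L (f ⟨b, A.symm y⟩)
    have h1 : ContDiff ℝ ∞ h := contMDiff_iff_contDiff.1
      (L.smooth.comp (hf.comp (contMDiff_fibre I V b A.symm.toLinearMap)))
    have h2 : ∀ r : ℝ, 0 < r → ∀ y, h (r • y) = r * h y := fun r hr y => by
      have h3 := hh r hr ⟨b, A.symm y⟩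
      have h4 : f ⟨b, A.symm (r • y)⟩ = scale r (f ⟨b, A.symm y⟩) := by
        rw [← h3, map_smul]
        rfl
      change L (f _) = r * L (f _)
      rw [h4]
      exact (L.linear _).map_smul r _
    refine ⟨(fderiv ℝ h 0 : F →ₗ[ℝ] ℝ).comp A.toLinearMap, fun v => ?_⟩
    have h5 := additive_of_homogeneous ((h1.differentiable (by simp)) 0) h2 (A v)
    refine Eq.trans ?_ h5
    simp only [h, A.symm_apply_apply, hl]
  refine ⟨hproj, ?_, ?_⟩
  · rintro _ _ _ ⟨b, u, v, rfl, rfl, rfl⟩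
    refine ⟨_, l b u, l b v, hl b u, hl b v, ?_⟩
    rw [hl b (u + v)]
    congr 1
    refine fibreLin_ext I' (F := F') fun L => ?_
    obtain ⟨m, hm⟩ := hlin b L
    rw [hm, map_add, ← hm, ← hm]
    exact ((L.linear _).map_add _ _).symm
  · rintro r ⟨b, v⟩
    refine (hl b (r • v)).trans (Eq.trans ?_ (congrArg (scale r) (hl b v)).symm)
    refine congrArg (TotalSpace.mk _) ?_
    change _ = r • l b v
    refine fibreLin_ext I' (F := F') fun L => ?_
    obtain ⟨m, hm⟩ := hlin b L
    rw [hm, map_smul, ← hm]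
    exact ((L.linear _).map_smul _ _).symm

end Homogeneous

/-! ## Smooth families of diffeomorphisms -/

section InverseFamilies

variable {EN : Type*} [NormedAddCommGroup EN] [NormedSpace ℝ EN] [FiniteDimensional ℝ EN]
  {HN : Type*} [TopologicalSpace HN] {J : ModelWithCorners ℝ EN HN} [J.Boundaryless]
  {N : Type*} [TopologicalSpace N] [ChartedSpace HN N] [IsManifold J ∞ N]

/-- A smooth bijection with injective differential is a diffeomorphism. -/
theorem contMDiff_symm_of_injective_mfderiv (f : N ≃ N) (hf : ContMDiff J J ∞ f)
    (hinj : ∀ x (v : TangentSpace J x), mfderiv J J f x v = 0 → v = 0) :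
    ContMDiff J J ∞ f.symm := by
  have : CompleteSpace EN := FiniteDimensional.complete ℝ EN
  intro y₀
  set x₀ := f.symm y₀ with hx₀
  have hfx : f x₀ = y₀ := f.apply_symm_apply y₀
  let χ := extChartAt J x₀
  let χ' := extChartAt J (f x₀)
  let g : EN → EN := χ' ∘ f ∘ χ.symm
  have hχs : ContMDiffAt 𝓘(ℝ, EN) J ∞ χ.symm (χ x₀) :=
    (contMDiffOn_extChartAt_symm x₀).contMDiffAt
      ((isOpen_extChartAt_target x₀).mem_nhds (mem_extChartAt_target x₀))
  have hχx : χ.symm (χ x₀) = x₀ := extChartAt_to_inv x₀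
  have hg : ContDiffAt ℝ ∞ g (χ x₀) := by
    rw [← contMDiffAt_iff_contDiffAt]
    refine ContMDiffAt.comp (χ x₀) (I' := J) (g := χ') ?_ (ContMDiffAt.comp (χ x₀) (hf _) hχs)
    simp only [Function.comp_apply, hχx]
    exact contMDiffAt_extChartAt
  have hd : fderiv ℝ g (χ x₀) = (mfderiv J J f x₀ : EN →L[ℝ] EN) := by
    have h1 : (mfderiv J J f x₀ : EN →L[ℝ] EN) = fderivWithin ℝ g (range J) (χ x₀) :=
      (hf.mdifferentiable (by simp) x₀).mfderiv
    rw [h1, J.range_eq_univ, fderivWithin_univ]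
  have hinj' : Function.Injective (fderiv ℝ g (χ x₀) : EN →ₗ[ℝ] EN) := by
    rw [injective_iff_map_eq_zero]
    intro v hv
    refine hinj x₀ v ?_
    rw [← hd]
    exact hv
  let Λ : EN ≃L[ℝ] EN := (LinearEquiv.ofInjectiveEndo _ hinj').toContinuousLinearEquiv
  have hΛ : HasFDerivAt g (Λ : EN →L[ℝ] EN) (χ x₀) := by
    have h1 : (Λ : EN →L[ℝ] EN) = fderiv ℝ g (χ x₀) := by
      ext v
      rfl
    rw [h1]
    exact (hg.differentiableAt (by simp)).hasFDerivAt
  have hstrict : HasStrictFDerivAt g (Λ : EN →L[ℝ] EN) (χ x₀) :=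
    hg.hasStrictFDerivAt' hΛ (by simp)
  have hlinv : ContDiffAt ℝ ∞ (hg.localInverse hΛ (by simp)) (g (χ x₀)) :=
    hg.to_localInverse hΛ (by simp)
  set li := hg.localInverse hΛ (by simp) with hli
  have hlieq : li (g (χ x₀)) = χ x₀ := hg.localInverse_apply_image hΛ (by simp)
  have hgx : g (χ x₀) = χ' (f x₀) := by simp only [g, Function.comp_apply, hχx]
  have hright : ∀ᶠ z in 𝓝 (g (χ x₀)), g (li z) = z := hstrict.eventually_right_inverse
  have hχ' : ContMDiffAt J 𝓘(ℝ, EN) ∞ χ' (f x₀) := contMDiffAt_extChartAt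
  have hk : ContMDiffAt J J ∞ (fun y => χ.symm (li (χ' y))) (f x₀) := by
    have h1 : ContMDiffAt J 𝓘(ℝ, EN) ∞ (fun y => li (χ' y)) (f x₀) := by
      refine ContMDiffAt.comp (f x₀) (g := li) (I' := 𝓘(ℝ, EN)) ?_ hχ'
      rw [← hgx]
      exact hlinv.contMDiffAt
    refine ContMDiffAt.comp (f x₀) (g := χ.symm) (I' := 𝓘(ℝ, EN)) ?_ h1
    rw [← hgx, hlieq]
    exact hχs
  have hk0 : χ.symm (li (χ' (f x₀))) = x₀ := by rw [← hgx, hlieq, hχx]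
  have hsrc : ∀ᶠ y in 𝓝 (f x₀), y ∈ χ'.source := extChartAt_source_mem_nhds (f x₀)
  have hfk : ContinuousAt (fun y => f (χ.symm (li (χ' y)))) (f x₀) :=
    hf.continuous.continuousAt.comp hk.continuousAt
  rw [← hfx]
  -- The local inverse is a right inverse of f near the point; as f is injective, it agrees there
  -- with the global inverse.
  refine hk.congr_of_eventuallyEq ?_
  have hev : ∀ᶠ y in 𝓝 (f x₀), f (χ.symm (li (χ' y))) ∈ χ'.source := by
    refine hfk.eventually_mem ?_
    rw [hk0]
    exact extChartAt_source_mem_nhds (f x₀)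
  have hev2 : ∀ᶠ y in 𝓝 (f x₀), g (li (χ' y)) = χ' y := by
    refine hχ'.continuousAt.eventually (p := fun z => g (li z) = z) ?_
    rw [← hgx]
    exact hright
  filter_upwards [hsrc, hev, hev2] with y h1 h2 h3
  rw [Equiv.symm_apply_eq]
  exact (χ'.injOn h2 h1 h3).symm

/-- The inverses of a smooth path of diffeomorphisms form a smooth path. -/
theorem contMDiff_symm_family {φ : ℝ → Diffeomorph J J N N ∞}
    (hφ : ContMDiff (𝓘(ℝ, ℝ).prod J) J ∞ fun p : ℝ × N => φ p.1 p.2) :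
    ContMDiff (𝓘(ℝ, ℝ).prod J) J ∞ fun p : ℝ × N => (φ p.1).symm p.2 := by
  -- The differential of Ψ is block triangular: a vector in its kernel has no time component, and
  -- its N component is then killed by the differential of the diffeomorphism φ t. So Ψ has a smooth
  -- inverse.
  let Ψ : ℝ × N ≃ ℝ × N :=
    { toFun := fun p => (p.1, φ p.1 p.2)
      invFun := fun p => (p.1, (φ p.1).symm p.2)
      left_inv := fun p => by simp
      right_inv := fun p => by simp }
  have hΨ : ContMDiff (𝓘(ℝ, ℝ).prod J) (𝓘(ℝ, ℝ).prod J) ∞ Ψ := contMDiff_fst.prodMk hφ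
  have h := contMDiff_symm_of_injective_mfderiv Ψ hΨ ?_
  · exact contMDiff_snd.comp h
  rintro ⟨t, x⟩ v hv
  have hd : HasMFDerivAt (𝓘(ℝ, ℝ).prod J) (𝓘(ℝ, ℝ).prod J) Ψ (t, x)
      (mfderiv (𝓘(ℝ, ℝ).prod J) (𝓘(ℝ, ℝ).prod J) Ψ (t, x)) :=
    (hΨ.mdifferentiable (by simp) _).hasMFDerivAt
  have h1 : HasMFDerivAt (𝓘(ℝ, ℝ).prod J) 𝓘(ℝ, ℝ) (fun p : ℝ × N => p.1) (t, x) _ :=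
    HasMFDerivAt.comp (t, x) (f := Ψ) (g := fun p : ℝ × N => p.1) (hasMFDerivAt_fst (Ψ (t, x))) hd
  have h1' := hasMFDerivAt_unique h1 (hasMFDerivAt_fst (t, x))
  have hv1 : v.1 = 0 := by
    have h2 := DFunLike.congr_fun h1' v
    refine Eq.trans h2.symm ?_
    refine (congrArg (ContinuousLinearMap.fst ℝ ℝ EN) hv).trans ?_
    rfl
  have hsn : HasMFDerivAt (𝓘(ℝ, ℝ).prod J) J (fun p : ℝ × N => φ p.1 p.2) (t, x) _ :=
    HasMFDerivAt.comp (t, x) (f := Ψ) (g := fun p : ℝ × N => p.2) (hasMFDerivAt_snd (Ψ (t, x))) hd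
  have hin : HasMFDerivAt J (𝓘(ℝ, ℝ).prod J) (fun y : N => (t, y)) x _ :=
    (hasMFDerivAt_const t x).prodMk (hasMFDerivAt_id x)
  have hco : HasMFDerivAt J J (φ t) x _ :=
    HasMFDerivAt.comp x (f := fun y : N => (t, y)) (g := fun p : ℝ × N => φ p.1 p.2) hsn hin
  have hid : HasMFDerivAt J J (fun y => (φ t).symm (φ t y)) x _ :=
    HasMFDerivAt.comp x ((φ t).symm.contMDiff.mdifferentiable (by simp) (φ t x)).hasMFDerivAt hco
  have hid' : HasMFDerivAt J J (fun y => (φ t).symm (φ t y)) x (ContinuousLinearMap.id ℝ EN) :=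
    (hasMFDerivAt_id x).congr_of_eventuallyEq (Eventually.of_forall fun y => (φ t).symm_apply_apply y)
  have hu := DFunLike.congr_fun (hasMFDerivAt_unique hid hid') v.2
  have hv2 : v.2 = 0 := by
    refine hu.symm.trans ?_
    have e1 : (((0 : EN →L[ℝ] ℝ).prod (ContinuousLinearMap.id ℝ EN)) v.2 : ℝ × EN) = v := by
      refine Prod.ext ?_ rfl
      exact hv1.symm
    have e2 : mfderiv (𝓘(ℝ, ℝ).prod J) (𝓘(ℝ, ℝ).prod J) Ψ (t, x)
        (((0 : EN →L[ℝ] ℝ).prod (ContinuousLinearMap.id ℝ EN)) v.2 : ℝ × EN) = 0 :=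
      (congrArg (mfderiv (𝓘(ℝ, ℝ).prod J) (𝓘(ℝ, ℝ).prod J) Ψ (t, x)) e1).trans hv
    have e3 := congrArg (ContinuousLinearMap.snd ℝ ℝ EN) e2
    have e4 := congrArg (mfderiv J J (φ t).symm (φ t x)) e3
    refine e4.trans ?_
    exact map_zero (mfderiv J J (φ t).symm (φ t x))
  exact Prod.ext hv1 hv2

end InverseFamilies

/-! ## Automorphisms of a vector bundle acting on sections -/

section Automorphisms

variable {EB : Type*} [NormedAddCommGroup EB] [NormedSpace ℝ EB]
  {HB : Type*} [TopologicalSpace HB] {I : ModelWithCorners ℝ EB HB}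
  {B : Type*} [TopologicalSpace B] [ChartedSpace HB B]
  {F : Type*} [NormedAddCommGroup F] [NormedSpace ℝ F]
  {V : B → Type*} [TopologicalSpace (TotalSpace F V)]
  [∀ b, AddCommGroup (V b)] [∀ b, Module ℝ (V b)] [∀ b, TopologicalSpace (V b)]
  [FiberBundle F V] [VectorBundle ℝ F V]
  {EQ : Type*} [NormedAddCommGroup EQ] [NormedSpace ℝ EQ]
  {HQ : Type*} [TopologicalSpace HQ] {JQ : ModelWithCorners ℝ EQ HQ}
  {Q : Type*} [TopologicalSpace Q] [ChartedSpace HQ Q]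

theorem sec_ext_total {s s' : Sec I F V}
    (h : ∀ b, (⟨b, s b⟩ : TotalSpace F V) = ⟨b, s' b⟩) : s = s' := by
  ext b
  simpa using h b

/-- Pull-back at b is a single linear map between fibres applied to the value of the section at the
image point, which reduces identities for `pullSec` to linear algebra. -/
theorem VBAut.exists_fibre (φ : VBAut I F V) (b : B) : ∃ l : V (φ.base b) →ₗ[ℝ] V b,
    (∀ v, (⟨b, l v⟩ : TotalSpace F V) = φ.total.symm ⟨φ.base b, v⟩) ∧
      ∀ s : Sec I F V, φ.pullSec s b = l (s (φ.base b)) := by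
  obtain ⟨l, hl⟩ := φ.symm.linear.exists_fibre (φ.base.symm_apply_apply b)
  refine ⟨l, hl, fun s => ?_⟩
  have h := (φ.mk_pullSec s b).trans (hl _).symm
  simpa using h

theorem VBAut.mk_symm_pullSec (φ : VBAut I F V) (s : Sec I F V) (b : B) :
    (⟨b, φ.symm.pullSec s b⟩ : TotalSpace F V) = φ.total ⟨φ.base.symm b, s (φ.base.symm b)⟩ :=
  φ.symm.mk_pullSec s b

theorem VBAut.total_pullSec (φ : VBAut I F V) (s : Sec I F V) (b : B) :
    φ.total ⟨b, φ.pullSec s b⟩ = ⟨φ.base b, s (φ.base b)⟩ := by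
  rw [φ.mk_pullSec, φ.total.apply_symm_apply]

@[simp] theorem VBAut.pullSec_symm_pullSec (φ : VBAut I F V) (s : Sec I F V) :
    φ.pullSec (φ.symm.pullSec s) = s := by
  refine sec_ext_total fun b => ?_
  rw [φ.mk_pullSec, φ.mk_symm_pullSec, φ.total.symm_apply_apply, φ.base.symm_apply_apply]

@[simp] theorem VBAut.symm_pullSec_pullSec (φ : VBAut I F V) (s : Sec I F V) :
    φ.symm.pullSec (φ.pullSec s) = s := by
  refine sec_ext_total fun b => ?_
  rw [φ.mk_symm_pullSec, φ.total_pullSec, φ.base.apply_symm_apply]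

/-- The pull-back of sections, as a linear map. -/
def VBAut.pullSecL (φ : VBAut I F V) : Sec I F V →ₗ[ℝ] Sec I F V where
  toFun := φ.pullSec
  map_add' s t := by
    ext b
    obtain ⟨l, -, hl⟩ := φ.exists_fibre b
    rw [ContMDiffSection.coe_add, Pi.add_apply, hl, hl, hl, ContMDiffSection.coe_add, Pi.add_apply,
      map_add]
  map_smul' r s := by
    ext b
    obtain ⟨l, -, hl⟩ := φ.exists_fibre b
    rw [ContMDiffSection.coe_smul, Pi.smul_apply, hl, hl, ContMDiffSection.coe_smul,
      Pi.smul_apply, map_smul]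
    rfl

/-- The pull-back of functions on the base. -/
def VBAut.pullFun (φ : VBAut I F V) (f : C^∞⟮I, B; ℝ⟯) : C^∞⟮I, B; ℝ⟯ :=
  ⟨fun b => f (φ.base b), f.contMDiff.comp φ.base.contMDiff⟩

@[simp] theorem VBAut.pullFun_apply (φ : VBAut I F V) (f : C^∞⟮I, B; ℝ⟯) (b : B) :
    φ.pullFun f b = f (φ.base b) := rfl

theorem VBAut.pullSec_fsmul (φ : VBAut I F V) (f : C^∞⟮I, B; ℝ⟯) (s : Sec I F V) :
    φ.pullSec (fsmul f s) = fsmul (φ.pullFun f) (φ.pullSec s) := by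
  ext b
  obtain ⟨l, -, hl⟩ := φ.exists_fibre b
  rw [fsmul_apply, hl, hl, fsmul_apply, map_smul, φ.pullFun_apply]

theorem VBAut.base_eq (φ : VBAut I F V) (b : B) : φ.base b = (φ.total ⟨b, 0⟩).proj :=
  (φ.linear.proj ⟨b, 0⟩).symm

theorem FibDeriv.pullSec {φ : VBAut I F V} {s : ℝ → Sec I F V} {s' : Sec I F V} {t : ℝ}
    (h : ∀ b, FibDeriv (fun τ => s τ b) (s' b) t) (b : B) :
    FibDeriv (fun τ => φ.pullSec (s τ) b) (φ.pullSec s' b) t := by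
  obtain ⟨l, -, hl⟩ := φ.exists_fibre b
  simp only [hl]
  exact (h _).map l

/-- The chain rule, with the base point b decoupled from γ t: for the generator of a path φ, the
curve at time t is at φ_t(φ_t⁻¹ b), equal to b only propositionally. -/
theorem dirDeriv_comp_deriv {b c : B} (h : c = b) {γ : ℝ → B} {t : ℝ} (hc : γ t = c)
    (hγ : MDifferentiableAt 𝓘(ℝ, ℝ) I γ t) {f : B → ℝ} (hf : MDifferentiableAt I 𝓘(ℝ, ℝ) f b) :
    HasDerivAt (fun τ => f (γ τ)) (dirDeriv (I := I) (b := b)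
      ((mfderiv 𝓘(ℝ, ℝ) I γ t : ℝ →L[ℝ] EB) 1 : EB) f) t := by
  subst h
  subst hc
  let A : EB →L[ℝ] ℝ := mfderiv I 𝓘(ℝ, ℝ) f (γ t)
  let C : ℝ →L[ℝ] EB := mfderiv 𝓘(ℝ, ℝ) I γ t
  have h1 : HasFDerivAt (fun τ => f (γ τ)) (A.comp C) t :=
    (HasMFDerivAt.comp t hf.hasMFDerivAt hγ.hasMFDerivAt).hasFDerivAt
  exact h1.hasDerivAt

variable [FiniteDimensional ℝ EB] [IsManifold I ∞ B] [T2Space B] [FiniteDimensional ℝ F]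
  [ContMDiffVectorBundle ∞ F V I] [I.Boundaryless]

/-- Smooth paths of automorphisms. -/
def SmoothAutPath (φ : ℝ → VBAut I F V) : Prop :=
  ContMDiff (𝓘(ℝ, ℝ).prod (I.prod 𝓘(ℝ, F))) (I.prod 𝓘(ℝ, F)) ∞
    fun p : ℝ × TotalSpace F V => (φ p.1).total p.2

theorem SmoothAutPath.symm {φ : ℝ → VBAut I F V} (h : SmoothAutPath φ) :
    SmoothAutPath fun t => (φ t).symm :=
  contMDiff_symm_family (φ := fun t => (φ t).total) h

theorem SmoothAutPath.base {φ : ℝ → VBAut I F V} (h : SmoothAutPath φ) :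
    ContMDiff (𝓘(ℝ, ℝ).prod I) I ∞ fun p : ℝ × B => (φ p.1).base p.2 := by
  have h1 : ContMDiff (𝓘(ℝ, ℝ).prod I) I ∞
      fun p : ℝ × B => ((φ p.1).total (zeroSection F V p.2)).proj :=
    (Bundle.contMDiff_proj V).comp (ContMDiff.comp (g := fun p : ℝ × TotalSpace F V =>
      (φ p.1).total p.2) h (contMDiff_fst.prodMk
      ((Bundle.contMDiff_zeroSection ℝ V).comp contMDiff_snd)))
  exact h1.congr fun p => (φ p.1).base_eq p.2

theorem SmoothAutPath.pullSec {φ : ℝ → VBAut I F V} (h : SmoothAutPath φ) {g : Q → ℝ}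
    (hg : ContMDiff JQ 𝓘(ℝ, ℝ) ∞ g) {s : Q → Sec I F V} (hs : SmoothFam JQ s) :
    SmoothFam JQ fun q => (φ (g q)).pullSec (s q) := by
  have h1 : ContMDiff (JQ.prod I) I ∞ fun p : Q × B => (φ (g p.1)).base p.2 :=
    ContMDiff.comp (g := fun p : ℝ × B => (φ p.1).base p.2) h.base
      ((hg.comp contMDiff_fst).prodMk contMDiff_snd)
  have h2 : ContMDiff (JQ.prod I) (I.prod 𝓘(ℝ, F)) ∞
      fun p : Q × B => (⟨(φ (g p.1)).base p.2, s p.1 ((φ (g p.1)).base p.2)⟩ : TotalSpace F V) :=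
    ContMDiff.comp (g := fun p : Q × B => (⟨p.2, s p.1 p.2⟩ : TotalSpace F V)) hs
      (contMDiff_fst.prodMk h1)
  have h3 : ContMDiff (JQ.prod I) (I.prod 𝓘(ℝ, F)) ∞ fun p : Q × B =>
      (φ (g p.1)).total.symm ⟨(φ (g p.1)).base p.2, s p.1 ((φ (g p.1)).base p.2)⟩ :=
    ContMDiff.comp (g := fun p : ℝ × TotalSpace F V => (φ p.1).total.symm p.2) h.symm
      ((hg.comp contMDiff_fst).prodMk h2)
  exact h3.congr fun p => (φ (g p.1)).mk_pullSec (s p.1) p.2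

/-- A smooth path of automorphisms is generated by a smooth path of derivations. -/
theorem SmoothAutPath.exists_generator {φ : ℝ → VBAut I F V} (h : SmoothAutPath φ) :
    ∃ (D : ℝ → Sec I F V →ₗ[ℝ] Sec I F V) (X : ∀ (_ : ℝ) (b : B), TangentSpace I b),
      (∀ t, IsDerivation (D t) (X t)) ∧
      (∀ t, ContMDiff I I.tangent ∞ fun b => (⟨b, X t b⟩ : TangentBundle I B)) ∧
      (∀ s, SmoothFam 𝓘(ℝ, ℝ) fun t => D t s) ∧
      ∀ s t b, FibDeriv (fun τ => (φ τ).pullSec s b) ((φ t).pullSec (D t s) b) t := by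
  have hex := fun s : Sec I F V =>
    (h.pullSec (contMDiff_id (I := 𝓘(ℝ, ℝ))) (smoothFam_const s)).exists_deriv
  choose P hP hPd using hex
  have hPd' : ∀ s t b, FibDeriv (fun τ => (φ τ).pullSec s b) (P s t b) t := hPd
  have hadd : ∀ t s s', P (s + s') t = P s t + P s' t := fun t s s' => by
    ext b
    refine (hPd' (s + s') t b).unique ?_
    have h2 : (fun τ => (φ τ).pullSec (s + s') b) =
        fun τ => (φ τ).pullSec s b + (φ τ).pullSec s' b := by
      funext τ
      exact congrArg (fun w : Sec I F V => w b) ((φ τ).pullSecL.map_add s s')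
    rw [h2]
    exact (hPd' s t b).add (hPd' s' t b)
  have hsmul : ∀ t (r : ℝ) s, P (r • s) t = r • P s t := fun t r s => by
    ext b
    refine (hPd' (r • s) t b).unique ?_
    have h2 : (fun τ => (φ τ).pullSec (r • s) b) = fun τ => r • (φ τ).pullSec s b := by
      funext τ
      exact congrArg (fun w : Sec I F V => w b) ((φ τ).pullSecL.map_smul r s)
    rw [h2]
    exact (hPd' s t b).map (LinearMap.lsmul ℝ (V b) r)
  have hcurve : ∀ (t : ℝ) (b : B), ContMDiff 𝓘(ℝ, ℝ) I ∞
      fun τ => (φ τ).base ((φ t).base.symm b) := fun t b =>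
    ContMDiff.comp (g := fun p : ℝ × B => (φ p.1).base p.2) h.base
      (contMDiff_id.prodMk contMDiff_const)
  -- The generator is (φ_t⁻¹)^* after d/dt φ_t^*; its symbol at b is the velocity at time t of τ ↦
  -- φ_τ(φ_t⁻¹ b).
  let D : ℝ → Sec I F V →ₗ[ℝ] Sec I F V := fun t =>
    (φ t).symm.pullSecL.comp
      ({ toFun := fun s => P s t, map_add' := hadd t, map_smul' := hsmul t } :
        Sec I F V →ₗ[ℝ] Sec I F V)
  let X : ∀ (_ : ℝ) (b : B), TangentSpace I b := fun t b =>
    ((mfderiv 𝓘(ℝ, ℝ) I (fun τ => (φ τ).base ((φ t).base.symm b)) t : ℝ →L[ℝ] EB) 1 : EB)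
  have hXd : ∀ t b {f : B → ℝ}, ContMDiff I 𝓘(ℝ, ℝ) ∞ f →
      HasDerivAt (fun τ => f ((φ τ).base ((φ t).base.symm b))) (dirDeriv (X t b) f) t :=
    fun t b f hf => dirDeriv_comp_deriv ((φ t).base.apply_symm_apply b) rfl
      ((hcurve t b).mdifferentiable (by simp) t) (hf.mdifferentiable (by simp) b)
  refine ⟨D, X, ?_, ?_, ?_, ?_⟩
  · intro t f s b
    set c := (φ t).base.symm b with hc
    have hcb : (φ t).base c = b := (φ t).base.apply_symm_apply b
    have h1 : FibDeriv (fun τ => (φ τ).pullSec (fsmul f s) c)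
        (dirDeriv (X t b) f • (φ t).pullSec s c + f ((φ t).base c) • P s t c) t := by
      have h2 : (fun τ => (φ τ).pullSec (fsmul f s) c) =
          fun τ => f ((φ τ).base c) • (φ τ).pullSec s c := by
        funext τ
        rw [(φ τ).pullSec_fsmul, fsmul_apply, (φ τ).pullFun_apply]
      rw [h2]
      exact FibDeriv.smul (hXd t b f.contMDiff) (hPd' s t c)
    have h3 := (hPd' (fsmul f s) t c).unique h1
    obtain ⟨l, hl⟩ : ∃ l : V c →ₗ[ℝ] V b, ∀ s, (φ t).symm.pullSec s b = l (s c) :=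
      let ⟨l, _, hl⟩ := (φ t).symm.exists_fibre b
      ⟨l, hl⟩
    have h4 : D t (fsmul f s) b = l (P (fsmul f s) t c) := hl _
    have h5 : D t s b = l (P s t c) := hl _
    have h6 : s b = l ((φ t).pullSec s c) := by
      have := hl ((φ t).pullSec s)
      rwa [(φ t).symm_pullSec_pullSec] at this
    rw [h4, h3, map_add, map_smul, map_smul, ← h5, ← h6, hcb]
  · intro t
    refine (isCoordFamily_contMDiff I B).contMDiff_tangent contMDiff_id fun f hf => ?_
    have h1 : ContMDiff (𝓘(ℝ, ℝ).prod I) 𝓘(ℝ, ℝ) ∞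
        fun p : ℝ × B => f ((φ p.1).base ((φ t).base.symm p.2)) :=
      ContMDiff.comp (g := f) hf (ContMDiff.comp (g := fun p : ℝ × B => (φ p.1).base p.2) h.base
        (contMDiff_fst.prodMk ((φ t).base.symm.contMDiff.comp contMDiff_snd)))
    have h2 := (contMDiff_deriv_fst
      (f := fun τ b => f ((φ τ).base ((φ t).base.symm b))) h1).comp
      ((contMDiff_const (c := t)).prodMk (contMDiff_id (I := I) (M := B)))
    exact h2.congr fun b => (hXd t b hf).deriv.symm
  · intro s
    exact h.symm.pullSec contMDiff_id (hP s)
  · intro s t b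
    have h1 : (φ t).pullSec (D t s) = P s t := (φ t).pullSec_symm_pullSec _
    rw [h1]
    exact hPd' s t b

/-- The derivative of the pull-back of a smooth family of sections. -/
theorem SmoothAutPath.fibDeriv_pullSec {φ : ℝ → VBAut I F V} (h : SmoothAutPath φ)
    {s : ℝ → Sec I F V} (hs : SmoothFam 𝓘(ℝ, ℝ) s) {t : ℝ} {s' d : Sec I F V}
    (hs' : ∀ b, FibDeriv (fun τ => s τ b) (s' b) t)
    (hd : ∀ b, FibDeriv (fun τ => (φ τ).pullSec (s t) b) ((φ t).pullSec d b) t) (b : B) :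
    FibDeriv (fun τ => (φ τ).pullSec (s τ) b) ((φ t).pullSec (d + s') b) t := by
  have h0 : SmoothFam (𝓘(ℝ, ℝ).prod 𝓘(ℝ, ℝ)) fun p : ℝ × ℝ => s p.2 :=
    hs.comp (JR := 𝓘(ℝ, ℝ).prod 𝓘(ℝ, ℝ)) (g := fun p : ℝ × ℝ => p.2) contMDiff_snd
  have h2 : SmoothFam (𝓘(ℝ, ℝ).prod 𝓘(ℝ, ℝ)) fun p : ℝ × ℝ => (φ p.1).pullSec (s p.2) :=
    h.pullSec (g := fun p : ℝ × ℝ => p.1) contMDiff_fst h0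
  have h1 : FibDeriv (fun τ => (φ τ).pullSec (s τ) b)
      ((φ t).pullSec d b + (φ t).pullSec s' b) t :=
    fibDeriv_diag (u := fun p : ℝ × ℝ => (φ p.1).pullSec (s p.2)) h2 (hd b)
      (FibDeriv.pullSec (φ := φ t) hs' b)
  have h3 : (φ t).pullSec (d + s') = (φ t).pullSec d + (φ t).pullSec s' :=
    (φ t).pullSecL.map_add d s'
  rw [h3]
  exact h1

end Automorphisms

/-! ## Gerstenhaber brackets in low degrees -/

section LowDegree

variable {G : Type*} [AddCommGroup G]

/-- There are two (1,1)-shuffles and a single (2,0)-shuffle. For skew b the right side is b(Ds₀, s₁)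
+ b(s₀, Ds₁) − D b(s₀, s₁), the infinitesimal action of D on b. -/
theorem gerst_one_zero (b : (Fin 2 → G) → G) (D : (Fin 1 → G) → G) (s : Fin 2 → G) :
    gerst (k := 1) (l := 0) b D s =
      b ![D ![s 0], s 1] - b ![D ![s 1], s 0] - D ![b ![s 0, s 1]] := by
  have h1 : (Finset.univ.filter fun τ : Equiv.Perm (Fin (0 + 1 + 1)) => IsShuffle (0 + 1) 1 τ) =
      {1, Equiv.swap 0 1} := by decide
  have h2 : (Finset.univ.filter fun τ : Equiv.Perm (Fin (1 + 1 + 0)) => IsShuffle (1 + 1) 0 τ) =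
      {1} := by decide
  have h3 : (1 : Equiv.Perm (Fin (0 + 1 + 1))) ≠ Equiv.swap 0 1 := by decide
  unfold gerst gerstProd
  rw [h1, h2, Finset.sum_pair h3, Finset.sum_singleton]
  have hs : Equiv.Perm.sign (Equiv.swap (0 : Fin (0 + 1 + 1)) 1) = -1 :=
    Equiv.Perm.sign_swap (by decide)
  rw [hs]
  simp only [mul_zero, pow_zero, one_smul, Equiv.Perm.sign_one, Units.val_one, Units.val_neg,
    neg_smul, ← sub_eq_add_neg]
  congr 1
  · congr 1
    · congr 1
      funext i
      fin_cases i
      · change D _ = D _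
        congr 1
        funext i
        fin_cases i
        rfl
      · rfl
    · congr 1
      funext i
      fin_cases i
      · change D _ = D _
        congr 1
        funext i
        fin_cases i
        rfl
      · rfl
  · congr 1
    funext i
    fin_cases i
    change b _ = b _
    congr 1
    funext i
    fin_cases i <;> rfl

/-- The Gerstenhaber product of two maps with two entries. -/
theorem gerstProd_one_two (b c : (Fin 2 → G) → G) (s : Fin 3 → G) :
    gerstProd (k := 1) (l := 2) b c s =
      b ![c ![s 0, s 1], s 2] - b ![c ![s 0, s 2], s 1] + b ![c ![s 1, s 2], s 0] := by
  have h1 : (Finset.univ.filter fun τ : Equiv.Perm (Fin (2 + 1)) => IsShuffle 2 1 τ) =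
      {1, Equiv.swap 1 2, Equiv.swap 0 1 * Equiv.swap 1 2} := by decide
  unfold gerstProd
  rw [h1, Finset.sum_insert (by decide), Finset.sum_pair (by decide)]
  have hs : Equiv.Perm.sign (Equiv.swap (1 : Fin (2 + 1)) 2) = -1 :=
    Equiv.Perm.sign_swap (by decide)
  have hs' : Equiv.Perm.sign (Equiv.swap (0 : Fin (2 + 1)) 1) = -1 :=
    Equiv.Perm.sign_swap (by decide)
  rw [Equiv.Perm.sign_mul, hs, hs']
  simp only [Equiv.Perm.sign_one, Units.val_one, Units.val_neg, neg_smul, one_smul, neg_mul_neg,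
    mul_one, sub_eq_add_neg, add_assoc]
  have key : ∀ τ : Equiv.Perm (Fin (2 + 1)),
      b (Fin.cons (c fun i => s (τ (Fin.castAdd 1 i))) fun j => s (τ (Fin.natAdd 2 j))) =
        b ![c ![s (τ 0), s (τ 1)], s (τ 2)] := fun τ => by
    congr 1
    funext i
    fin_cases i
    · change c _ = c _
      congr 1
      funext i
      fin_cases i <;> rfl
    · rfl
  simp only [key]
  rfl

variable [Module ℝ G]

/-- The alternating map with two entries given by an alternating bilinear map. -/
def altOfBil (b : G →ₗ[ℝ] G →ₗ[ℝ] G) (hb : ∀ s, b s s = 0) : G [⋀^Fin 2]→ₗ[ℝ] G where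
  toFun s := b (s 0) (s 1)
  map_update_add' m i x y := by
    fin_cases i <;> simp [Function.update]
  map_update_smul' m i c x := by
    fin_cases i <;> simp [Function.update]
  map_eq_zero_of_eq' v i j h hij := by
    fin_cases i <;> fin_cases j <;> simp_all

theorem alt_pair_swap (c : G [⋀^Fin 2]→ₗ[ℝ] G) (s t : G) : c ![s, t] = -c ![t, s] := by
  have h := c.map_swap ![t, s] (show (0 : Fin 2) ≠ 1 by decide)
  rw [← h]
  congr 1
  funext i
  fin_cases i <;> rfl

/-- The bilinear map of an alternating map with two entries. -/
def bilOfAlt (c : G [⋀^Fin 2]→ₗ[ℝ] G) : G →ₗ[ℝ] G →ₗ[ℝ] G :=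
  LinearMap.mk₂ ℝ (fun s t => c ![s, t]) (fun s s' t => c.map_vecCons_add _ s s')
    (fun r s t => c.map_vecCons_smul _ r s)
    (fun s t t' => by
      rw [alt_pair_swap, c.map_vecCons_add, alt_pair_swap c s t, alt_pair_swap c s t', neg_add])
    (fun r s t => by
      rw [alt_pair_swap, c.map_vecCons_smul, alt_pair_swap c s t, smul_neg])

/-- The linear map of an alternating map with one entry. -/
def linOfAlt (c : G [⋀^Fin 1]→ₗ[ℝ] G) : G →ₗ[ℝ] G where
  toFun s := c ![s]
  map_add' s t := c.map_vecCons_add _ s t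
  map_smul' r s := c.map_vecCons_smul _ r s

/-- The alternating map with one entry given by a linear map. -/
def altOfLin (D : G →ₗ[ℝ] G) : G [⋀^Fin 1]→ₗ[ℝ] G where
  toFun s := D (s 0)
  map_update_add' m i x y := by
    fin_cases i; simp
  map_update_smul' m i c x := by
    fin_cases i; simp
  map_eq_zero_of_eq' v i j h hij := (hij (Subsingleton.elim i j)).elim

theorem snoc_one (s : Fin 1 → G) (t : G) : Fin.snoc (α := fun _ => G) s t = ![s 0, t] := by
  funext i
  fin_cases i <;> rfl

theorem snoc_zero (s : Fin 0 → G) (t : G) : Fin.snoc (α := fun _ => G) s t = ![t] := by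
  funext i
  fin_cases i
  rfl

end LowDegree

/-! ## Derivations with one and two entries -/

section Biderivations

variable {EB : Type*} [NormedAddCommGroup EB] [NormedSpace ℝ EB]
  {HB : Type*} [TopologicalSpace HB] {I : ModelWithCorners ℝ EB HB}
  {B : Type*} [TopologicalSpace B] [ChartedSpace HB B] [IsManifold I ∞ B]
  {F : Type*} [NormedAddCommGroup F] [NormedSpace ℝ F]
  {V : B → Type*} [TopologicalSpace (TotalSpace F V)]
  [∀ b, AddCommGroup (V b)] [∀ b, Module ℝ (V b)] [∀ b, TopologicalSpace (V b)]
  [FiberBundle F V] [VectorBundle ℝ F V]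

/-- The bilinear map `c` on sections is a derivation in its second entry, with symbol `σ`. -/
structure IsBider (c : Sec I F V →ₗ[ℝ] Sec I F V →ₗ[ℝ] Sec I F V)
    (σ : ∀ b : B, V b →ₗ[ℝ] TangentSpace I b) : Prop where
  smooth : ∀ s : Sec I F V,
    ContMDiff I I.tangent ∞ fun b => (⟨b, σ b (s b)⟩ : TangentBundle I B)
  deriv : ∀ s : Sec I F V, IsDerivation (c s) fun b => σ b (s b)

theorem LieAlgebroid.isBider (L : LieAlgebroid I F V) : IsBider L.bracket L.anchor where
  smooth s := L.contMDiff_anchor.comp s.contMDiff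
  deriv s f t b := L.leibniz s t f b

theorem LieAlgebroid.bracket_swap (L : LieAlgebroid I F V) (s t : Sec I F V) :
    L.bracket s t = -L.bracket t s := by
  have h := L.bracket_self (s + t)
  simp only [map_add, LinearMap.add_apply, L.bracket_self, zero_add, add_zero] at h
  exact eq_neg_of_add_eq_zero_right h

theorem IsBider.isMultiderivation {c : Sec I F V →ₗ[ℝ] Sec I F V →ₗ[ℝ] Sec I F V}
    {σ : ∀ b : B, V b →ₗ[ℝ] TangentSpace I b} (h : IsBider c σ) (hc : ∀ s, c s s = 0) :
    IsMultiderivation (k := 1) (altOfBil c hc) := by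
  refine ⟨fun b => AlternatingMap.ofSubsingleton ℝ (V b) (TangentSpace I b) (0 : Fin 1) (σ b),
    fun s => h.smooth (s 0), fun s f t b => ?_⟩
  rw [snoc_one, snoc_one]
  exact h.deriv (s 0) f t b

theorem IsDerivation.isMultiderivation {D : Sec I F V →ₗ[ℝ] Sec I F V}
    {X : ∀ b : B, TangentSpace I b} (h : IsDerivation D X)
    (hX : ContMDiff I I.tangent ∞ fun b => (⟨b, X b⟩ : TangentBundle I B)) :
    IsMultiderivation (k := 0) (altOfLin D) := by
  refine ⟨fun b => AlternatingMap.constOfIsEmpty ℝ (V b) (Fin 0) (X b), fun s => hX,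
    fun s f t b => ?_⟩
  rw [snoc_zero, snoc_zero]
  exact h f t b

theorem IsMultiderivation.exists_isBider {c : (Sec I F V) [⋀^Fin 2]→ₗ[ℝ] (Sec I F V)}
    (h : IsMultiderivation (k := 1) c) : ∃ σ, IsBider (bilOfAlt c) σ := by
  obtain ⟨σ, hσ, hc⟩ := h
  refine ⟨fun b => (AlternatingMap.ofSubsingleton ℝ (V b) (TangentSpace I b) (0 : Fin 1)).symm (σ b),
    fun s => ?_, fun s f t b => ?_⟩
  · exact hσ fun _ => s
  · have h1 := hc (fun _ => s) f t b
    rw [snoc_one, snoc_one] at h1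
    exact h1

theorem IsMultiderivation.exists_isDerivation {c : (Sec I F V) [⋀^Fin 1]→ₗ[ℝ] (Sec I F V)}
    (h : IsMultiderivation (k := 0) c) : ∃ X, IsDerivation (linOfAlt c) X ∧
      ContMDiff I I.tangent ∞ fun b => (⟨b, X b⟩ : TangentBundle I B) := by
  obtain ⟨σ, hσ, hc⟩ := h
  refine ⟨fun b => σ b Fin.elim0, fun f t b => ?_, ?_⟩
  · have h1 := hc Fin.elim0 f t b
    rw [snoc_zero, snoc_zero] at h1
    have h2 : (fun i => (Fin.elim0 i : Sec I F V) b) = (Fin.elim0 : Fin 0 → V b) := Subsingleton.elim _ _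
    rw [h2] at h1
    exact h1
  · have h1 := hσ Fin.elim0
    refine h1.congr fun b => ?_
    exact congrArg (fun v => (⟨b, σ b v⟩ : TangentBundle I B)) (Subsingleton.elim _ _)

theorem dirDeriv_sub {b : B} (X Y : TangentSpace I b) (f : B → ℝ) :
    dirDeriv (X - Y) f = dirDeriv X f - dirDeriv Y f :=
  map_sub (mfderiv I 𝓘(ℝ, ℝ) f b) X Y

theorem dirDeriv_zero {b : B} (f : B → ℝ) : dirDeriv (0 : TangentSpace I b) f = 0 :=
  map_zero (mfderiv I 𝓘(ℝ, ℝ) f b)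

/-- The pull-back of a bilinear map on sections by an automorphism. -/
def VBAut.pullBil (φ : VBAut I F V) (c : Sec I F V →ₗ[ℝ] Sec I F V →ₗ[ℝ] Sec I F V) :
    Sec I F V →ₗ[ℝ] Sec I F V →ₗ[ℝ] Sec I F V :=
  (c.compl₁₂ φ.symm.pullSecL φ.symm.pullSecL).compr₂ φ.pullSecL

@[simp] theorem VBAut.pullBil_apply (φ : VBAut I F V)
    (c : Sec I F V →ₗ[ℝ] Sec I F V →ₗ[ℝ] Sec I F V) (s t : Sec I F V) :
    φ.pullBil c s t = φ.pullSec (c (φ.symm.pullSec s) (φ.symm.pullSec t)) := rfl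

variable [FiniteDimensional ℝ EB] [T2Space B]

theorem IsBider.sub {c c' : Sec I F V →ₗ[ℝ] Sec I F V →ₗ[ℝ] Sec I F V}
    {σ σ' : ∀ b : B, V b →ₗ[ℝ] TangentSpace I b} (h : IsBider c σ) (h' : IsBider c' σ') :
    IsBider (c - c') fun b => σ b - σ' b where
  smooth s := by
    refine (isCoordFamily_contMDiff I B).contMDiff_tangent contMDiff_id fun f hf => ?_
    have h1 : ∀ {X : ∀ b : B, TangentSpace I b},
        (ContMDiff I I.tangent ∞ fun b => (⟨b, X b⟩ : TangentBundle I B)) →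
        ContMDiff I 𝓘(ℝ, ℝ) ∞ fun b => dirDeriv (X b) f := fun hX =>
      contMDiff_dirDeriv (JQ := I) (J := I) (f := fun _ => f) (ContMDiff.comp (g := f) hf contMDiff_snd) hX
    exact ((h1 (h.smooth s)).sub (h1 (h'.smooth s))).congr fun b => dirDeriv_sub _ _ _
  deriv s f t b := by
    have h1 := h.deriv s f t b
    have h2 := h'.deriv s f t b
    have h3 : dirDeriv (σ b (s b) - σ' b (s b)) f =
      dirDeriv (σ b (s b)) f - dirDeriv (σ' b (s b)) f := dirDeriv_sub _ _ _
    change c s (fsmul f t) b - c' s (fsmul f t) b =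
      dirDeriv (σ b (s b) - σ' b (s b)) f • t b + f b • (c s t b - c' s t b)
    rw [h1, h2, h3, sub_smul, smul_sub]
    abel

/-- The new symbol is the old one conjugated by φ and by the differential of its base map. The last
clause states this on test functions, the form in which two anchors can be compared. -/
theorem IsBider.pull (φ : VBAut I F V) {c : Sec I F V →ₗ[ℝ] Sec I F V →ₗ[ℝ] Sec I F V}
    {σ : ∀ b : B, V b →ₗ[ℝ] TangentSpace I b} (h : IsBider c σ) :
    ∃ σ' : ∀ b : B, V b →ₗ[ℝ] TangentSpace I b, IsBider (φ.pullBil c) σ' ∧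
      ∀ (s : Sec I F V) (b : B) (f : C^∞⟮I, B; ℝ⟯), dirDeriv (σ' b (s b)) f =
        dirDeriv (σ (φ.base b) (φ.symm.pullSec s (φ.base b))) (φ.symm.pullFun f) := by
  have hex : ∀ b, ∃ l : V b →ₗ[ℝ] V (φ.base b), ∀ s : Sec I F V,
      φ.symm.pullSec s (φ.base b) = l (s b) := fun b => by
    have h2 : φ.base.symm (φ.base b) = b := φ.base.symm_apply_apply b
    obtain ⟨l, hl⟩ := φ.linear.exists_fibre (b := b) rfl
    refine ⟨l, fun s => ?_⟩
    have h3 := φ.mk_symm_pullSec s (φ.base b)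
    rw [h2] at h3
    simpa using h3.trans (hl _).symm
  choose l hl using hex
  let dφ : ∀ b : B, EB →L[ℝ] EB := fun b => mfderiv I I φ.base.symm (φ.base b)
  let σ' : ∀ b : B, V b →ₗ[ℝ] TangentSpace I b := fun b =>
    ((dφ b : EB →ₗ[ℝ] EB).comp ((σ (φ.base b) : V (φ.base b) →ₗ[ℝ] EB).comp (l b)) : V b →ₗ[ℝ] EB)
  have hσ' : ∀ (s : Sec I F V) (b : B) (f : C^∞⟮I, B; ℝ⟯), dirDeriv (σ' b (s b)) f =
        dirDeriv (σ (φ.base b) (φ.symm.pullSec s (φ.base b))) (φ.symm.pullFun f) := by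
    intro s b f
    have h2 : φ.base.symm (φ.base b) = b := φ.base.symm_apply_apply b
    have hd : HasMFDerivAt I I φ.base.symm (φ.base b) (dφ b) :=
      (φ.base.symm.contMDiff.mdifferentiable (by simp) _).hasMFDerivAt
    have hf : HasMFDerivAt I 𝓘(ℝ, ℝ) f (φ.base.symm (φ.base b)) (mfderiv I 𝓘(ℝ, ℝ) f b : EB →L[ℝ] ℝ) := by
      have h4 := (f.contMDiff.mdifferentiable (by simp) (φ.base.symm (φ.base b))).hasMFDerivAt
      have key : ∀ y, y = b → HasMFDerivAt I 𝓘(ℝ, ℝ) f y (mfderiv I 𝓘(ℝ, ℝ) f b : EB →L[ℝ] ℝ) := by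
        rintro y rfl
        exact (f.contMDiff.mdifferentiable (by simp) y).hasMFDerivAt
      exact key _ h2
    have h5 := (HasMFDerivAt.comp (φ.base b) (f := φ.base.symm) (g := f) hf hd).mfderiv
    have h6 := DFunLike.congr_fun h5 (σ (φ.base b) (φ.symm.pullSec s (φ.base b)))
    refine Eq.trans ?_ h6.symm
    exact congrArg (fun v => (mfderiv I 𝓘(ℝ, ℝ) f b : EB →L[ℝ] ℝ) (dφ b (σ (φ.base b) v))) (hl b s).symm
  refine ⟨σ', ⟨fun s => ?_, fun s f t b => ?_⟩, hσ'⟩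
  · refine (isCoordFamily_contMDiff I B).contMDiff_tangent contMDiff_id fun f hf => ?_
    let f' : C^∞⟮I, B; ℝ⟯ := ⟨f, hf⟩
    have h1 : ContMDiff I 𝓘(ℝ, ℝ) ∞
        fun y => dirDeriv (σ y (φ.symm.pullSec s y)) (φ.symm.pullFun f') :=
      contMDiff_dirDeriv (f := fun _ => φ.symm.pullFun f')
        ((φ.symm.pullFun f').contMDiff.comp contMDiff_snd) (h.smooth (φ.symm.pullSec s))
    exact (h1.comp φ.base.contMDiff).congr fun b => hσ' s b f'
  · have h1 : φ.symm.pullSec (fsmul f t) = fsmul (φ.symm.pullFun f) (φ.symm.pullSec t) :=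
      φ.symm.pullSec_fsmul f t
    obtain ⟨m, -, hm⟩ := φ.exists_fibre b
    have h2 : φ.pullBil c s (fsmul f t) b =
        m (c (φ.symm.pullSec s) (φ.symm.pullSec (fsmul f t)) (φ.base b)) := hm _
    have h3 : φ.pullBil c s t b =
        m (c (φ.symm.pullSec s) (φ.symm.pullSec t) (φ.base b)) := hm _
    have h4 : t b = m (φ.symm.pullSec t (φ.base b)) := by
      rw [← hm, φ.pullSec_symm_pullSec]
    have h5 : φ.symm.pullFun f (φ.base b) = f b := congrArg f (φ.base.symm_apply_apply b)
    rw [h2, h3, h1, h.deriv, map_add, map_smul, map_smul, ← h4, h5]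
    congr 2
    exact (hσ' s b f).symm

variable [FiniteDimensional ℝ F] [ContMDiffVectorBundle ∞ F V I]

/-- A derivation with vanishing symbol is tensorial. -/
theorem IsDerivation.congr_of_symbol_eq_zero {D : Sec I F V →ₗ[ℝ] Sec I F V}
    {X : ∀ b : B, TangentSpace I b} (hD : IsDerivation D X) {b : B} (hX : X b = 0)
    {s s' : Sec I F V} (h : s b = s' b) : D s b = D s' b := by
  obtain ⟨e, l, hl⟩ := exists_frame I F V b
  have h1 := hD.eq_sum (hl.mono fun y hy v => (hy v).1)
  rw [h1 s, h1 s', h]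
  exact Finset.sum_congr rfl fun i _ => by rw [hX, dirDeriv_zero, dirDeriv_zero]

end Biderivations

/-! ## Algebra of total spaces -/

section TotalAlgebra

variable {B₁ B₂ : Type*} {F₁ F₂ : Type*} {E₁ : B₁ → Type*} {E₂ : B₂ → Type*}
  [∀ b, AddCommGroup (E₁ b)] [∀ b, Module ℝ (E₁ b)]
  [∀ b, AddCommGroup (E₂ b)] [∀ b, Module ℝ (E₂ b)]

theorem isSum_zero_right (x : TotalSpace F₁ E₁) {b : B₁} (hb : x.proj = b) :
    IsSum x ⟨b, 0⟩ x := by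
  subst hb
  exact ⟨x.proj, x.2, 0, rfl, rfl, by rw [add_zero]⟩

theorem isSum_zero_left (x : TotalSpace F₁ E₁) {b : B₁} (hb : x.proj = b) :
    IsSum ⟨b, 0⟩ x x := by
  subst hb
  exact ⟨x.proj, 0, x.2, rfl, rfl, by rw [zero_add]⟩

theorem IsSum.eq_zero {x y : TotalSpace F₁ E₁} (h : IsSum x y x) : y = ⟨x.proj, 0⟩ := by
  obtain ⟨b, u, v, rfl, rfl, h3⟩ := h
  have h4 : u = u + v := by simpa using h3
  have h5 : v = 0 := by simpa using h4.symm
  rw [h5]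

theorem exists_isSum_right {x z : TotalSpace F₁ E₁} (h : x.proj = z.proj) : ∃ y, IsSum x y z := by
  obtain ⟨b, u⟩ := x
  obtain ⟨b', v⟩ := z
  obtain rfl : b = b' := h
  exact ⟨⟨b, v - u⟩, b, u, v - u, rfl, rfl, by rw [add_sub_cancel]⟩

theorem IsSum.scale {x y z : TotalSpace F₁ E₁} (h : IsSum x y z) (r : ℝ) :
    IsSum (scale r x) (VBDef.scale r y) (VBDef.scale r z) := by
  obtain ⟨b, u, v, rfl, rfl, rfl⟩ := h
  exact ⟨b, r • u, r • v, rfl, rfl, congrArg (TotalSpace.mk b) (smul_add r u v)⟩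

@[simp] theorem scale_zero_vector (r : ℝ) (b : B₁) :
    scale r (⟨b, 0⟩ : TotalSpace F₁ E₁) = ⟨b, 0⟩ :=
  congrArg (TotalSpace.mk b) (smul_zero r)

theorem scale_scale (r s : ℝ) (x : TotalSpace F₁ E₁) : scale r (scale s x) = scale (r * s) x :=
  congrArg (TotalSpace.mk x.proj) (smul_smul r s x.2)

@[simp] theorem scale_one (x : TotalSpace F₁ E₁) : scale 1 x = x :=
  congrArg (TotalSpace.mk x.proj) (one_smul ℝ x.2)

theorem scale_zero_left (x : TotalSpace F₁ E₁) : scale 0 x = ⟨x.proj, 0⟩ :=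
  congrArg (TotalSpace.mk x.proj) (zero_smul ℝ x.2)

theorem IsFiberwiseLinear.map_zero {f : TotalSpace F₁ E₁ → TotalSpace F₂ E₂} {g : B₁ → B₂}
    (h : IsFiberwiseLinear f g) (b : B₁) : f ⟨b, 0⟩ = ⟨g b, 0⟩ := by
  obtain ⟨l, hl⟩ := h.exists_fibre (b := b) rfl
  rw [← hl, _root_.map_zero]

end TotalAlgebra

section TotalSmooth

variable {EB : Type*} [NormedAddCommGroup EB] [NormedSpace ℝ EB]
  {HB : Type*} [TopologicalSpace HB] {I : ModelWithCorners ℝ EB HB}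
  {B : Type*} [TopologicalSpace B] [ChartedSpace HB B]
  {F : Type*} [NormedAddCommGroup F] [NormedSpace ℝ F]
  {V : B → Type*} [TopologicalSpace (TotalSpace F V)]
  [∀ b, AddCommGroup (V b)] [∀ b, Module ℝ (V b)] [∀ b, TopologicalSpace (V b)]
  [FiberBundle F V] [VectorBundle ℝ F V]
  {EB' : Type*} [NormedAddCommGroup EB'] [NormedSpace ℝ EB']
  {HB' : Type*} [TopologicalSpace HB'] {I' : ModelWithCorners ℝ EB' HB'}
  {B' : Type*} [TopologicalSpace B'] [ChartedSpace HB' B']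
  {F' : Type*} [NormedAddCommGroup F'] [NormedSpace ℝ F']
  {V' : B' → Type*} [TopologicalSpace (TotalSpace F' V')]
  [∀ b, AddCommGroup (V' b)] [∀ b, Module ℝ (V' b)] [∀ b, TopologicalSpace (V' b)]
  [FiberBundle F' V'] [VectorBundle ℝ F' V']

theorem FibreLin.map_isSum (L : FibreLin I F V) {x y z : TotalSpace F V} (h : IsSum x y z) :
    L z = L x + L y := by
  obtain ⟨b, u, v, rfl, rfl, rfl⟩ := h
  exact (L.linear b).map_add u v

theorem FibreLin.map_scale (L : FibreLin I F V) (r : ℝ) (x : TotalSpace F V) :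
    L (scale r x) = r * L x := (L.linear x.proj).map_smul r x.2

/-- The composition of a fibrewise linear function with a smooth fibrewise linear map. -/
def FibreLin.comp (L : FibreLin I' F' V') {f : TotalSpace F V → TotalSpace F' V'} {g : B → B'}
    (hf : ContMDiff (I.prod 𝓘(ℝ, F)) (I'.prod 𝓘(ℝ, F')) ∞ f) (hl : IsFiberwiseLinear f g) :
    FibreLin I F V where
  toFun x := L (f x)
  smooth := L.smooth.comp hf
  linear b := by
    obtain ⟨l, h⟩ := hl.exists_fibre (b := b) rfl
    simp only [← h]
    exact ((L.at (g b)).comp l).isLinear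

@[simp] theorem FibreLin.comp_apply (L : FibreLin I' F' V') {f : TotalSpace F V → TotalSpace F' V'}
    {g : B → B'} (hf : ContMDiff (I.prod 𝓘(ℝ, F)) (I'.prod 𝓘(ℝ, F')) ∞ f)
    (hl : IsFiberwiseLinear f g) (x : TotalSpace F V) : L.comp hf hl x = L (f x) := rfl

variable [FiniteDimensional ℝ EB] [IsManifold I ∞ B] [T2Space B] [FiniteDimensional ℝ F]
  [ContMDiffVectorBundle ∞ F V I]

variable (I) in
theorem total_ext {x y : TotalSpace F V} (h : x.proj = y.proj)
    (hL : ∀ L : FibreLin I F V, L x = L y) : x = y := by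
  obtain ⟨b, u⟩ := x
  obtain ⟨b', v⟩ := y
  obtain rfl : b = b' := h
  rw [fibreLin_ext I hL]

variable (I F V) in
theorem contMDiff_scale_prod : ContMDiff (𝓘(ℝ, ℝ).prod (I.prod 𝓘(ℝ, F))) (I.prod 𝓘(ℝ, F)) ∞
    fun p : ℝ × TotalSpace F V => scale p.1 p.2 := by
  rw [contMDiff_totalSpace_iff]
  refine ⟨ContMDiff.comp (f := fun p : ℝ × TotalSpace F V => p.2) (Bundle.contMDiff_proj V) contMDiff_snd,
    fun L => ?_⟩
  exact (contMDiff_fst.mul (L.smooth.comp contMDiff_snd)).congr fun p => L.map_scale _ _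

/-- The vector which is the derivative at `0` of a curve in a vector bundle that starts at a zero
vector. -/
theorem exists_vertical_deriv {u : ℝ → TotalSpace F V}
    (hu : ContMDiff 𝓘(ℝ, ℝ) (I.prod 𝓘(ℝ, F)) ∞ u) {b : B} (hb : u 0 = ⟨b, 0⟩) :
    ∃ x : V b, ∀ L : FibreLin I F V, L ⟨b, x⟩ = deriv (fun r => L (u r)) 0 := by
  obtain ⟨e, l, hl⟩ := exists_frame I F V b
  have hd : ∀ L : FibreLin I F V, HasDerivAt (fun r => L (u r)) (deriv (fun r => L (u r)) 0) 0 :=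
    fun L => ((contMDiff_iff_contDiff.1 (L.smooth.comp hu)).differentiable (by simp) 0).hasDerivAt
  have hp : ContMDiff 𝓘(ℝ, ℝ) I ∞ fun r => (u r).proj := (Bundle.contMDiff_proj V).comp hu
  have hp0 : (u 0).proj = b := by rw [hb]
  refine ⟨∑ i, deriv (fun r => l i (u r)) 0 • e i b, fun L => ?_⟩
  have h1 : (fun r => L (u r)) =ᶠ[𝓝 0]
      fun r => ∑ i, l i (u r) * L.compSec (e i) (u r).proj := by
    have hev := (hp.continuous.continuousAt (x := 0)).eventually (hp0 ▸ hl)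
    filter_upwards [hev] with r hr
    have h2 := congrArg (L.at (u r).proj) (hr (u r).2).1
    rw [map_sum] at h2
    simp only [map_smul, smul_eq_mul, FibreLin.at_apply] at h2
    exact h2
  have h3 : ∀ i, HasDerivAt (fun r => l i (u r) * L.compSec (e i) (u r).proj)
      (deriv (fun r => l i (u r)) 0 * L ⟨b, e i b⟩) 0 := fun i => by
    have h4 : DifferentiableAt ℝ (fun r => L.compSec (e i) (u r).proj) 0 :=
      (contMDiff_iff_contDiff.1 ((L.compSec (e i)).contMDiff.comp hp)).differentiable (by simp) 0
    have h5 := (hd (l i)).fun_mul h4.hasDerivAt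
    -- As the curve starts at a zero vector, the product-rule term from the moving base point
    -- vanishes, so the derivative lies in the fibre.
    have h6 : l i (u 0) = 0 := by
      rw [hb]
      exact ((l i).at b).map_zero
    rw [h6, zero_mul, add_zero, hp0] at h5
    exact h5
  have h7 := ((HasDerivAt.fun_sum fun i (_ : i ∈ Finset.univ) => h3 i).congr_of_eventuallyEq h1).deriv
  rw [h7]
  change L.at b _ = _
  simp only [map_sum, map_smul, smul_eq_mul, FibreLin.at_apply]

end TotalSmooth

/-! ## Linear and core sections of a double vector bundle -/

section DVB

variable {EM : Type*} [NormedAddCommGroup EM] [NormedSpace ℝ EM] [FiniteDimensional ℝ EM]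
  {M : Type*} [TopologicalSpace M] [ChartedSpace EM M] [IsManifold 𝓘(ℝ, EM) ∞ M] [T2Space M]
  {FE : Type*} [NormedAddCommGroup FE] [NormedSpace ℝ FE] [FiniteDimensional ℝ FE]
  {E : M → Type*} [TopologicalSpace (TotalSpace FE E)]
  [∀ x, AddCommGroup (E x)] [∀ x, Module ℝ (E x)] [∀ x, TopologicalSpace (E x)]
  [FiberBundle FE E] [VectorBundle ℝ FE E] [ContMDiffVectorBundle ∞ FE E 𝓘(ℝ, EM)]
  {FA : Type*} [NormedAddCommGroup FA] [NormedSpace ℝ FA] [FiniteDimensional ℝ FA]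
  {A : M → Type*} [TopologicalSpace (TotalSpace FA A)]
  [∀ x, AddCommGroup (A x)] [∀ x, Module ℝ (A x)] [∀ x, TopologicalSpace (A x)]
  [FiberBundle FA A] [VectorBundle ℝ FA A] [ContMDiffVectorBundle ∞ FA A 𝓘(ℝ, EM)]
  {FV : Type*} [NormedAddCommGroup FV] [NormedSpace ℝ FV] [FiniteDimensional ℝ FV]
  {V : TotalSpace FE E → Type*} [TopologicalSpace (TotalSpace FV V)]
  [∀ e, AddCommGroup (V e)] [∀ e, Module ℝ (V e)] [∀ e, TopologicalSpace (V e)]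
  [FiberBundle FV V] [VectorBundle ℝ FV V]
  [ContMDiffVectorBundle ∞ FV V (𝓘(ℝ, EM).prod 𝓘(ℝ, FE))]
  {FU : Type*} [NormedAddCommGroup FU] [NormedSpace ℝ FU] [FiniteDimensional ℝ FU]
  {U : TotalSpace FA A → Type*} [TopologicalSpace (TotalSpace FU U)]
  [∀ a, AddCommGroup (U a)] [∀ a, Module ℝ (U a)] [∀ a, TopologicalSpace (U a)]
  [FiberBundle FU U] [VectorBundle ℝ FU U]
  [ContMDiffVectorBundle ∞ FU U (𝓘(ℝ, EM).prod 𝓘(ℝ, FA))]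
  (D : DoubleVectorBundle EM FE E FA A FV V FU U)

namespace DoubleVectorBundle

theorem toA_proj_proj (w : TotalSpace FV V) : (D.toA w).proj.proj = w.proj.proj :=
  D.proj_linear.proj w

theorem toA_zero_zero (m : M) :
    D.toA (⟨⟨m, 0⟩, 0⟩ : TotalSpace FV V) = ⟨⟨m, 0⟩, 0⟩ := by
  have h := D.zero_linear.map_zero m
  rw [← D.toA.apply_symm_apply (⟨⟨m, 0⟩, 0⟩ : TotalSpace FU U)]
  exact congrArg D.toA h.symm

theorem toA_zero_proj (e : TotalSpace FE E) :
    (D.toA (⟨e, 0⟩ : TotalSpace FV V)).proj = ⟨e.proj, 0⟩ :=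
  D.proj_linear.map_zero e

theorem hom_apply (r : ℝ) (hr : r ≠ 0) (w : TotalSpace FV V) :
    (D.hom r hr).total w = D.toA.symm (scale r (D.toA w)) := rfl

theorem toA_hom (r : ℝ) (hr : r ≠ 0) (w : TotalSpace FV V) :
    D.toA ((D.hom r hr).total w) = scale r (D.toA w) := by
  rw [hom_apply, D.toA.apply_symm_apply]

/-- The projection `W → E` is a vector bundle map from `W → A` to `E → M`. -/
theorem projE_linear : IsFiberwiseLinear (fun u : TotalSpace FU U => (D.toA.symm u).proj)
    (fun a : TotalSpace FA A => a.proj) where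
  proj u := by
    have h := D.toA_proj_proj (D.toA.symm u)
    rw [D.toA.apply_symm_apply] at h
    exact h.symm
  add x y z h := by
    refine D.add_proj _ _ _ ?_
    simpa only [D.toA.apply_symm_apply] using h
  smul r u := by
    have h := (D.smul_linear r).proj (D.toA.symm u)
    rwa [D.toA.apply_symm_apply] at h

/-- On the core, the two additions agree. -/
theorem isSumA_of_core {w w' w'' : TotalSpace FV V} {m : M} (hw : w.proj = ⟨m, 0⟩)
    (hwA : (D.toA w).proj = ⟨m, 0⟩) (hw' : w'.proj = ⟨m, 0⟩) (hwA' : (D.toA w').proj = ⟨m, 0⟩)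
    (h : IsSum w w' w'') : D.IsSumA w w' w'' := by
  -- Eckmann–Hilton: the interchange law applied to the summands w = w +_A 0 and w' = 0 +_A w'.
  refine D.add_add w ⟨⟨m, 0⟩, 0⟩ w ⟨⟨m, 0⟩, 0⟩ w' w' w w' w'' ?_ ?_
    (isSum_zero_right w hw) (isSum_zero_left w' hw') h
  · rw [D.toA_zero_zero]
    exact isSum_zero_right _ hwA
  · rw [D.toA_zero_zero]
    exact isSum_zero_left _ hwA'

/-- On the core, the two scalar multiplications agree. -/
theorem toA_scale_core {w : TotalSpace FV V} {m : M} (hw : w.proj = ⟨m, 0⟩)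
    (hwA : (D.toA w).proj = ⟨m, 0⟩) (r : ℝ) : D.toA (scale r w) = scale r (D.toA w) := by
  have hp : ∀ r, (D.toA (scale r w)).proj = ⟨m, 0⟩ := fun r => by
    have h := D.proj_linear.smul r w
    rw [hwA] at h
    exact h.trans (scale_zero_vector r m)
  refine total_ext (𝓘(ℝ, EM).prod 𝓘(ℝ, FA)) ((hp r).trans hwA.symm) fun L => ?_
  -- Since the two additions agree on the core, r ↦ L(r w) is additive; it is also continuous, hence
  -- real linear.
  let f : ℝ →+ ℝ := AddMonoidHom.mk' (fun r => L (D.toA (scale r w))) fun r s => by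
    refine L.map_isSum (D.isSumA_of_core (m := m) hw (hp r) hw (hp s) ?_)
    exact ⟨w.proj, r • w.2, s • w.2, rfl, rfl, congrArg (TotalSpace.mk w.proj) (_root_.add_smul r s w.2)⟩
  have hf : Continuous f := L.smooth.continuous.comp (D.toA.continuous.comp
    (contMDiff_scale_left (𝓘(ℝ, EM).prod 𝓘(ℝ, FE)) w).continuous)
  have h1 := map_real_smul f hf r 1
  rw [smul_eq_mul, smul_eq_mul, mul_one] at h1
  have h2 : f 1 = L (D.toA w) := congrArg (fun x => L (D.toA x)) (scale_one w)
  rw [h2] at h1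
  exact h1.trans (L.map_scale r _).symm

variable {D}

/-- Linear sections have weight zero: commuting with the multiplications in E → M and W → A is being
fixed by the homotheties. -/
theorem IsLinearSection.hom_pullSec {s : D.Γ} (hs : D.IsLinearSection s) (r : ℝ) (hr : r ≠ 0) :
    (D.hom r hr).pullSec s = s := by
  obtain ⟨α, hα⟩ := hs
  refine sec_ext_total fun e => ?_
  rw [VBAut.mk_pullSec]
  refine (D.hom r hr).total.toEquiv.symm_apply_eq.2 ?_
  refine D.toA.injective ?_
  exact (hα.smul r e).trans (D.toA_hom r hr _).symm

/-- Core sections have weight −1. On the core the scalings of W → E and W → A agree, so multiplying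
the core part by r⁻¹ over E is undone by h_r, which sends the summand 0_e to 0_{re}. -/
theorem IsCoreSection.hom_pullSec {s : D.Γ} (hs : D.IsCoreSection s) (r : ℝ) (hr : r ≠ 0) :
    (D.hom r hr).pullSec s = r⁻¹ • s := by
  obtain ⟨χ, -, hχE, hχA, hsum⟩ := hs
  refine sec_ext_total fun e => ?_
  rw [VBAut.mk_pullSec]
  refine (D.hom r hr).total.toEquiv.symm_apply_eq.2 ?_
  refine D.toA.injective ?_
  have h1 := D.add_smul r⁻¹ _ _ _ (hsum e)
  rw [D.toA_scale_core (hχE e.proj) (hχA e.proj)] at h1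
  have h2 := h1.scale r
  rw [scale_scale, mul_inv_cancel₀ hr, scale_one] at h2
  have h3 : scale r (D.toA (scale r⁻¹ (zeroSection FV V e))) =
      D.toA (zeroSection FV V (scale r e)) := by
    have h4 := (D.smul_linear r).map_zero e
    have h5 : scale r⁻¹ (zeroSection FV V e) = ⟨e, 0⟩ := scale_zero_vector _ _
    rw [h5]
    exact (D.toA.toEquiv.symm_apply_eq.1 h4)
  rw [h3] at h2
  have h6 := hsum (scale r e)
  have h7 := h6.unique h2
  refine h7.trans (D.toA_hom r hr _).symm

variable (D) in
/-- The core section determined by the values of a section on the zero section of `E → M`. -/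
theorem exists_coreSection (t : D.Γ) : ∃ κ : D.Γ, D.IsCoreSection κ ∧ ∀ m : M,
    (⟨⟨m, 0⟩, (t - κ) ⟨m, 0⟩⟩ : TotalSpace FV V) =
      D.toA.symm (zeroSection FU U (D.toA ⟨⟨m, 0⟩, t ⟨m, 0⟩⟩).proj) := by
  have h1 := fun m : M => D.zero_linear.exists_fibre (b := m) (c := ⟨m, 0⟩) rfl
  have h2 := fun m : M => D.proj_linear.exists_fibre (b := (⟨m, 0⟩ : TotalSpace FE E)) (c := m) rfl
  choose l hl using h1
  choose p hp using h2
  have hpl : ∀ m a, p m (l m a) = a := fun m a => by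
    have h3 := hp m (l m a)
    rw [hl, D.toA.apply_symm_apply] at h3
    simpa [zeroSection] using h3
  have h0 : ContMDiff 𝓘(ℝ, EM) (𝓘(ℝ, EM).prod 𝓘(ℝ, FE)) ∞ (fun m : M => (⟨m, 0⟩ : TotalSpace FE E)) :=
    Bundle.contMDiff_zeroSection ℝ E
  have ht0 : ContMDiff 𝓘(ℝ, EM) ((𝓘(ℝ, EM).prod 𝓘(ℝ, FE)).prod 𝓘(ℝ, FV)) ∞
      (fun m : M => (⟨⟨m, 0⟩, t ⟨m, 0⟩⟩ : TotalSpace FV V)) := t.contMDiff.comp h0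
  have hlp : ∀ m, (⟨⟨m, 0⟩, l m (p m (t ⟨m, 0⟩))⟩ : TotalSpace FV V) =
      D.toA.symm (zeroSection FU U (D.toA ⟨⟨m, 0⟩, t ⟨m, 0⟩⟩).proj) := fun m => by
    rw [hl, hp]
  -- Over the zero vector of E_m, the value of t splits into the zero vector of W → A over its
  -- A-projection, which is `l m (p m _)`, and a remainder χ m lying in the core.
  let χ : M → TotalSpace FV V := fun m => ⟨⟨m, 0⟩, t ⟨m, 0⟩ - l m (p m (t ⟨m, 0⟩))⟩
  have hχ : ContMDiff 𝓘(ℝ, EM) ((𝓘(ℝ, EM).prod 𝓘(ℝ, FE)).prod 𝓘(ℝ, FV)) ∞ χ := by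
    rw [contMDiff_totalSpace_iff]
    refine ⟨h0, fun L => ?_⟩
    have h3 : ContMDiff 𝓘(ℝ, EM) 𝓘(ℝ, ℝ) ∞ (fun m => L ⟨⟨m, 0⟩, t ⟨m, 0⟩⟩ -
        L (D.toA.symm (zeroSection FU U (D.toA ⟨⟨m, 0⟩, t ⟨m, 0⟩⟩).proj))) := by
      refine (L.smooth.comp ht0).sub (L.smooth.comp (D.toA.symm.contMDiff.comp ?_))
      exact (Bundle.contMDiff_zeroSection ℝ U).comp
        ((Bundle.contMDiff_proj U).comp (D.toA.contMDiff.comp ht0))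
    refine h3.congr fun m => ?_
    rw [← hlp]
    exact (L.linear _).map_sub _ _
  have hχA : ∀ m, (D.toA (χ m)).proj = ⟨m, 0⟩ := fun m => by
    refine (hp m _).symm.trans ?_
    rw [map_sub, hpl, sub_self]
  have hex : ∀ e : TotalSpace FE E, ∃ z, IsSum (D.toA (⟨e, 0⟩ : TotalSpace FV V))
      (D.toA (χ e.proj)) z := fun e =>
    exists_isSum ((D.toA_zero_proj e).trans (hχA e.proj).symm)
  choose z hz using hex
  have hzp : ∀ e, (D.toA.symm (z e)).proj = e := fun e => by
    have h3 := D.projE_linear.add _ _ _ (hz e)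
    rw [D.toA.symm_apply_apply, D.toA.symm_apply_apply] at h3
    exact h3.unique (isSum_zero_right e rfl)
  have hzs : ContMDiff (𝓘(ℝ, EM).prod 𝓘(ℝ, FE)) ((𝓘(ℝ, EM).prod 𝓘(ℝ, FA)).prod 𝓘(ℝ, FU)) ∞ z := by
    rw [contMDiff_totalSpace_iff]
    constructor
    · have h3 : ContMDiff (𝓘(ℝ, EM).prod 𝓘(ℝ, FE)) (𝓘(ℝ, EM).prod 𝓘(ℝ, FA)) ∞
          (fun e : TotalSpace FE E => (D.toA (⟨e, 0⟩ : TotalSpace FV V)).proj) :=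
        (Bundle.contMDiff_proj U).comp
          (D.toA.contMDiff.comp (Bundle.contMDiff_zeroSection ℝ V))
      exact h3.congr fun e => (hz e).proj_eq.1.symm
    · intro L
      have h3 : ContMDiff (𝓘(ℝ, EM).prod 𝓘(ℝ, FE)) 𝓘(ℝ, ℝ) ∞ (fun e : TotalSpace FE E =>
          L (D.toA (⟨e, 0⟩ : TotalSpace FV V)) + L (D.toA (χ e.proj))) :=
        (L.smooth.comp (D.toA.contMDiff.comp (Bundle.contMDiff_zeroSection ℝ V))).add
          (L.smooth.comp (D.toA.contMDiff.comp (hχ.comp (Bundle.contMDiff_proj E))))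
      exact h3.congr fun e => L.map_isSum (hz e)
  let κ : D.Γ := secOfMap (fun e => D.toA.symm (z e)) hzp (D.toA.symm.contMDiff.comp hzs)
  have hκ : ∀ e, (⟨e, κ e⟩ : TotalSpace FV V) = D.toA.symm (z e) := mk_secOfMap _ hzp _
  refine ⟨κ, ⟨χ, hχ, fun m => rfl, hχA, fun e => ?_⟩, fun m => ?_⟩
  · change IsSum _ _ _
    rw [hκ, D.toA.apply_symm_apply]
    exact hz e
  · have h3 := hz ⟨m, 0⟩
    rw [D.toA_zero_zero] at h3
    have h4 : z ⟨m, 0⟩ = D.toA (χ m) := h3.unique (isSum_zero_left _ (hχA m))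
    have h5 := hκ ⟨m, 0⟩
    rw [h4, D.toA.symm_apply_apply] at h5
    have h6 : κ ⟨m, 0⟩ = t ⟨m, 0⟩ - l m (p m (t ⟨m, 0⟩)) := by simpa [χ] using h5
    rw [← hlp]
    refine congrArg (TotalSpace.mk _) ?_
    change t ⟨m, 0⟩ - κ ⟨m, 0⟩ = _
    rw [h6, sub_sub_cancel]

variable (D) in
/-- The linearization of a section. -/
theorem exists_linearSection (t : D.Γ) : ∃ s : D.Γ, D.IsLinearSection s ∧ ∀ e : TotalSpace FE E,
    (D.toA ⟨e, s e⟩).proj = (D.toA ⟨⟨e.proj, 0⟩, t ⟨e.proj, 0⟩⟩).proj := by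
  -- After subtraction of its core part the section sends zero vectors of E to zero vectors of W →
  -- A, and so has a fibrewise derivative along the zero section.
  obtain ⟨κ, -, hκ⟩ := D.exists_coreSection t
  let a : M → TotalSpace FA A := fun m => (D.toA ⟨⟨m, 0⟩, t ⟨m, 0⟩⟩).proj
  have ha : ContMDiff 𝓘(ℝ, EM) (𝓘(ℝ, EM).prod 𝓘(ℝ, FA)) ∞ a :=
    (Bundle.contMDiff_proj U).comp
      (D.toA.contMDiff.comp (t.contMDiff.comp (Bundle.contMDiff_zeroSection ℝ E)))
  have hap : ∀ m, (a m).proj = m := fun m => D.toA_proj_proj _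
  let u : TotalSpace FE E → TotalSpace FU U := fun e => D.toA ⟨e, (t - κ) e⟩
  have hu : ContMDiff (𝓘(ℝ, EM).prod 𝓘(ℝ, FE)) ((𝓘(ℝ, EM).prod 𝓘(ℝ, FA)).prod 𝓘(ℝ, FU)) ∞ u :=
    D.toA.contMDiff.comp (t - κ).contMDiff
  have hu0 : ∀ m, u ⟨m, 0⟩ = ⟨a m, 0⟩ := fun m =>
    (congrArg D.toA (hκ m)).trans (D.toA.apply_symm_apply _)
  have hus : ContMDiff (𝓘(ℝ, ℝ).prod (𝓘(ℝ, EM).prod 𝓘(ℝ, FE)))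
      ((𝓘(ℝ, EM).prod 𝓘(ℝ, FA)).prod 𝓘(ℝ, FU)) ∞
      (fun p : ℝ × TotalSpace FE E => u (scale p.1 p.2)) :=
    hu.comp (contMDiff_scale_prod 𝓘(ℝ, EM) FE E)
  have hex := fun e : TotalSpace FE E => exists_vertical_deriv (u := fun r => u (scale r e))
    (hus.comp (contMDiff_id.prodMk contMDiff_const)) (b := a e.proj)
    (by rw [scale_zero_left]; exact hu0 e.proj)
  choose x' hx' using hex
  -- The linearization is the derivative of u(r e) at r = 0, taken in the fibre of W → A; it is
  -- homogeneous of degree one in e and therefore fibrewise linear.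
  let x : TotalSpace FE E → TotalSpace FU U := fun e => ⟨a e.proj, x' e⟩
  have hx : ∀ (e) (L : FibreLin (𝓘(ℝ, EM).prod 𝓘(ℝ, FA)) FU U),
      L (x e) = deriv (fun r => L (u (scale r e))) 0 := hx'
  have hxs : ContMDiff (𝓘(ℝ, EM).prod 𝓘(ℝ, FE)) ((𝓘(ℝ, EM).prod 𝓘(ℝ, FA)).prod 𝓘(ℝ, FU)) ∞ x := by
    rw [contMDiff_totalSpace_iff]
    refine ⟨ha.comp (Bundle.contMDiff_proj E), fun L => ?_⟩
    have h1 := (contMDiff_deriv_fst (f := fun r e => L (u (scale r e))) (L.smooth.comp hus)).comp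
      ((contMDiff_const (c := (0 : ℝ))).prodMk
        (contMDiff_id (I := 𝓘(ℝ, EM).prod 𝓘(ℝ, FE)) (M := TotalSpace FE E)))
    exact h1.congr fun e => hx e L
  have hxh : ∀ r : ℝ, 0 < r → ∀ e, x (scale r e) = scale r (x e) := fun r _ e => by
    refine total_ext (𝓘(ℝ, EM).prod 𝓘(ℝ, FA)) rfl fun L => ?_
    rw [hx, L.map_scale, hx]
    simp only [scale_scale]
    have h1 := deriv_comp_mul_left r (fun ρ => L (u (scale ρ e))) 0
    rw [mul_zero, smul_eq_mul] at h1
    simpa only [mul_comm] using h1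
  have hxl : IsFiberwiseLinear x a := by
    have h1 := isFiberwiseLinear_of_homogeneous hxs hxh
    exact h1
  -- The projection to E is linear on the fibres of W → A, so it commutes with this derivative, and
  -- u(r e) lies over r e.
  have hxp : ∀ e, (D.toA.symm (x e)).proj = e := fun e => by
    have hq : ContMDiff ((𝓘(ℝ, EM).prod 𝓘(ℝ, FA)).prod 𝓘(ℝ, FU)) (𝓘(ℝ, EM).prod 𝓘(ℝ, FE)) ∞
        (fun v : TotalSpace FU U => (D.toA.symm v).proj) :=
      (Bundle.contMDiff_proj V).comp D.toA.symm.contMDiff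
    refine total_ext 𝓘(ℝ, EM) ?_ fun L => ?_
    · exact (D.projE_linear.proj (x e)).trans (hap e.proj)
    · have h1 := hx e (L.comp hq D.projE_linear)
      simp only [FibreLin.comp_apply] at h1
      rw [h1]
      have h2 : (fun r => L (D.toA.symm (u (scale r e))).proj) = fun r => r * L e := by
        funext r
        have h3 : (D.toA.symm (u (scale r e))).proj = scale r e :=
          congrArg TotalSpace.proj (D.toA.symm_apply_apply ⟨scale r e, (t - κ) (scale r e)⟩)
        rw [h3, L.map_scale]
      rw [h2]
      simp
  let s : D.Γ := secOfMap (fun e => D.toA.symm (x e)) hxp (D.toA.symm.contMDiff.comp hxs)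
  have hs : ∀ e, D.toA ⟨e, s e⟩ = x e := fun e =>
    (congrArg D.toA (mk_secOfMap _ hxp _ e)).trans (D.toA.apply_symm_apply _)
  refine ⟨s, ⟨secOfMap a hap ha, ?_⟩, fun e => ?_⟩
  swap
  · have h1 := congrArg TotalSpace.proj (hs e)
    exact h1
  have h1 : (fun e : TotalSpace FE E => D.toA ⟨e, s e⟩) = x := funext hs
  have h2 : (fun m : M => (⟨m, secOfMap a hap ha m⟩ : TotalSpace FA A)) = a :=
    funext (mk_secOfMap a hap ha)
  rw [h1, h2]
  exact hxl

variable (D) in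
/-- The linear and the core sections span the fibres of `W → E`. -/
theorem exists_linear_add_core {e : TotalSpace FE E} (v : V e) : ∃ s κ : D.Γ,
    D.IsLinearSection s ∧ D.IsCoreSection κ ∧ v = (s + κ) e := by
  obtain ⟨p, hp⟩ := D.proj_linear.exists_fibre (b := e) (c := e.proj) rfl
  obtain ⟨l, hl⟩ := D.zero_linear.exists_fibre (b := e.proj) (c := ⟨e.proj, 0⟩) rfl
  -- A section through the zero vector of W → A over p v linearizes to a section whose value at e
  -- has the same A-projection as v.
  obtain ⟨t, ht⟩ := exists_sec_eq (𝓘(ℝ, EM).prod 𝓘(ℝ, FE)) FV (l (p v))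
  obtain ⟨s, hs, hsp⟩ := D.exists_linearSection t
  have h1 : p (s e) = p v := by
    have h2 := hp (s e)
    rw [hsp e, ht, hl, D.toA.apply_symm_apply] at h2
    simpa [zeroSection] using h2
  have h3 : (D.toA (⟨e, v - s e⟩ : TotalSpace FV V)).proj = ⟨e.proj, 0⟩ := by
    refine (hp _).symm.trans ?_
    rw [map_sub, h1, sub_self]
  -- The difference v − s(e) projects to zero in A, so it equals 0_e +_A y; projecting to E shows
  -- that y is a core vector, to be extended to a core section.
  obtain ⟨y, hy⟩ := exists_isSum_right ((D.toA_zero_proj e).trans h3.symm)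
  have h4 : (D.toA.symm y).proj = ⟨e.proj, 0⟩ := by
    have h5 := D.projE_linear.add _ _ _ hy
    rw [D.toA.symm_apply_apply, D.toA.symm_apply_apply] at h5
    exact h5.eq_zero
  have hyp : y.proj = ⟨e.proj, 0⟩ := hy.proj_eq.2.trans h3
  rcases hc : D.toA.symm y with ⟨e', c⟩
  rw [hc] at h4
  obtain rfl : e' = ⟨e.proj, 0⟩ := h4
  have hcy : D.toA ⟨⟨e.proj, 0⟩, c⟩ = y := by rw [← hc, D.toA.apply_symm_apply]
  obtain ⟨t', ht'⟩ := exists_sec_eq (𝓘(ℝ, EM).prod 𝓘(ℝ, FE)) FV c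
  obtain ⟨κ, hκ, hκt⟩ := D.exists_coreSection t'
  have h6 : κ ⟨e.proj, 0⟩ = c := by
    have h7 := hκt e.proj
    rw [ht', hcy, hyp] at h7
    have h8 := h7.trans (D.zero_linear.map_zero e.proj)
    have h9 : t' ⟨e.proj, 0⟩ - κ ⟨e.proj, 0⟩ = 0 := TotalSpace.mk_injective _ h8
    rw [← ht']
    exact (sub_eq_zero.1 h9).symm
  refine ⟨s, κ, hs, hκ, ?_⟩
  obtain ⟨χ, -, -, hχA, hχ⟩ := hκ
  have h10 : D.toA (χ e.proj) = y := by
    have h11 := hχ ⟨e.proj, 0⟩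
    have h12 : IsSum (D.toA ⟨⟨e.proj, 0⟩, 0⟩) (D.toA (χ e.proj)) (D.toA ⟨⟨e.proj, 0⟩, κ ⟨e.proj, 0⟩⟩) := h11
    rw [D.toA_zero_zero, h6, hcy] at h12
    exact (isSum_zero_left _ (hχA e.proj)).unique h12
  have h13 : IsSum (D.toA ⟨e, 0⟩) (D.toA (χ e.proj)) (D.toA ⟨e, κ e⟩) := hχ e
  rw [h10] at h13
  have h14 := D.toA.injective (hy.unique h13)
  have h15 : v - s e = κ e := by simpa using h14
  change v = s e + κ e
  rw [← h15, add_sub_cancel]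

end DoubleVectorBundle

end DVB

/-! ## Brackets of Lie algebroids on smooth families of sections -/

theorem gerst_one_one {G : Type*} [AddCommGroup G] (b c : (Fin 2 → G) → G) (s : Fin 3 → G) :
    gerst (k := 1) (l := 1) b c s =
      -gerstProd (k := 1) (l := 2) b c s - gerstProd (k := 1) (l := 2) c b s := by
  unfold gerst
  rw [mul_one, pow_one, neg_smul, one_smul]
  rfl

section Chain

variable {E₁ : Type*} [NormedAddCommGroup E₁] [NormedSpace ℝ E₁]
  {H₁ : Type*} [TopologicalSpace H₁] {J₁ : ModelWithCorners ℝ E₁ H₁}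
  {N₁ : Type*} [TopologicalSpace N₁] [ChartedSpace H₁ N₁]
  {E₂ : Type*} [NormedAddCommGroup E₂] [NormedSpace ℝ E₂]
  {H₂ : Type*} [TopologicalSpace H₂] {J₂ : ModelWithCorners ℝ E₂ H₂}
  {N₂ : Type*} [TopologicalSpace N₂] [ChartedSpace H₂ N₂]

theorem dirDeriv_mfderiv {g : N₁ → N₂} {f : N₂ → ℝ} {x : N₁}
    (hf : MDifferentiableAt J₂ 𝓘(ℝ, ℝ) f (g x)) (hg : MDifferentiableAt J₁ J₂ g x)
    (X : TangentSpace J₁ x) :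
    dirDeriv (mfderiv J₁ J₂ g x X) f = dirDeriv X fun y => f (g y) := by
  have h := (HasMFDerivAt.comp x (g := f) (f := g) hf.hasMFDerivAt hg.hasMFDerivAt).mfderiv
  exact (DFunLike.congr_fun h X).symm

end Chain

/-- A curve in a fibre of a vector bundle that is weakly differentiable is differentiable. -/
theorem FibDeriv.tendsto_slope {B : Type*} [TopologicalSpace B] (F : Type*)
    [NormedAddCommGroup F] [NormedSpace ℝ F] [FiniteDimensional ℝ F] {V : B → Type*}
    [TopologicalSpace (TotalSpace F V)] [∀ b, AddCommGroup (V b)] [∀ b, Module ℝ (V b)]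
    [∀ b, TopologicalSpace (V b)] [FiberBundle F V] [VectorBundle ℝ F V] {b : B} {u : ℝ → V b} {v : V b} {t : ℝ} (h : FibDeriv u v t) :
    Tendsto (fun τ => (τ - t)⁻¹ • (u τ - u t)) (𝓝[≠] t) (𝓝 v) := by
  let A := (trivializationAt F V b).continuousLinearEquivAt ℝ b
    (FiberBundle.mem_baseSet_trivializationAt F V b)
  let β := Module.finBasis ℝ F
  have h1 : HasDerivAt (fun τ => A (u τ)) (A v) t := by
    have h2 : ∀ w : V b, A w = ∑ i, β.repr (A w) i • β i := fun w => (β.sum_repr _).symm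
    have h3 : HasDerivAt (fun τ => ∑ i, β.repr (A (u τ)) i • β i) (∑ i, β.repr (A v) i • β i) t :=
      HasDerivAt.fun_sum fun i _ =>
        (h ((β.coord i).comp (A.toLinearEquiv : V b →ₗ[ℝ] F))).smul_const (β i)
    rw [← h2 v] at h3
    exact h3.congr_of_eventuallyEq (Eventually.of_forall fun τ => h2 (u τ))
  rw [hasDerivAt_iff_tendsto_slope] at h1
  have h4 := (A.symm.continuous.tendsto (A v)).comp h1
  rw [A.symm_apply_apply] at h4
  refine h4.congr fun τ => ?_
  rw [Function.comp_apply, slope_def_module, map_smul, map_sub, A.symm_apply_apply,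
    A.symm_apply_apply]

section Brackets

variable {EB : Type*} [NormedAddCommGroup EB] [NormedSpace ℝ EB] [FiniteDimensional ℝ EB]
  {HB : Type*} [TopologicalSpace HB] {I : ModelWithCorners ℝ EB HB}
  {B : Type*} [TopologicalSpace B] [ChartedSpace HB B] [IsManifold I ∞ B] [T2Space B]
  {F : Type*} [NormedAddCommGroup F] [NormedSpace ℝ F] [FiniteDimensional ℝ F]
  {V : B → Type*} [TopologicalSpace (TotalSpace F V)]
  [∀ b, AddCommGroup (V b)] [∀ b, Module ℝ (V b)] [∀ b, TopologicalSpace (V b)]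
  [FiberBundle F V] [VectorBundle ℝ F V] [ContMDiffVectorBundle ∞ F V I]
  {EQ : Type*} [NormedAddCommGroup EQ] [NormedSpace ℝ EQ]
  {HQ : Type*} [TopologicalSpace HQ] {JQ : ModelWithCorners ℝ EQ HQ}
  {Q : Type*} [TopologicalSpace Q] [ChartedSpace HQ Q] [IsManifold JQ ∞ Q]

/-- The bracket is a derivation in each slot, so the slots are made to vary one after the other,
with skew-symmetry exchanging them; the symbols vary smoothly because the anchor is a bundle map. -/
theorem LieAlgebroid.smoothFam_bracket (L : LieAlgebroid I F V) {s t : Q → Sec I F V}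
    (hs : SmoothFam JQ s) (ht : SmoothFam JQ t) : SmoothFam JQ fun q => L.bracket (s q) (t q) := by
  have h1 : ∀ {s : Q → Sec I F V}, SmoothFam JQ s → ContMDiff (JQ.prod I) I.tangent ∞
      fun p : Q × B => (⟨p.2, L.anchor p.2 (s p.1 p.2)⟩ : TangentBundle I B) := fun hs =>
    L.contMDiff_anchor.comp hs
  refine SmoothFam.derivation (fun q => L.isBider.deriv (s q)) (fun u => ?_) (h1 hs) ht
  have h2 : SmoothFam JQ fun q => L.bracket u (s q) :=
    SmoothFam.derivation (fun q => L.isBider.deriv u) (fun v => smoothFam_const _)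
      (h1 (smoothFam_const u)) hs
  simpa only [← L.bracket_swap] using h2.neg

theorem LieAlgebroid.fibDeriv_bracket [I.Boundaryless] (L : LieAlgebroid I F V)
    {s u : ℝ → Sec I F V} (hs : SmoothFam 𝓘(ℝ, ℝ) s) (hu : SmoothFam 𝓘(ℝ, ℝ) u)
    {s' u' : Sec I F V} {t : ℝ} (hs' : ∀ b, FibDeriv (fun τ => s τ b) (s' b) t)
    (hu' : ∀ b, FibDeriv (fun τ => u τ b) (u' b) t) (b : B) :
    FibDeriv (fun τ => L.bracket (s τ) (u τ) b) (L.bracket s' (u t) b + L.bracket (s t) u' b) t := by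
  have h1 : SmoothFam (𝓘(ℝ, ℝ).prod 𝓘(ℝ, ℝ)) fun p : ℝ × ℝ => s p.1 :=
    hs.comp (JR := 𝓘(ℝ, ℝ).prod 𝓘(ℝ, ℝ)) (g := fun p : ℝ × ℝ => p.1) contMDiff_fst
  have h2 : SmoothFam (𝓘(ℝ, ℝ).prod 𝓘(ℝ, ℝ)) fun p : ℝ × ℝ => u p.2 :=
    hu.comp (JR := 𝓘(ℝ, ℝ).prod 𝓘(ℝ, ℝ)) (g := fun p : ℝ × ℝ => p.2) contMDiff_snd
  refine fibDeriv_diag (u := fun p : ℝ × ℝ => L.bracket (s p.1) (u p.2)) (L.smoothFam_bracket h1 h2)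
    ?_ ((L.isBider.deriv (s t)).fibDeriv hu hu' b)
  have h3 := ((L.isBider.deriv (u t)).fibDeriv hs hs' b).neg
  have h4 : ∀ v, L.bracket v (u t) b = -L.bracket (u t) v b := fun v =>
    congrArg (fun w : Sec I F V => w b) (L.bracket_swap v (u t))
  simpa only [h4] using h3

theorem VBAut.pullSec_comm {φ ψ : VBAut I F V}
    (h : ∀ w, φ.total (ψ.total w) = ψ.total (φ.total w)) (s : Sec I F V) :
    φ.pullSec (ψ.pullSec s) = ψ.pullSec (φ.pullSec s) := by
  have hb : ∀ b, ψ.base (φ.base b) = φ.base (ψ.base b) := fun b => by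
    have h1 := congrArg TotalSpace.proj (h ⟨b, 0⟩)
    have h2 := φ.linear.proj (ψ.total ⟨b, 0⟩)
    have h3 := ψ.linear.proj (φ.total ⟨b, 0⟩)
    rw [ψ.linear.proj] at h2
    rw [φ.linear.proj] at h3
    exact h3.symm.trans (h1.symm.trans h2)
  refine sec_ext_total fun b => φ.total.injective (ψ.total.injective ?_)
  change ψ.total (φ.total _) = ψ.total (φ.total _)
  rw [φ.total_pullSec, ψ.total_pullSec, ← h, ψ.total_pullSec, φ.total_pullSec, hb]

theorem VBAut.pullSec_injective (φ : VBAut I F V) : Function.Injective φ.pullSec :=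
  Function.LeftInverse.injective φ.symm_pullSec_pullSec

end Brackets

/-! ## Brackets of VB-algebroids have weight zero -/

section DVB

variable {EM : Type*} [NormedAddCommGroup EM] [NormedSpace ℝ EM] [FiniteDimensional ℝ EM]
  {M : Type*} [TopologicalSpace M] [ChartedSpace EM M] [IsManifold 𝓘(ℝ, EM) ∞ M] [T2Space M]
  {FE : Type*} [NormedAddCommGroup FE] [NormedSpace ℝ FE] [FiniteDimensional ℝ FE]
  {E : M → Type*} [TopologicalSpace (TotalSpace FE E)]
  [∀ x, AddCommGroup (E x)] [∀ x, Module ℝ (E x)] [∀ x, TopologicalSpace (E x)]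
  [FiberBundle FE E] [VectorBundle ℝ FE E] [ContMDiffVectorBundle ∞ FE E 𝓘(ℝ, EM)]
  {FA : Type*} [NormedAddCommGroup FA] [NormedSpace ℝ FA] [FiniteDimensional ℝ FA]
  {A : M → Type*} [TopologicalSpace (TotalSpace FA A)]
  [∀ x, AddCommGroup (A x)] [∀ x, Module ℝ (A x)] [∀ x, TopologicalSpace (A x)]
  [FiberBundle FA A] [VectorBundle ℝ FA A] [ContMDiffVectorBundle ∞ FA A 𝓘(ℝ, EM)]
  {FV : Type*} [NormedAddCommGroup FV] [NormedSpace ℝ FV] [FiniteDimensional ℝ FV]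
  {V : TotalSpace FE E → Type*} [TopologicalSpace (TotalSpace FV V)]
  [∀ e, AddCommGroup (V e)] [∀ e, Module ℝ (V e)] [∀ e, TopologicalSpace (V e)]
  [FiberBundle FV V] [VectorBundle ℝ FV V]
  [ContMDiffVectorBundle ∞ FV V (𝓘(ℝ, EM).prod 𝓘(ℝ, FE))]
  {FU : Type*} [NormedAddCommGroup FU] [NormedSpace ℝ FU] [FiniteDimensional ℝ FU]
  {U : TotalSpace FA A → Type*} [TopologicalSpace (TotalSpace FU U)]
  [∀ a, AddCommGroup (U a)] [∀ a, Module ℝ (U a)] [∀ a, TopologicalSpace (U a)]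
  [FiberBundle FU U] [VectorBundle ℝ FU U]
  [ContMDiffVectorBundle ∞ FU U (𝓘(ℝ, EM).prod 𝓘(ℝ, FA))]
  (D : DoubleVectorBundle EM FE E FA A FV V FU U)

namespace DoubleVectorBundle

variable {D}

theorem IsLinear.hom_pullSec {c : (Fin 2 → D.Γ) → D.Γ} (hc : D.IsLinear c) {r : ℝ} (hr : 0 < r)
    (s t : D.Γ) : (D.hom r hr.ne').pullSec (c ![s, t]) =
      c ![(D.hom r hr.ne').pullSec s, (D.hom r hr.ne').pullSec t] := by
  have h := congrFun (hc r hr) ![(D.hom r hr.ne').pullSec s, (D.hom r hr.ne').pullSec t]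
  refine Eq.trans ?_ h
  change _ = (D.hom r hr.ne').pullSec _
  congr 2
  funext i
  fin_cases i
  · exact ((D.hom r hr.ne').symm_pullSec_pullSec s).symm
  · exact ((D.hom r hr.ne').symm_pullSec_pullSec t).symm

theorem isLinear_of_hom_pullSec {c : D.Γ →ₗ[ℝ] D.Γ →ₗ[ℝ] D.Γ}
    (hc : ∀ (r : ℝ) (hr : 0 < r) (s t : D.Γ), (D.hom r hr.ne').pullSec (c s t) =
      c ((D.hom r hr.ne').pullSec s) ((D.hom r hr.ne').pullSec t)) :
    D.IsLinear fun s : Fin 2 → D.Γ => c (s 0) (s 1) := by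
  intro r hr
  funext s
  refine (hc r hr _ _).trans ?_
  rw [VBAut.pullSec_symm_pullSec, VBAut.pullSec_symm_pullSec]

/-- The bracket and its pull-back have the same anchor, so their difference is tensorial and need
only be checked on linear and core sections. There the bracket conditions match the weights 0 and
−1: (lin, lin) gives weight 0, (lin, core) weight −1, and (core, core) gives zero. -/
theorem VBAlgebroid.hom_pullSec_bracket (W : D.VBAlgebroid) {r : ℝ} (hr : 0 < r) (s t : D.Γ) :
    (D.hom r hr.ne').pullBil W.bracket s t = W.bracket s t := by
  set h := D.hom r hr.ne' with hh
  obtain ⟨σ, hσ, hσ'⟩ := W.toLieAlgebroid.isBider.pull h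
  have hd := W.toLieAlgebroid.isBider.sub hσ
  -- Equality of the two anchors is the homogeneity axiom `anchor_smul`, tested on functions.
  have hX : ∀ (s : D.Γ) (e : TotalSpace FE E), (W.anchor e - σ e) (s e) = 0 := fun s e => by
    refine sub_eq_zero.2 ?_
    refine (isCoordFamily_contMDiff (𝓘(ℝ, EM).prod 𝓘(ℝ, FE)) (TotalSpace FE E)).tangent_ext
      fun f hf => ?_
    refine Eq.trans ?_ (hσ' s e ⟨f, hf⟩).symm
    have h1 := W.anchor_smul r ⟨e, s e⟩
    have h2 : D.toA.symm (scale r (D.toA ⟨e, s e⟩)) = ⟨h.base e, h.symm.pullSec s (h.base e)⟩ := by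
      rw [h.mk_symm_pullSec, h.base.symm_apply_apply]
      rfl
    rw [h2] at h1
    have h3 := TotalSpace.mk_injective _ h1
    have hb : ContMDiff (𝓘(ℝ, EM).prod 𝓘(ℝ, FE)) (𝓘(ℝ, EM).prod 𝓘(ℝ, FE)) ∞ h.base :=
      h.base.contMDiff
    have h4 := dirDeriv_mfderiv (g := h.base) (f := h.symm.pullFun ⟨f, hf⟩) (x := e)
      ((h.symm.pullFun ⟨f, hf⟩).contMDiff.mdifferentiable (by simp) _)
      (hb.mdifferentiable (by simp) e) (W.anchor e (s e))
    refine Eq.trans ?_ (h4.symm.trans (congrArg (fun X => dirDeriv X _) h3.symm))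
    congr 1
    funext y
    exact (congrArg f (h.base.symm_apply_apply y)).symm
  let d : D.Γ →ₗ[ℝ] D.Γ →ₗ[ℝ] D.Γ := W.bracket - h.pullBil W.bracket
  have hd' : ∀ s, IsDerivation (d s) fun e => (W.anchor e - σ e) (s e) := hd.deriv
  have hswap : ∀ s t, d s t = -d t s := fun s t => by
    change W.bracket s t - h.pullSecL (W.bracket _ _) = -(W.bracket t s - h.pullSecL (W.bracket _ _))
    rw [W.bracket_swap, W.bracket_swap (h.symm.pullSecL s), map_neg]
    abel
  have hll : ∀ s t, D.IsLinearSection s → D.IsLinearSection t → d s t = 0 := fun s t hs ht => by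
    have e1 : h.symm.pullSec s = s := by
      conv_lhs => rw [← hs.hom_pullSec r hr.ne']
      exact h.symm_pullSec_pullSec s
    have e2 : h.symm.pullSec t = t := by
      conv_lhs => rw [← ht.hom_pullSec r hr.ne']
      exact h.symm_pullSec_pullSec t
    change W.bracket s t - h.pullSec (W.bracket (h.symm.pullSec s) (h.symm.pullSec t)) = 0
    rw [e1, e2, (W.bracket_lin_lin s t hs ht).hom_pullSec, sub_self]
  have hcore : ∀ t, D.IsCoreSection t → h.symm.pullSec t = r • t := fun t ht => by
    have e3 : h.pullSec (r • t) = t := by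
      have e4 : h.pullSec (r • t) = r • h.pullSec t := h.pullSecL.map_smul r t
      rw [e4, ht.hom_pullSec, smul_inv_smul₀ hr.ne']
    conv_lhs => rw [← e3]
    exact h.symm_pullSec_pullSec _
  have hlc : ∀ s t, D.IsLinearSection s → D.IsCoreSection t → d s t = 0 := fun s t hs ht => by
    have e1 : h.symm.pullSec s = s := by
      conv_lhs => rw [← hs.hom_pullSec r hr.ne']
      exact h.symm_pullSec_pullSec s
    change W.bracket s t - h.pullSec (W.bracket (h.symm.pullSec s) (h.symm.pullSec t)) = 0
    rw [e1, hcore t ht, map_smul]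
    have e4 : h.pullSec (r • W.bracket s t) = r • h.pullSec (W.bracket s t) :=
      h.pullSecL.map_smul r _
    rw [e4, (W.bracket_lin_core s t hs ht).hom_pullSec, smul_inv_smul₀ hr.ne', sub_self]
  have hcc : ∀ s t, D.IsCoreSection s → D.IsCoreSection t → d s t = 0 := fun s t hs ht => by
    change W.bracket s t - h.pullSecL (W.bracket (h.symm.pullSec s) (h.symm.pullSec t)) = 0
    rw [hcore t ht, hcore s hs, map_smul, LinearMap.map_smul₂, W.bracket_core_core s t hs ht,
      smul_zero, smul_zero, map_zero, sub_zero]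
  have hz : d s t = 0 := by
    ext e
    obtain ⟨s₁, κ₁, hs₁, hκ₁, hv₁⟩ := D.exists_linear_add_core (s e)
    obtain ⟨s₂, κ₂, hs₂, hκ₂, hv₂⟩ := D.exists_linear_add_core (t e)
    -- Tensoriality at e replaces t, and after a swap also s, by linear plus core sections with the
    -- same values at e.
    rw [(hd' s).congr_of_symbol_eq_zero (hX s e) hv₂, hswap]
    have e5 := (hd' (s₂ + κ₂)).congr_of_symbol_eq_zero (hX (s₂ + κ₂) e) hv₁
    have e6 : d (s₂ + κ₂) (s₁ + κ₁) = 0 := by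
      rw [map_add, map_add, LinearMap.add_apply, LinearMap.add_apply, hll _ _ hs₂ hs₁,
        hlc _ _ hs₂ hκ₁, hcc _ _ hκ₂ hκ₁, hswap κ₂ s₁, hlc _ _ hs₁ hκ₂]
      simp
    rw [e6] at e5
    change -(d (s₂ + κ₂) s e) = 0
    rw [e5]
    exact neg_zero
  exact (sub_eq_zero.1 hz).symm

theorem VBAlgebroid.isLinear_brk (W : D.VBAlgebroid) : D.IsLinear W.brk := by
  intro r hr
  funext s
  exact W.hom_pullSec_bracket hr (s 0) (s 1)

/-- Linear deformations are Maurer–Cartan elements. -/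
theorem IsDeformation.isMaurerCartan {W b : D.VBAlgebroid} {c : D.LinCochain 1}
    (h : IsDeformation W c b) : IsMaurerCartan W c := by
  have hc : ∀ x y, c.fn ![x, y] = b.bracket x y - W.bracket x y := fun x y => by
    have h1 : b.bracket x y = W.bracket x y + c.fn ![x, y] := congrFun h ![x, y]
    rw [h1, add_sub_cancel_left]
  have hW : ∀ x y, W.brk ![x, y] = W.bracket x y := fun x y => rfl
  funext s
  have h1 := gerst_one_one W.brk c.fn s
  have h2 := gerst_one_one c.fn c.fn s
  change gerst (k := 1) (l := 1) W.brk c.fn s + (1 / 2 : ℝ) • gerst (k := 1) (l := 1) c.fn c.fn s = 0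
  rw [h1, h2, gerstProd_one_two, gerstProd_one_two, gerstProd_one_two]
  simp only [hc, hW, map_sub, LinearMap.sub_apply]
  have jb := b.jacobi (s 0) (s 1) (s 2)
  have jW := W.jacobi (s 0) (s 1) (s 2)
  rw [b.bracket_swap (s 2) (s 0), map_neg, LinearMap.neg_apply] at jb
  rw [W.bracket_swap (s 2) (s 0), map_neg, LinearMap.neg_apply] at jW
  -- With c = b − b_W, the left side is ½⟦b, b⟧ − ½⟦b_W, b_W⟧, which is the Jacobiator of b_W minus
  -- that of b; zero is rewritten as that difference.
  rw [show (0 : D.Γ) = 0 - 0 from (sub_zero 0).symm]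
  nth_rewrite 1 [← jW]
  rw [← jb]
  module

end DoubleVectorBundle

end DVB

/-! ## Equivalent deformations are gauge equivalent -/

/-- A smooth function that moves periodically between `0` and `1`. -/
def cosRamp (t : ℝ) : ℝ := (1 - Real.cos (Real.pi * t)) / 2

theorem contDiff_cosRamp : ContDiff ℝ ∞ cosRamp :=
  (contDiff_const.sub (Real.contDiff_cos.comp (contDiff_const.mul contDiff_id))).div_const 2

theorem cosRamp_mem (t : ℝ) : cosRamp t ∈ Icc (0 : ℝ) 1 := by
  have h1 := Real.neg_one_le_cos (Real.pi * t)
  have h2 := Real.cos_le_one (Real.pi * t)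
  constructor <;> unfold cosRamp <;> linarith

@[simp] theorem cosRamp_zero : cosRamp 0 = 0 := by simp [cosRamp]

@[simp] theorem cosRamp_one : cosRamp 1 = 1 := by norm_num [cosRamp]

/-! ### A fixed bracket conjugated along a path of automorphisms -/

section PullBracket

variable {EB : Type*} [NormedAddCommGroup EB] [NormedSpace ℝ EB] [FiniteDimensional ℝ EB]
  {HB : Type*} [TopologicalSpace HB] {I : ModelWithCorners ℝ EB HB} [I.Boundaryless]
  {B : Type*} [TopologicalSpace B] [ChartedSpace HB B] [IsManifold I ∞ B] [T2Space B]
  {F : Type*} [NormedAddCommGroup F] [NormedSpace ℝ F] [FiniteDimensional ℝ F]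
  {V : B → Type*} [TopologicalSpace (TotalSpace F V)]
  [∀ b, AddCommGroup (V b)] [∀ b, Module ℝ (V b)] [∀ b, TopologicalSpace (V b)]
  [FiberBundle F V] [VectorBundle ℝ F V] [ContMDiffVectorBundle ∞ F V I]

theorem VBAut.pullSec_of_total_eq {φ : VBAut I F V} (h : ∀ w, φ.total w = w) (s : Sec I F V) :
    φ.pullSec s = s := by
  refine sec_ext_total fun b => ?_
  have h1 := φ.total_pullSec s b
  have h2 : φ.base b = b := by rw [φ.base_eq, h]
  rw [h, h2] at h1
  exact h1

theorem SmoothAutPath.smoothFam_pullBil {φ : ℝ → VBAut I F V} (h : SmoothAutPath φ)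
    (L : LieAlgebroid I F V) (s u : Sec I F V) :
    SmoothFam 𝓘(ℝ, ℝ) fun t => (φ t).symm.pullBil L.bracket s u :=
  h.symm.pullSec contMDiff_id (L.smoothFam_bracket (h.pullSec contMDiff_id (smoothFam_const s))
    (h.pullSec contMDiff_id (smoothFam_const u)))

/-- For β_t = (φ_t⁻¹)^* L, differentiate φ_t^*(β_t(s, u)) = L(φ_t^* s, φ_t^* u). The left side
contributes the generator and the unknown derivative of β_t, the right side the product rule; then
cancel the injective φ_t^*. The result is ⟦β_t, D_t⟧ evaluated on (s, u). -/
theorem SmoothAutPath.fibDeriv_pullBil {φ : ℝ → VBAut I F V} (h : SmoothAutPath φ)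
    (L : LieAlgebroid I F V) {D : ℝ → Sec I F V →ₗ[ℝ] Sec I F V}
    (hD : ∀ s t b, FibDeriv (fun τ => (φ τ).pullSec s b) ((φ t).pullSec (D t s) b) t)
    (s u : Sec I F V) (t : ℝ) (b : B) :
    FibDeriv (fun τ => (φ τ).symm.pullBil L.bracket s u b)
      (((φ t).symm.pullBil L.bracket (D t s) u + (φ t).symm.pullBil L.bracket s (D t u) -
        D t ((φ t).symm.pullBil L.bracket s u)) b) t := by
  obtain ⟨w', -, hw'⟩ := (h.smoothFam_pullBil L s u).exists_deriv
  refine (hw' t b).congr_deriv (congrArg (fun v : Sec I F V => v b) (eq_sub_of_add_eq' ?_))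
  refine (φ t).pullSec_injective ?_
  ext y
  have h1 := h.fibDeriv_pullSec (h.smoothFam_pullBil L s u) (hw' t) (fun b => hD _ t b) y
  have h2 := L.fibDeriv_bracket (h.pullSec contMDiff_id (smoothFam_const s))
    (h.pullSec contMDiff_id (smoothFam_const u)) (hD s t) (hD u t) y
  have h3 : ∀ v : Sec I F V, ∀ τ, (φ τ).pullSec ((φ τ).symm.pullSec v) = v :=
    fun v τ => (φ τ).pullSec_symm_pullSec v
  have h4 : (fun τ => (φ τ).pullSec ((φ τ).symm.pullBil L.bracket s u) y) =
      fun τ => L.bracket ((φ τ).pullSec s) ((φ τ).pullSec u) y :=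
    funext fun τ => congrArg (fun v : Sec I F V => v y) (h3 _ τ)
  rw [h4] at h1
  refine (h1.unique h2).trans ?_
  have h5 : (φ t).pullSec ((φ t).symm.pullBil L.bracket (D t s) u +
      (φ t).symm.pullBil L.bracket s (D t u)) =
      L.bracket ((φ t).pullSec (D t s)) ((φ t).pullSec u) +
        L.bracket ((φ t).pullSec s) ((φ t).pullSec (D t u)) := by
    refine ((φ t).pullSecL.map_add _ _).trans ?_
    exact congrArg₂ (· + ·) (h3 _ t) (h3 _ t)
  rw [h5]
  rfl

end PullBracket

/-! ### From an isotopy to a gauge equivalence -/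

section DVB

variable {EM : Type*} [NormedAddCommGroup EM] [NormedSpace ℝ EM] [FiniteDimensional ℝ EM]
  {M : Type*} [TopologicalSpace M] [ChartedSpace EM M] [IsManifold 𝓘(ℝ, EM) ∞ M] [T2Space M]
  {FE : Type*} [NormedAddCommGroup FE] [NormedSpace ℝ FE] [FiniteDimensional ℝ FE]
  {E : M → Type*} [TopologicalSpace (TotalSpace FE E)]
  [∀ x, AddCommGroup (E x)] [∀ x, Module ℝ (E x)] [∀ x, TopologicalSpace (E x)]
  [FiberBundle FE E] [VectorBundle ℝ FE E] [ContMDiffVectorBundle ∞ FE E 𝓘(ℝ, EM)]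
  {FA : Type*} [NormedAddCommGroup FA] [NormedSpace ℝ FA] [FiniteDimensional ℝ FA]
  {A : M → Type*} [TopologicalSpace (TotalSpace FA A)]
  [∀ x, AddCommGroup (A x)] [∀ x, Module ℝ (A x)] [∀ x, TopologicalSpace (A x)]
  [FiberBundle FA A] [VectorBundle ℝ FA A] [ContMDiffVectorBundle ∞ FA A 𝓘(ℝ, EM)]
  {FV : Type*} [NormedAddCommGroup FV] [NormedSpace ℝ FV] [FiniteDimensional ℝ FV]
  {V : TotalSpace FE E → Type*} [TopologicalSpace (TotalSpace FV V)]
  [∀ e, AddCommGroup (V e)] [∀ e, Module ℝ (V e)] [∀ e, TopologicalSpace (V e)]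
  [FiberBundle FV V] [VectorBundle ℝ FV V]
  [ContMDiffVectorBundle ∞ FV V (𝓘(ℝ, EM).prod 𝓘(ℝ, FE))]
  {FU : Type*} [NormedAddCommGroup FU] [NormedSpace ℝ FU] [FiniteDimensional ℝ FU]
  {U : TotalSpace FA A → Type*} [TopologicalSpace (TotalSpace FU U)]
  [∀ a, AddCommGroup (U a)] [∀ a, Module ℝ (U a)] [∀ a, TopologicalSpace (U a)]
  [FiberBundle FU U] [VectorBundle ℝ FU U]
  [ContMDiffVectorBundle ∞ FU U (𝓘(ℝ, EM).prod 𝓘(ℝ, FA))]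
  (D : DoubleVectorBundle EM FE E FA A FV V FU U)

namespace DoubleVectorBundle

variable {D}

theorem DVBAut.total_hom (φ : D.DVBAut) (r : ℝ) (hr : r ≠ 0) (w : TotalSpace FV V) :
    (D.hom r hr).total (φ.onW.total w) = φ.onW.total ((D.hom r hr).total w) := by
  refine D.toA.injective ((D.toA_hom r hr _).trans ?_)
  have h := φ.linear_toA.smul r (D.toA w)
  rw [D.toA.symm_apply_apply] at h
  exact h.symm

theorem DVBAut.hom_pullSec (φ : D.DVBAut) (r : ℝ) (hr : r ≠ 0) (s : D.Γ) :
    (D.hom r hr).pullSec (φ.onW.pullSec s) = φ.onW.pullSec ((D.hom r hr).pullSec s) :=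
  VBAut.pullSec_comm (φ.total_hom r hr) s

theorem VBAlgebroid.hom_pullSec_bracket' (W : D.VBAlgebroid) {r : ℝ} (hr : 0 < r) (s t : D.Γ) :
    (D.hom r hr.ne').pullSec (W.bracket s t) =
      W.bracket ((D.hom r hr.ne').pullSec s) ((D.hom r hr.ne').pullSec t) :=
  W.isLinear_brk.hom_pullSec hr s t

theorem smoothPath_of_smoothFam {n : ℕ} {c : ℝ → (Fin n → D.Γ) → D.Γ}
    (h : ∀ s, SmoothFam 𝓘(ℝ, ℝ) fun t => c t s) : SmoothPath c := fun s => (h s).contMDiffOn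

theorem hasPathDeriv_of_fibDeriv {n : ℕ} {c c' : ℝ → (Fin n → D.Γ) → D.Γ}
    (h : ∀ t s e, FibDeriv (fun τ => c τ s e) (c' t s e) t) : HasPathDeriv c c' :=
  fun t _ s e => ((h t s e).tendsto_slope FV).mono_left (nhdsWithin_mono t fun _ hx => hx.2)

theorem isLinear_altOfLin {G : D.Γ →ₗ[ℝ] D.Γ}
    (hG : ∀ (r : ℝ) (hr : 0 < r) (s : D.Γ), (D.hom r hr.ne').pullSec (G s) =
      G ((D.hom r hr.ne').pullSec s)) : D.IsLinear (altOfLin G) := by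
  intro r hr
  funext s
  refine (hG r hr _).trans ?_
  rw [VBAut.pullSec_symm_pullSec]
  rfl

-- The interpolating path is c_t = (ψ_t⁻¹)^* b₀ − b_W with Δ_t the generator of ψ. It ends at c₁
-- because φ₁^* b₁ = b₀ means b₁ = (φ₁⁻¹)^* b₀.
set_option maxHeartbeats 800000 in
theorem Equivalent.gaugeEquivalent {W b₀ b₁ : D.VBAlgebroid} {c₀ c₁ : D.LinCochain 1}
    (h₀ : IsDeformation W c₀ b₀) (h₁ : IsDeformation W c₁ b₁) (h : Equivalent b₀ b₁) :
    GaugeEquivalent W c₀ c₁ := by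
  obtain ⟨φ, hφ, hφ0, hφ1⟩ := h
  -- The isotopy is smooth only over [0,1]. Running it along `cosRamp` gives a path smooth over all
  -- of ℝ with the same endpoints.
  let ψ : ℝ → VBAut (𝓘(ℝ, EM).prod 𝓘(ℝ, FE)) FV V := fun t => (φ (cosRamp t)).onW
  have hψ : SmoothAutPath ψ := by
    refine ContMDiffOn.comp_contMDiff (g := fun p : ℝ × TotalSpace FV V => (φ p.1).onW.total p.2)
      (f := fun p : ℝ × TotalSpace FV V => (cosRamp p.1, p.2)) hφ ?_ fun p =>
        ⟨cosRamp_mem p.1, mem_univ _⟩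
    exact (contDiff_cosRamp.contMDiff.comp contMDiff_fst).prodMk contMDiff_snd
  have hψh : ∀ t (r : ℝ) (hr : r ≠ 0) (s : D.Γ),
      (D.hom r hr).pullSec ((ψ t).pullSec s) = (ψ t).pullSec ((D.hom r hr).pullSec s) :=
    fun t => (φ (cosRamp t)).hom_pullSec
  have hψh' : ∀ t (r : ℝ) (hr : r ≠ 0) (s : D.Γ), (D.hom r hr).pullSec ((ψ t).symm.pullSec s) =
      (ψ t).symm.pullSec ((D.hom r hr).pullSec s) := fun t r hr s => by
    refine (ψ t).pullSec_injective ?_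
    rw [← hψh, (ψ t).pullSec_symm_pullSec, (ψ t).pullSec_symm_pullSec]
  obtain ⟨G, X, hGX, hX, hGs, hG⟩ := hψ.exists_generator
  let β : ℝ → D.Γ →ₗ[ℝ] D.Γ →ₗ[ℝ] D.Γ := fun t => (ψ t).symm.pullBil b₀.bracket
  have hβ : ∀ t s u, β t s u =
      (ψ t).symm.pullSec (b₀.bracket ((ψ t).pullSec s) ((ψ t).pullSec u)) := fun _ _ _ => rfl
  let γ : ℝ → D.Γ →ₗ[ℝ] D.Γ →ₗ[ℝ] D.Γ := fun t => β t - W.bracket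
  have hγ0 : ∀ t s, γ t s s = 0 := fun t s => by
    change β t s s - W.bracket s s = 0
    rw [hβ, W.bracket_self, b₀.bracket_self, sub_zero]
    exact (ψ t).symm.pullSecL.map_zero
  have hγm : ∀ t, IsMultiderivation (k := 1) (altOfBil (γ t) (hγ0 t)) := fun t => by
    obtain ⟨σ, hσ, -⟩ := b₀.isBider.pull (ψ t).symm
    exact (hσ.sub W.isBider).isMultiderivation (hγ0 t)
  have hγl : ∀ t, D.IsLinear (altOfBil (γ t) (hγ0 t)) := fun t => by
    refine isLinear_of_hom_pullSec (D := D) (c := γ t) fun r hr s u => ?_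
    change (D.hom r hr.ne').pullSecL (β t s u - W.bracket s u) = β t _ _ - W.bracket _ _
    rw [map_sub]
    refine congrArg₂ (· - ·) ?_ (W.hom_pullSec_bracket' hr s u)
    refine (hψh' t r hr.ne' (b₀.bracket ((ψ t).pullSec s) ((ψ t).pullSec u))).trans ?_
    rw [b₀.hom_pullSec_bracket' hr, hψh, hψh]
    rfl
  -- The pull-backs by h_r and ψ_t commute; differentiating in t and cancelling ψ_t^* shows that the
  -- generator commutes with h_r^*.
  have hGl : ∀ t, D.IsLinear (altOfLin (G t)) := fun t =>
    isLinear_altOfLin (D := D) (G := G t) fun r hr v => by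
      refine (ψ t).pullSec_injective ?_
      rw [← hψh]
      ext e
      have h1 := FibDeriv.pullSec (φ := D.hom r hr.ne') (hG v t) e
      have h2 : (fun τ => (D.hom r hr.ne').pullSec ((ψ τ).pullSec v) e) =
          fun τ => (ψ τ).pullSec ((D.hom r hr.ne').pullSec v) e :=
        funext fun τ => congrArg (fun w : D.Γ => w e) (hψh τ r hr.ne' v)
      rw [h2] at h1
      exact h1.unique (hG _ t e)
  let c : ℝ → D.LinCochain 1 := fun t => ⟨altOfBil (γ t) (hγ0 t), hγm t, hγl t⟩
  let Δ : ℝ → D.LinCochain 0 := fun t =>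
    ⟨altOfLin (G t), (hGX t).isMultiderivation (hX t), hGl t⟩
  have hcf : ∀ t s, (c t).fn s = β t (s 0) (s 1) - W.bracket (s 0) (s 1) := fun _ _ => rfl
  have hβs : ∀ s u, SmoothFam 𝓘(ℝ, ℝ) fun t => β t s u := hψ.smoothFam_pullBil b₀.toLieAlgebroid
  refine ⟨h₀.isMaurerCartan, h₁.isMaurerCartan, c, Δ, ?_, ?_, ?_, ?_, ?_⟩
  · exact smoothPath_of_smoothFam fun s => (hβs _ _).sub (smoothFam_const _)
  · exact smoothPath_of_smoothFam fun s => hGs (s 0)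
  · refine Subtype.ext (AlternatingMap.ext fun s => ?_)
    have hid : ∀ s, (ψ 0).pullSec s = s := VBAut.pullSec_of_total_eq fun w => by
      change (φ (cosRamp 0)).onW.total w = w
      rw [cosRamp_zero, hφ0]
    have h1 : β 0 (s 0) (s 1) = b₀.bracket (s 0) (s 1) := by
      refine (ψ 0).pullSec_injective ?_
      rw [hβ, (ψ 0).pullSec_symm_pullSec, hid, hid, hid]
    have h2 : b₀.bracket (s 0) (s 1) = W.bracket (s 0) (s 1) + c₀.fn s := congrFun h₀ s
    change β 0 (s 0) (s 1) - W.bracket (s 0) (s 1) = c₀.fn s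
    rw [h1, h2, add_sub_cancel_left]
  · refine Subtype.ext (AlternatingMap.ext fun s => ?_)
    have hψ1 : ψ 1 = (φ 1).onW := by
      change (φ (cosRamp 1)).onW = _
      rw [cosRamp_one]
    have h1 : β 1 (s 0) (s 1) = b₁.bracket (s 0) (s 1) := by
      refine (ψ 1).pullSec_injective ?_
      rw [hβ, (ψ 1).pullSec_symm_pullSec, hψ1]
      have h3 := congrFun hφ1 ![(φ 1).onW.pullSec (s 0), (φ 1).onW.pullSec (s 1)]
      refine Eq.trans h3.symm ?_
      change (φ 1).onW.pullSec (b₁.bracket ((φ 1).onW.symm.pullSec ((φ 1).onW.pullSec (s 0)))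
        ((φ 1).onW.symm.pullSec ((φ 1).onW.pullSec (s 1)))) = _
      rw [VBAut.symm_pullSec_pullSec, VBAut.symm_pullSec_pullSec]
    have h2 : b₁.bracket (s 0) (s 1) = W.bracket (s 0) (s 1) + c₁.fn s := congrFun h₁ s
    change β 1 (s 0) (s 1) - W.bracket (s 0) (s 1) = c₁.fn s
    rw [h1, h2, add_sub_cancel_left]
  · refine hasPathDeriv_of_fibDeriv fun t s e => ?_
    have h1 := (hψ.fibDeriv_pullBil b₀.toLieAlgebroid hG (s 0) (s 1) t e).sub
      (fibDeriv_const (W.bracket (s 0) (s 1) e) t)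
    refine h1.congr_deriv ?_
    rw [sub_zero]
    refine congrArg (fun v : D.Γ => v e) ?_
    have h2 := gerst_one_zero W.brk (Δ t).fn s
    have h3 := gerst_one_zero (c t).fn (Δ t).fn s
    refine Eq.trans ?_ (congrArg₂ (· + ·) h2 h3).symm
    have h4 : ∀ x y, (c t).fn ![x, y] = β t x y - W.bracket x y := fun x y => hcf t _
    have h5 : ∀ x, (Δ t).fn ![x] = G t x := fun x => rfl
    have h6 : ∀ x y, W.brk ![x, y] = W.bracket x y := fun x y => rfl
    have h7 : β t (G t (s 1)) (s 0) = -β t (s 0) (G t (s 1)) := by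
      rw [hβ, hβ, b₀.bracket_swap]
      exact (ψ t).symm.pullSecL.map_neg _
    simp only [h4, h5, h6, map_sub, h7]
    change β t _ _ + β t _ _ - G t (β t _ _) = _
    abel

end DoubleVectorBundle

end DVB

/-! ## Flows of time-dependent vector fields -/

section TimeDependent

variable {EN : Type*} [NormedAddCommGroup EN] [NormedSpace ℝ EN] [FiniteDimensional ℝ EN]
  {HN : Type*} [TopologicalSpace HN] {J : ModelWithCorners ℝ EN HN} [J.Boundaryless]
  {N : Type*} [TopologicalSpace N] [ChartedSpace HN N] [IsManifold J ∞ N] [T2Space N]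

theorem hasDerivAt_comp_of_isMIntegralCurve {X : ∀ x : N, TangentSpace J x} {γ : ℝ → N}
    (hγ : IsMIntegralCurve γ X) {g : N → ℝ} (hg : ContMDiff J 𝓘(ℝ, ℝ) ∞ g) (t : ℝ) :
    HasDerivAt (fun τ => g (γ τ)) (dirDeriv (X (γ t)) g) t := by
  have h1 := (hg.mdifferentiable (by simp) (γ t)).hasMFDerivAt
  let A : EN →L[ℝ] ℝ := mfderiv J 𝓘(ℝ, ℝ) g (γ t)
  let v : EN := X (γ t)
  have h2 : HasFDerivAt (fun τ => g (γ τ)) (A.comp ((1 : ℝ →L[ℝ] ℝ).smulRight v)) t :=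
    (HasMFDerivAt.comp t h1 (hγ t)).hasFDerivAt
  refine h2.hasDerivAt.congr_deriv ?_
  exact congrArg A (one_smul ℝ v)

/-- The vector field on space-time given by a time-dependent vector field. -/
def spacetimeField (Y : ∀ (_ : ℝ) (x : N), TangentSpace J x) (p : ℝ × N) :
    TangentSpace (𝓘(ℝ, ℝ).prod J) p := ((1, Y p.1 p.2) : ℝ × EN)

variable {Y : ∀ (_ : ℝ) (x : N), TangentSpace J x}

/-- The shift c serves the symmetries (t, x) ↦ (t + c, S x) of space-time. -/
theorem dirDeriv_spacetimeField_fst (p : ℝ × N) (c : ℝ) :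
    dirDeriv (spacetimeField Y p) (fun p => p.1 + c) = 1 := by
  have hc : ContDiff ℝ ∞ fun t : ℝ => t + c := contDiff_id.add contDiff_const
  have h := dirDeriv_mfderiv (J₁ := 𝓘(ℝ, ℝ).prod J) (J₂ := 𝓘(ℝ, ℝ)) (g := fun p : ℝ × N => p.1)
    (f := fun t => t + c) (x := p) (hc.contMDiff.mdifferentiable (by simp) p.1)
    mdifferentiableAt_fst (spacetimeField Y p)
  refine h.symm.trans ?_
  rw [mfderiv_fst]
  change mfderiv 𝓘(ℝ, ℝ) 𝓘(ℝ, ℝ) (fun t : ℝ => t + c) p.1 (1 : ℝ) = 1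
  rw [mfderiv_eq_fderiv]
  have h2 : HasDerivAt (fun t : ℝ => t + c) 1 p.1 := (hasDerivAt_id p.1).add_const c
  exact (fderiv_apply_one_eq_deriv).trans h2.deriv

theorem dirDeriv_spacetimeField_snd (p : ℝ × N) {g : N → ℝ} (hg : ContMDiff J 𝓘(ℝ, ℝ) ∞ g) :
    dirDeriv (spacetimeField Y p) (fun p => g p.2) = dirDeriv (Y p.1 p.2) g := by
  have h := dirDeriv_mfderiv (J₁ := 𝓘(ℝ, ℝ).prod J) (J₂ := J) (g := fun p : ℝ × N => p.2)
    (f := g) (x := p) (hg.mdifferentiable (by simp) p.2)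
    mdifferentiableAt_snd (spacetimeField Y p)
  refine h.symm.trans ?_
  rw [mfderiv_snd]
  rfl

theorem contMDiff_spacetimeField (hY : ContMDiff (𝓘(ℝ, ℝ).prod J) J.tangent ∞
      fun p : ℝ × N => (⟨p.2, Y p.1 p.2⟩ : TangentBundle J N)) :
    ContMDiff (𝓘(ℝ, ℝ).prod J) (𝓘(ℝ, ℝ).prod J).tangent ∞
      fun p : ℝ × N => (⟨p, spacetimeField Y p⟩ : TangentBundle (𝓘(ℝ, ℝ).prod J) (ℝ × N)) := by
  refine (isCoordFamily_contMDiff J N).prod_real.contMDiff_tangent contMDiff_id ?_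
  rintro _ (rfl | ⟨g, hg, rfl⟩)
  · have h := fun p => dirDeriv_spacetimeField_fst (Y := Y) p 0
    simp only [add_zero] at h
    exact (contMDiff_const (c := (1 : ℝ))).congr h
  · refine ContMDiff.congr ?_ fun p => dirDeriv_spacetimeField_snd p hg
    exact contMDiff_dirDeriv (f := fun _ => g) (ContMDiff.comp hg contMDiff_snd) hY

/-- Shifting time by a period and applying a symmetry of all the Y t preserves ∂_t + Y_t; this is
tested on the time coordinate and on functions of N. -/
theorem mfderiv_prodMap_spacetimeField {S : N → N} (hS : ContMDiff J J ∞ S) {c : ℝ}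
    (hc : ∀ t x, Y (t + c) x = Y t x) (hSY : ∀ t x, mfderiv J J S x (Y t x) = Y t (S x))
    (p : ℝ × N) : mfderiv (𝓘(ℝ, ℝ).prod J) (𝓘(ℝ, ℝ).prod J) (fun p : ℝ × N => (p.1 + c, S p.2)) p
      (spacetimeField Y p) = spacetimeField Y (p.1 + c, S p.2) := by
  have hS' : ContMDiff (𝓘(ℝ, ℝ).prod J) (𝓘(ℝ, ℝ).prod J) ∞
      (fun p : ℝ × N => (p.1 + c, S p.2)) :=
    (contMDiff_fst.add contMDiff_const).prodMk (hS.comp contMDiff_snd)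
  have hco := (isCoordFamily_contMDiff J N).prod_real
  refine hco.tangent_ext fun g hg => ?_
  refine (dirDeriv_mfderiv ((hco.smooth g hg).mdifferentiable (by simp) _)
    (hS'.mdifferentiable (by simp) p) _).trans ?_
  obtain rfl | ⟨g, hg, rfl⟩ := hg
  · have h := dirDeriv_spacetimeField_fst (Y := Y) (p.1 + c, S p.2) 0
    simp only [add_zero] at h
    exact (dirDeriv_spacetimeField_fst p c).trans h.symm
  · refine (dirDeriv_spacetimeField_snd p (g := fun x => g (S x)) (ContMDiff.comp hg hS)).trans ?_
    refine Eq.trans ?_ (dirDeriv_spacetimeField_snd _ hg).symm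
    refine (dirDeriv_mfderiv (ContMDiff.mdifferentiable hg (by simp) _)
      (hS.mdifferentiable (by simp) p.2) (Y p.1 p.2)).symm.trans ?_
    rw [hSY]
    exact congrArg (fun X => dirDeriv X g) (hc p.1 (S p.2)).symm

/-- A periodic time-dependent vector field has a global flow if every point is moved into every
neighbourhood of a fixed compact set by symmetries of the vector field. -/
theorem exists_timeDependentFlow (hY : ContMDiff (𝓘(ℝ, ℝ).prod J) J.tangent ∞
      fun p : ℝ × N => (⟨p.2, Y p.1 p.2⟩ : TangentBundle J N))
    (hper : Function.Periodic Y 2) {K : Set N} (hK : IsCompact K)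
    (hsym : ∀ O : Set N, K ⊆ O → IsOpen O → ∀ x, ∃ S : Diffeomorph J J N N ∞,
      (∀ t x, mfderiv J J S x (Y t x) = Y t (S x)) ∧ ∃ y ∈ O, S y = x) :
    ∃ φ : ℝ → Diffeomorph J J N N ∞,
      ContMDiff (𝓘(ℝ, ℝ).prod J) J ∞ (fun p : ℝ × N => φ p.1 p.2) ∧ (∀ x, φ 0 x = x) ∧
      (∀ g : N → ℝ, ContMDiff J 𝓘(ℝ, ℝ) ∞ g → ∀ t x,
        HasDerivAt (fun τ => g (φ τ x)) (dirDeriv (Y t (φ t x)) g) t) ∧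
      ∀ S : Diffeomorph J J N N ∞, (∀ t x, mfderiv J J S x (Y t x) = Y t (S x)) →
        ∀ t x, φ t (S x) = S (φ t x) := by
  have hZ := contMDiff_spacetimeField hY
  -- The autonomous field ∂_t + Y_t on ℝ × N is complete by the symmetry criterion, with compact set
  -- [0,2] × K and time translations by periods among the symmetries.
  obtain ⟨Φ, hΦ, hΦ0, hΦX⟩ := exists_globalFlow hZ (isCompact_Icc (a := (0 : ℝ)) (b := 2) |>.prod hK)
    (by
      intro O hO hOo ⟨t, x⟩
      obtain ⟨O₁, O₂, -, hO₂, h₁, h₂, h₁₂⟩ := generalized_tube_lemma isCompact_Icc hK hOo hO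
      obtain ⟨S, hS, y, hy, rfl⟩ := hsym O₂ h₂ hO₂ x
      -- The largest multiple of the period not exceeding t, so that t − c lies in [0, 2].
      let c : ℝ := ⌊t / 2⌋ * 2
      have hc : ∀ t x, Y (t + c) x = Y t x := fun s x => congrFun (hper.int_mul ⌊t / 2⌋ s) x
      let T : Diffeomorph 𝓘(ℝ, ℝ) 𝓘(ℝ, ℝ) ℝ ℝ ∞ :=
        { toEquiv := Equiv.addRight c
          contMDiff_toFun := (contDiff_id.add contDiff_const).contMDiff
          contMDiff_invFun := (contDiff_id.add contDiff_const).contMDiff }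
      refine ⟨T.prodCongr S, fun p => mfderiv_prodMap_spacetimeField S.contMDiff hc hS p,
        (t - c, y), h₁₂ ⟨h₁ ⟨?_, ?_⟩, hy⟩, ?_⟩
      · have := Int.floor_le (t / 2)
        change 0 ≤ t - ⌊t / 2⌋ * 2
        linarith
      · have := Int.lt_floor_add_one (t / 2)
        change t - ⌊t / 2⌋ * 2 ≤ 2
        linarith
      · change (t - c + c, S y) = (t, S y)
        rw [sub_add_cancel])
  have huniq : ∀ {γ γ' : ℝ → ℝ × N}, IsMIntegralCurve (I := 𝓘(ℝ, ℝ).prod J) γ (spacetimeField Y) →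
      IsMIntegralCurve (I := 𝓘(ℝ, ℝ).prod J) γ' (spacetimeField Y) → γ 0 = γ' 0 → γ = γ' :=
    fun h h' h0 => isMIntegralCurve_Ioo_eq_of_contMDiff_boundaryless (t₀ := 0)
      (hZ.of_le (mod_cast le_top)) h h' h0
  have hfst : ∀ t p, (Φ (t, p)).1 = p.1 + t := fun t p => by
    have h1 : ∀ t, HasDerivAt (fun τ => (Φ (τ, p)).1 - τ) 0 t := fun t => by
      have h := (hasDerivAt_comp_of_isMIntegralCurve (hΦX p)
        (contMDiff_fst (I := 𝓘(ℝ, ℝ)) (J := J)) t).sub (hasDerivAt_id t)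
      refine h.congr_deriv (sub_eq_zero.2 ?_)
      have h2 := dirDeriv_spacetimeField_fst (Y := Y) (Φ (t, p)) 0
      simp only [add_zero] at h2
      exact h2
    have h2 := is_const_of_deriv_eq_zero (fun t => (h1 t).differentiableAt)
      (fun t => (h1 t).deriv) t 0
    simp only [hΦ0, sub_zero] at h2
    linarith
  have hgrp : ∀ s t p, Φ (s + t, p) = Φ (s, Φ (t, p)) := fun s t p => by
    have h := huniq ((hΦX p).comp_add t) (hΦX (Φ (t, p)))
      (by simp only [Function.comp_apply, zero_add, hΦ0])
    exact congrFun h s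
  have hmk : ∀ t x, Φ (t, (0, x)) = (t, (Φ (t, (0, x))).2) := fun t x =>
    Prod.ext ((hfst t (0, x)).trans (zero_add t)) rfl
  have hmk' : ∀ t x, Φ (-t, (t, x)) = (0, (Φ (-t, (t, x))).2) := fun t x =>
    Prod.ext ((hfst (-t) (t, x)).trans (add_neg_cancel t)) rfl
  -- The slice at time 0 flows to the slice at time t because the time coordinate grows at unit
  -- speed; the inverse flows back for time −t from the slice at time t.
  let φ : ℝ → Diffeomorph J J N N ∞ := fun t =>
    { toFun := fun x => (Φ (t, (0, x))).2
      invFun := fun x => (Φ (-t, (t, x))).2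
      left_inv := fun x => by
        change (Φ (-t, (t, (Φ (t, (0, x))).2))).2 = x
        rw [← hmk, ← hgrp, neg_add_cancel, hΦ0]
      right_inv := fun x => by
        change (Φ (t, (0, (Φ (-t, (t, x))).2))).2 = x
        rw [← hmk', ← hgrp, add_neg_cancel, hΦ0]
      contMDiff_toFun := contMDiff_snd.comp (hΦ.comp
        (contMDiff_const.prodMk (contMDiff_const.prodMk contMDiff_id)))
      contMDiff_invFun := contMDiff_snd.comp (hΦ.comp
        (contMDiff_const.prodMk (contMDiff_const.prodMk contMDiff_id))) }
  refine ⟨φ, ?_, fun x => congrArg Prod.snd (hΦ0 (0, x)), fun g hg t x => ?_, fun S hS t x => ?_⟩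
  · exact contMDiff_snd.comp (hΦ.comp (contMDiff_fst.prodMk (contMDiff_const.prodMk contMDiff_snd)))
  · refine (hasDerivAt_comp_of_isMIntegralCurve (hΦX (0, x)) (ContMDiff.comp hg
      (contMDiff_snd (I := 𝓘(ℝ, ℝ)) (J := J))) t).congr_deriv ?_
    refine (dirDeriv_spacetimeField_snd _ hg).trans ?_
    have h : (Φ (t, (0, x))).1 = t := (hfst t (0, x)).trans (zero_add t)
    exact congrArg (fun s => dirDeriv (Y s (φ t x)) g) h
  · have hS' : ContMDiff (𝓘(ℝ, ℝ).prod J) (𝓘(ℝ, ℝ).prod J) ∞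
        (fun p : ℝ × N => (p.1 + 0, S p.2)) :=
      (contMDiff_fst.add contMDiff_const).prodMk (S.contMDiff.comp contMDiff_snd)
    have h1 := IsMIntegralCurveOn.map ((hΦX (0, x)).isMIntegralCurveOn univ) hS'
      (mfderiv_prodMap_spacetimeField S.contMDiff (fun t x => by rw [add_zero]) hS)
    have h2 := huniq (hΦX (0, S x)) (isMIntegralCurve_iff_isMIntegralCurveOn.2 h1) (by
      simp only [Function.comp_apply, hΦ0, add_zero])
    exact congrArg Prod.snd (congrFun h2 t)

end TimeDependent

/-! ## The vector field on the total space given by a derivation -/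

section TotalField

variable {EB : Type*} [NormedAddCommGroup EB] [NormedSpace ℝ EB] [FiniteDimensional ℝ EB]
  {HB : Type*} [TopologicalSpace HB] {I : ModelWithCorners ℝ EB HB} [I.Boundaryless]
  {B : Type*} [TopologicalSpace B] [ChartedSpace HB B] [IsManifold I ∞ B] [T2Space B]
  {F : Type*} [NormedAddCommGroup F] [NormedSpace ℝ F] [FiniteDimensional ℝ F]
  {V : B → Type*} [TopologicalSpace (TotalSpace F V)]
  [∀ b, AddCommGroup (V b)] [∀ b, Module ℝ (V b)] [∀ b, TopologicalSpace (V b)]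
  [FiberBundle F V] [VectorBundle ℝ F V] [ContMDiffVectorBundle ∞ F V I]

theorem dirDeriv_sum_mul {n : ℕ} {f g : Fin n → B → ℝ} {b : B}
    (hf : ∀ i, ContMDiff I 𝓘(ℝ, ℝ) ∞ (f i)) (hg : ∀ i, ContMDiff I 𝓘(ℝ, ℝ) ∞ (g i))
    (X : TangentSpace I b) : dirDeriv X (fun y => ∑ i, f i y * g i y) =
      ∑ i, (dirDeriv X (f i) * g i b + f i b * dirDeriv X (g i)) := by
  have h1 : ∀ {f : B → ℝ}, ContMDiff I 𝓘(ℝ, ℝ) ∞ f →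
      HasMFDerivAt I 𝓘(ℝ, ℝ) f b (mfderiv I 𝓘(ℝ, ℝ) f b) := fun h =>
    (h.mdifferentiable (by simp) b).hasMFDerivAt
  have h2 := HasMFDerivAt.sum (t := Finset.univ) fun i _ => (h1 (hf i)).mul (h1 (hg i))
  have h3 : (∑ i, f i * g i) = fun y => ∑ i, f i y * g i y := by
    funext y
    simp
  rw [h3] at h2
  let A : Fin n → EB →L[ℝ] ℝ := fun i => mfderiv I 𝓘(ℝ, ℝ) (f i) b
  let C : Fin n → EB →L[ℝ] ℝ := fun i => mfderiv I 𝓘(ℝ, ℝ) (g i) b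
  refine (DFunLike.congr_fun h2.mfderiv X).trans ?_
  refine (sum_apply (F := EB →L[ℝ] ℝ) (s := Finset.univ)
    (f := fun i => f i b • C i + g i b • A i) (x := (X : EB))).trans ?_
  refine Finset.sum_congr rfl fun i _ => ?_
  change f i b * C i X + g i b * A i X = A i X * g i b + f i b * C i X
  ring

theorem dirDeriv_congr {b : B} {f g : B → ℝ} (h : f =ᶠ[𝓝 b] g) (X : TangentSpace I b) :
    dirDeriv X f = dirDeriv X g := by
  unfold dirDeriv
  exact DFunLike.congr_fun h.mfderiv_eq X

/-- The expression X(L∘s) − L(Ds), the dual derivation applied to L, is linear over functions in s: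
the derivatives of the coefficients l i ∘ s cancel. So it depends only on the value of s at b and
defines a function on the fibre. -/
theorem IsDerivation.dual_eq_sum {D : Sec I F V →ₗ[ℝ] Sec I F V} {X : ∀ b : B, TangentSpace I b}
    (hD : IsDerivation D X) {n : ℕ} {e : Fin n → Sec I F V} {l : Fin n → FibreLin I F V} {b : B}
    (h : ∀ᶠ y in 𝓝 b, ∀ v : V y, v = ∑ i, l i ⟨y, v⟩ • e i y) (L : FibreLin I F V)
    (s : Sec I F V) : dirDeriv (X b) (L.compSec s) - L ⟨b, D s b⟩ =
      ∑ i, l i ⟨b, s b⟩ * (dirDeriv (X b) (L.compSec (e i)) - L ⟨b, D (e i) b⟩) := by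
  have h1 : (L.compSec s : B → ℝ) =ᶠ[𝓝 b]
      fun y => ∑ i, (l i).compSec s y * L.compSec (e i) y := by
    filter_upwards [h] with y hy
    have h2 : L.at y (s y) = L.at y (∑ i, l i ⟨y, s y⟩ • e i y) := congrArg (L.at y) (hy (s y))
    rw [map_sum] at h2
    refine h2.trans (Finset.sum_congr rfl fun i _ => ?_)
    exact (L.at y).map_smul _ _
  have h2 : L ⟨b, D s b⟩ = ∑ i, (dirDeriv (X b) ((l i).compSec s) * L ⟨b, e i b⟩ +
      l i ⟨b, s b⟩ * L ⟨b, D (e i) b⟩) := by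
    have h3 := congrArg (L.at b) (hD.eq_sum h s)
    simp only [map_sum, map_add, map_smul, smul_eq_mul] at h3
    exact h3
  rw [dirDeriv_congr h1, dirDeriv_sum_mul (fun i => ((l i).compSec s).contMDiff)
    (fun i => (L.compSec (e i)).contMDiff), h2, ← Finset.sum_sub_distrib]
  refine Finset.sum_congr rfl fun i _ => ?_
  simp only [FibreLin.compSec_apply]
  ring

/-- The tangent vector to the total space given by a derivation of the module of sections. -/
theorem IsDerivation.exists_tangent {D : Sec I F V →ₗ[ℝ] Sec I F V}
    {X : ∀ b : B, TangentSpace I b} (hD : IsDerivation D X) (w : TotalSpace F V) :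
    ∃ Y : TangentSpace (I.prod 𝓘(ℝ, F)) w,
      (∀ f : C^∞⟮I, B; ℝ⟯, dirDeriv Y (fun v => f v.proj) = dirDeriv (X w.proj) f) ∧
      ∀ (L : FibreLin I F V) (s : Sec I F V), s w.proj = w.2 →
        dirDeriv Y L = dirDeriv (X w.proj) (L.compSec s) - L ⟨w.proj, D s w.proj⟩ := by
  obtain ⟨b, v⟩ := w
  obtain ⟨s, rfl⟩ := exists_sec_eq I F v
  have hs : MDifferentiableAt I (I.prod 𝓘(ℝ, F))
      (fun y => (⟨y, s y⟩ : TotalSpace F V)) b := s.contMDiff.mdifferentiable (by simp) b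
  let u : ℝ → TotalSpace F V := fun r => ⟨b, s b + r • D s b⟩
  have hu : ContMDiff 𝓘(ℝ, ℝ) (I.prod 𝓘(ℝ, F)) ∞ u := by
    have h1 : SmoothFam 𝓘(ℝ, ℝ) fun r : ℝ => s + r • D s :=
      (smoothFam_const s).add (SmoothFam.smul contMDiff_id (smoothFam_const (D s)))
    exact ContMDiff.comp (g := fun p : ℝ × B => (⟨p.2, (s + p.1 • D s) p.2⟩ : TotalSpace F V))
      (f := fun r : ℝ => (r, b)) h1 (contMDiff_id.prodMk contMDiff_const)
  have hu0 : u 0 = ⟨b, s b⟩ := by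
    change (⟨b, s b + (0 : ℝ) • D s b⟩ : TotalSpace F V) = _
    rw [zero_smul, add_zero]
  -- The vector sought is the lift of X along the section s minus the vertical vector D s; in the
  -- horizontal part differentiation of L gives X(L∘s), in the vertical part L(Ds).
  let Y₁ : TangentSpace (I.prod 𝓘(ℝ, F)) (⟨b, s b⟩ : TotalSpace F V) :=
    mfderiv I (I.prod 𝓘(ℝ, F)) (fun y => (⟨y, s y⟩ : TotalSpace F V)) b (X b)
  let Y₂ : TangentSpace (I.prod 𝓘(ℝ, F)) (⟨b, s b⟩ : TotalSpace F V) :=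
    ((mfderiv 𝓘(ℝ, ℝ) (I.prod 𝓘(ℝ, F)) u 0 : ℝ →L[ℝ] EB × F) 1 : EB × F)
  have hY₁ : ∀ {g : TotalSpace F V → ℝ}, ContMDiff (I.prod 𝓘(ℝ, F)) 𝓘(ℝ, ℝ) ∞ g →
      dirDeriv Y₁ g = dirDeriv (X b) fun y => g ⟨y, s y⟩ := fun hg =>
    dirDeriv_mfderiv (hg.mdifferentiable (by simp) _) hs (X b)
  have hY₂ : ∀ {g : TotalSpace F V → ℝ} {a : ℝ}, ContMDiff (I.prod 𝓘(ℝ, F)) 𝓘(ℝ, ℝ) ∞ g →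
      HasDerivAt (fun r => g (u r)) a 0 → dirDeriv Y₂ g = a := fun hg h =>
    (dirDeriv_comp_deriv hu0 rfl (hu.mdifferentiable (by simp) 0)
      (hg.mdifferentiable (by simp) _)).unique h
  refine ⟨Y₁ - Y₂, fun f => ?_, fun L s' hs' => ?_⟩
  · have hf : ContMDiff (I.prod 𝓘(ℝ, F)) 𝓘(ℝ, ℝ) ∞ fun v : TotalSpace F V => f v.proj :=
      f.contMDiff.comp (Bundle.contMDiff_proj V)
    rw [dirDeriv_sub, hY₁ hf, hY₂ hf (hasDerivAt_const 0 (f b)), sub_zero]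
  · have h1 : HasDerivAt (fun r => L (u r)) (L ⟨b, D s b⟩) 0 := by
      have h2 : (fun r => L (u r)) = fun r => L ⟨b, s b⟩ + r * L ⟨b, D s b⟩ := funext fun r => by
        refine ((L.linear b).map_add _ _).trans (congrArg _ ((L.linear b).map_smul _ _))
      rw [h2]
      simpa using ((hasDerivAt_id (0 : ℝ)).mul_const (L ⟨b, D s b⟩)).const_add (L ⟨b, s b⟩)
    rw [dirDeriv_sub, hY₁ L.smooth, hY₂ L.smooth h1]
    obtain ⟨e, l, hl⟩ := exists_frame I F V b
    have h3 := hD.dual_eq_sum (hl.mono fun y hy v => (hy v).1) L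
    refine (h3 s).trans (Eq.trans ?_ (h3 s').symm)
    have h4 : s' b = s b := hs'
    rw [h4]

/-- A smooth time-dependent derivation of the module of sections gives a smooth time-dependent
vector field on the total space. -/
theorem exists_totalField {D : ℝ → Sec I F V →ₗ[ℝ] Sec I F V}
    {X : ∀ (_ : ℝ) (b : B), TangentSpace I b} (hD : ∀ t, IsDerivation (D t) (X t))
    (hDs : ∀ s, SmoothFam 𝓘(ℝ, ℝ) fun t => D t s)
    (hX : ContMDiff (𝓘(ℝ, ℝ).prod I) I.tangent ∞
      fun p : ℝ × B => (⟨p.2, X p.1 p.2⟩ : TangentBundle I B)) :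
    ∃ Y : ∀ (_ : ℝ) (w : TotalSpace F V), TangentSpace (I.prod 𝓘(ℝ, F)) w,
      (ContMDiff (𝓘(ℝ, ℝ).prod (I.prod 𝓘(ℝ, F))) (I.prod 𝓘(ℝ, F)).tangent ∞
        fun p : ℝ × TotalSpace F V =>
          (⟨p.2, Y p.1 p.2⟩ : TangentBundle (I.prod 𝓘(ℝ, F)) (TotalSpace F V))) ∧
      (∀ t w (f : C^∞⟮I, B; ℝ⟯),
        dirDeriv (Y t w) (fun v => f v.proj) = dirDeriv (X t w.proj) f) ∧
      ∀ t w (L : FibreLin I F V) (s : Sec I F V), s w.proj = w.2 →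
        dirDeriv (Y t w) L = dirDeriv (X t w.proj) (L.compSec s) - L ⟨w.proj, D t s w.proj⟩ := by
  choose Y hY₁ hY₂ using fun t w => (hD t).exists_tangent w
  refine ⟨Y, (isCoordFamily_totalSpace I F V).contMDiff_tangent contMDiff_snd ?_, hY₁, hY₂⟩
  have hp : ContMDiff (𝓘(ℝ, ℝ).prod (I.prod 𝓘(ℝ, F))) (𝓘(ℝ, ℝ).prod I) ∞
      fun p : ℝ × TotalSpace F V => (p.1, p.2.proj) :=
    contMDiff_fst.prodMk ((Bundle.contMDiff_proj V).comp contMDiff_snd)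
  have hX' : ∀ f : C^∞⟮I, B; ℝ⟯, ContMDiff (𝓘(ℝ, ℝ).prod I) 𝓘(ℝ, ℝ) ∞
      fun p : ℝ × B => dirDeriv (X p.1 p.2) f := fun f =>
    contMDiff_dirDeriv (f := fun (_ : ℝ × B) => f) (f.contMDiff.comp contMDiff_snd) hX
  rintro _ (⟨f, rfl⟩ | ⟨L, rfl⟩)
  · exact ((hX' f).comp hp).congr fun p => hY₁ p.1 p.2 f
  · rintro ⟨t₀, w₀⟩
    obtain ⟨e, l, hl⟩ := exists_frame I F V w₀.proj
    have h1 : ContMDiff (𝓘(ℝ, ℝ).prod (I.prod 𝓘(ℝ, F))) 𝓘(ℝ, ℝ) ∞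
        fun p : ℝ × TotalSpace F V => ∑ i, l i p.2 *
          (dirDeriv (X p.1 p.2.proj) (L.compSec (e i)) - L ⟨p.2.proj, D p.1 (e i) p.2.proj⟩) :=
      ContMDiff.sum fun i _ => ((l i).smooth.comp contMDiff_snd).mul
        (((hX' (L.compSec (e i))).comp hp).sub ((smoothFam_iff.1 (hDs (e i)) L).comp hp))
    refine (h1 (t₀, w₀)).congr_of_eventuallyEq ?_
    have hl' : ∀ᶠ b in 𝓝 w₀.proj, ∀ᶠ y in 𝓝 b, ∀ v : V y, v = ∑ i, l i ⟨y, v⟩ • e i y :=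
      eventually_eventually_nhds.2 (hl.mono fun y hy v => (hy v).1)
    have hc : ContinuousAt (fun p : ℝ × TotalSpace F V => p.2.proj) (t₀, w₀) :=
      ((FiberBundle.continuous_proj F V).comp continuous_snd).continuousAt
    filter_upwards [hc.eventually hl'] with p hp
    obtain ⟨s, hs⟩ := exists_sec_eq I F p.2.2
    rw [hY₂ p.1 p.2 L s hs, (hD p.1).dual_eq_sum hp L s, hs]

/-- Apply the commutation of σ^* with D to f s and compare Leibniz rules: the terms with Ds cancel,
and a section whose pull-back is nonzero at b leaves the equality of the symbol terms. -/
theorem IsDerivation.dirDeriv_pullFun [Nontrivial F] {D : Sec I F V →ₗ[ℝ] Sec I F V}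
    {X : ∀ b : B, TangentSpace I b} (hD : IsDerivation D X) {σ : VBAut I F V}
    (hσ : ∀ s, σ.pullSec (D s) = D (σ.pullSec s)) (b : B) (f : C^∞⟮I, B; ℝ⟯) :
    dirDeriv (X b) (σ.pullFun f) = dirDeriv (X (σ.base b)) f := by
  obtain ⟨v, hv⟩ : ∃ v : V b, v ≠ 0 := by
    obtain ⟨A⟩ := exists_linearEquiv_fibre (F := F) V b
    have := A.toEquiv.nontrivial
    exact exists_ne 0
  obtain ⟨u, rfl⟩ := exists_sec_eq I F v
  obtain ⟨s, rfl⟩ : ∃ s, σ.pullSec s = u := ⟨_, σ.pullSec_symm_pullSec u⟩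
  obtain ⟨l, -, hl⟩ := σ.exists_fibre b
  have h1 := congrArg (fun w : Sec I F V => w b) (hσ (fsmul f s))
  simp only [σ.pullSec_fsmul] at h1
  rw [hD, hl, hD, map_add, map_smul, map_smul, ← hl, ← hl, hσ s, σ.pullFun_apply] at h1
  have h2 := add_right_cancel h1
  exact (smul_left_injective ℝ hv h2).symm

/-- Automorphisms that commute with a derivation preserve its vector field on the total space. -/
theorem mfderiv_totalField [Nontrivial F] {D : Sec I F V →ₗ[ℝ] Sec I F V}
    {X : ∀ b : B, TangentSpace I b} (hD : IsDerivation D X)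
    {Y : ∀ w : TotalSpace F V, TangentSpace (I.prod 𝓘(ℝ, F)) w}
    (hY₁ : ∀ w (f : C^∞⟮I, B; ℝ⟯), dirDeriv (Y w) (fun v => f v.proj) = dirDeriv (X w.proj) f)
    (hY₂ : ∀ w (L : FibreLin I F V) (s : Sec I F V), s w.proj = w.2 →
      dirDeriv (Y w) L = dirDeriv (X w.proj) (L.compSec s) - L ⟨w.proj, D s w.proj⟩)
    {σ : VBAut I F V} (hσ : ∀ s, σ.pullSec (D s) = D (σ.pullSec s)) (w : TotalSpace F V) :
    mfderiv (I.prod 𝓘(ℝ, F)) (I.prod 𝓘(ℝ, F)) σ.total w (Y w) = Y (σ.total w) := by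
  have hco := isCoordFamily_totalSpace I F V
  have hXσ := hD.dirDeriv_pullFun hσ
  refine hco.tangent_ext fun g hg => ?_
  have hσs : ContMDiff (I.prod 𝓘(ℝ, F)) (I.prod 𝓘(ℝ, F)) ∞ σ.total := σ.total.contMDiff
  refine (dirDeriv_mfderiv ((hco.smooth g hg).mdifferentiable (by simp) _)
    (hσs.mdifferentiable (by simp) w) _).trans ?_
  obtain ⟨b, v⟩ := w
  obtain ⟨s, rfl⟩ := exists_sec_eq I F v
  obtain ⟨s', rfl⟩ : ∃ s', σ.pullSec s' = s := ⟨_, σ.pullSec_symm_pullSec s⟩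
  have hw : σ.total ⟨b, σ.pullSec s' b⟩ = ⟨σ.base b, s' (σ.base b)⟩ := σ.total_pullSec s' b
  refine Eq.trans ?_ (congrArg (fun w => dirDeriv (Y w) g) hw).symm
  obtain ⟨f, rfl⟩ | ⟨L, rfl⟩ := hg
  · refine Eq.trans ?_ (hY₁ _ f).symm
    refine Eq.trans ?_ (hXσ b f)
    refine Eq.trans ?_ (hY₁ ⟨b, σ.pullSec s' b⟩ (σ.pullFun f))
    refine congrArg (dirDeriv _) (funext fun y => ?_)
    exact congrArg f (σ.linear.proj y)
  · refine Eq.trans ?_ (hY₂ _ L s' rfl).symm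
    refine (hY₂ ⟨b, σ.pullSec s' b⟩ (L.comp hσs σ.linear) (σ.pullSec s') rfl).trans ?_
    refine congrArg₂ (· - ·) ?_ ?_
    · refine Eq.trans ?_ (hXσ b (L.compSec s'))
      refine congrArg (dirDeriv _) (funext fun y => ?_)
      exact congrArg L (σ.total_pullSec s' y)
    · change L (σ.total ⟨b, D (σ.pullSec s') b⟩) = _
      rw [← hσ, σ.total_pullSec]

/-- The multiplication by a nonzero scalar, as an automorphism. -/
def scaleAut (I : ModelWithCorners ℝ EB HB) (F : Type*) [NormedAddCommGroup F] [NormedSpace ℝ F]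
    (V : B → Type*) [TopologicalSpace (TotalSpace F V)]
    [∀ b, AddCommGroup (V b)] [∀ b, Module ℝ (V b)] [∀ b, TopologicalSpace (V b)]
    [FiberBundle F V] [VectorBundle ℝ F V] [ContMDiffVectorBundle ∞ F V I]
    (r : ℝ) (hr : r ≠ 0) : VBAut I F V where
  total := scaleDiffeo r hr
  base := Diffeomorph.refl I B ∞
  linear :=
    { proj := fun _ => rfl
      add := fun _ _ _ h => h.scale r
      smul := fun c x => by
        change scale r (scale c x) = scale c (scale r x)
        rw [scale_scale, scale_scale, mul_comm] }

theorem scaleAut_pullSec (r : ℝ) (hr : r ≠ 0) (s : Sec I F V) :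
    (scaleAut I F V r hr).pullSec s = r⁻¹ • s := by
  refine sec_ext_total fun b => ?_
  rw [VBAut.mk_pullSec]
  rfl

/-- A diffeomorphism of the total space which commutes with the multiplications by positive scalars
is an automorphism. -/
def VBAut.ofHomogeneous (Φ : Diffeomorph (I.prod 𝓘(ℝ, F)) (I.prod 𝓘(ℝ, F)) (TotalSpace F V)
    (TotalSpace F V) ∞) (h : ∀ r : ℝ, 0 < r → ∀ x, Φ (scale r x) = scale r (Φ x)) :
    VBAut I F V where
  total := Φ
  base :=
    { toFun := fun b => (Φ ⟨b, 0⟩).proj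
      invFun := fun b => (Φ.symm ⟨b, 0⟩).proj
      left_inv := fun b => by
        change (Φ.symm ⟨(Φ ⟨b, 0⟩).proj, 0⟩).proj = b
        have h1 := (isFiberwiseLinear_of_homogeneous Φ.contMDiff h).map_zero b
        rw [← h1, Φ.symm_apply_apply]
      right_inv := fun b => by
        have h2 : ∀ r : ℝ, 0 < r → ∀ x, Φ.symm (scale r x) = scale r (Φ.symm x) :=
          fun r hr x => Φ.injective (by
            change Φ _ = Φ _
            rw [h r hr, Φ.apply_symm_apply, Φ.apply_symm_apply])
        change (Φ ⟨(Φ.symm ⟨b, 0⟩).proj, 0⟩).proj = b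
        have h1 := (isFiberwiseLinear_of_homogeneous Φ.symm.contMDiff h2).map_zero b
        rw [← h1, Φ.apply_symm_apply]
      contMDiff_toFun := (Bundle.contMDiff_proj V).comp
        (Φ.contMDiff.comp (Bundle.contMDiff_zeroSection ℝ V))
      contMDiff_invFun := (Bundle.contMDiff_proj V).comp
        (Φ.symm.contMDiff.comp (Bundle.contMDiff_zeroSection ℝ V)) }
  linear := isFiberwiseLinear_of_homogeneous Φ.contMDiff h

/-- The flow of the vector field of a derivation acts on sections with this derivation as its
generator. -/
theorem SmoothAutPath.fibDeriv_of_flow {ψ : ℝ → VBAut I F V} (h : SmoothAutPath ψ)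
    {D : Sec I F V →ₗ[ℝ] Sec I F V} {X : ∀ b : B, TangentSpace I b}
    {Y : ∀ w : TotalSpace F V, TangentSpace (I.prod 𝓘(ℝ, F)) w}
    (hY₁ : ∀ w (f : C^∞⟮I, B; ℝ⟯), dirDeriv (Y w) (fun v => f v.proj) = dirDeriv (X w.proj) f)
    (hY₂ : ∀ w (L : FibreLin I F V) (s : Sec I F V), s w.proj = w.2 →
      dirDeriv (Y w) L = dirDeriv (X w.proj) (L.compSec s) - L ⟨w.proj, D s w.proj⟩) {t : ℝ}
    (hflow : ∀ g : TotalSpace F V → ℝ, ContMDiff (I.prod 𝓘(ℝ, F)) 𝓘(ℝ, ℝ) ∞ g → ∀ w,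
      HasDerivAt (fun τ => g ((ψ τ).total w)) (dirDeriv (Y ((ψ t).total w)) g) t)
    (s : Sec I F V) (b : B) :
    FibDeriv (fun τ => (ψ τ).pullSec s b) ((ψ t).pullSec (D s) b) t := by
  have hs := h.pullSec (contMDiff_id (I := 𝓘(ℝ, ℝ))) (smoothFam_const s)
  obtain ⟨s', -, hs'⟩ := hs.exists_deriv
  refine (hs' t b).congr_deriv ?_
  have hw : (ψ t).total ⟨b, (ψ t).pullSec s b⟩ = ⟨(ψ t).base b, s ((ψ t).base b)⟩ :=
    (ψ t).total_pullSec s b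
  have key : (ψ t).total ⟨b, s' t b⟩ = ⟨(ψ t).base b, D s ((ψ t).base b)⟩ := by
    refine total_ext I ((ψ t).linear.proj _) fun L => ?_
    have h1 := hflow L L.smooth ⟨b, (ψ t).pullSec s b⟩
    have h2 : HasDerivAt (fun τ => L ((ψ t).total ⟨b, (ψ τ).pullSec s b⟩))
        (L ((ψ t).total ⟨b, s' t b⟩)) t :=
      hs' t b ((L.comp (ψ t).total.contMDiff (ψ t).linear).at b)
    have h0 : ContMDiff (𝓘(ℝ, ℝ).prod 𝓘(ℝ, ℝ)) 𝓘(ℝ, ℝ) ∞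
        fun p : ℝ × ℝ => L ((ψ p.1).total ⟨b, (ψ p.2).pullSec s b⟩) := by
      refine L.smooth.comp (ContMDiff.comp (g := fun p : ℝ × TotalSpace F V => (ψ p.1).total p.2)
        (f := fun p : ℝ × ℝ => (p.1, (⟨b, (ψ p.2).pullSec s b⟩ : TotalSpace F V))) h
        (contMDiff_fst.prodMk ?_))
      exact ContMDiff.comp (g := fun p : ℝ × B => (⟨p.2, (ψ p.1).pullSec s p.2⟩ : TotalSpace F V))
        (f := fun p : ℝ × ℝ => (p.2, b)) hs (contMDiff_snd.prodMk contMDiff_const)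
    have h0' : DifferentiableAt ℝ
        (fun p : ℝ × ℝ => L ((ψ p.1).total ⟨b, (ψ p.2).pullSec s b⟩)) (t, t) := by
      rw [← modelWithCornersSelf_prod, chartedSpaceSelf_prod] at h0
      exact (contMDiff_iff_contDiff.1 h0).differentiable (by simp) _
    -- The function L(ψ_τ((ψ_τ^* s)(b))) equals (L∘s)(ψ_τ(b)). Its derivative is Y(L) + L(ψ_t s') by
    -- the product rule and X(L∘s) along the base flow; since Y(L) = X(L∘s) − L(Ds), this gives
    -- L(ψ_t s') = L(Ds).
    have h3 := hasDerivAt_diag h0' h1 h2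
    have h4 : (fun τ => L ((ψ τ).total ⟨b, (ψ τ).pullSec s b⟩)) =
        fun τ => L.compSec s ((ψ τ).total ⟨b, (ψ t).pullSec s b⟩).proj := funext fun τ =>
      (congrArg L ((ψ τ).total_pullSec s b)).trans
        (congrArg (L.compSec s) ((ψ τ).linear.proj ⟨b, (ψ t).pullSec s b⟩).symm)
    have h5 := hflow (fun v => L.compSec s v.proj)
      ((L.compSec s).contMDiff.comp (Bundle.contMDiff_proj V)) ⟨b, (ψ t).pullSec s b⟩
    have h7 := (h3.congr_of_eventuallyEq
      (Eventually.of_forall fun τ => (congrFun h4 τ).symm)).unique h5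
    rw [hw] at h7
    have h6 := hY₂ ⟨(ψ t).base b, s ((ψ t).base b)⟩ L s rfl
    have h8 := hY₁ ⟨(ψ t).base b, s ((ψ t).base b)⟩ (L.compSec s)
    rw [h6, h8] at h7
    linarith
  have h9 := (ψ t).total_pullSec (D s) b
  exact TotalSpace.mk_injective b ((ψ t).total.injective (key.trans h9.symm))

end TotalField

/-! ## Brackets that are transported by a flow -/

section Transport

variable {EB : Type*} [NormedAddCommGroup EB] [NormedSpace ℝ EB] [FiniteDimensional ℝ EB]
  {HB : Type*} [TopologicalSpace HB] {I : ModelWithCorners ℝ EB HB} [I.Boundaryless]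
  {B : Type*} [TopologicalSpace B] [ChartedSpace HB B] [IsManifold I ∞ B] [T2Space B]
  {F : Type*} [NormedAddCommGroup F] [NormedSpace ℝ F] [FiniteDimensional ℝ F]
  {V : B → Type*} [TopologicalSpace (TotalSpace F V)]
  [∀ b, AddCommGroup (V b)] [∀ b, Module ℝ (V b)] [∀ b, TopologicalSpace (V b)]
  [FiberBundle F V] [VectorBundle ℝ F V] [ContMDiffVectorBundle ∞ F V I]
  {EQ : Type*} [NormedAddCommGroup EQ] [NormedSpace ℝ EQ]
  {HQ : Type*} [TopologicalSpace HQ] {JQ : ModelWithCorners ℝ EQ HQ}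
  {Q : Type*} [TopologicalSpace Q] [ChartedSpace HQ Q] [IsManifold JQ ∞ Q]

/-- The two slots vary in turn, as for a single bracket. Joint smoothness of the symbols in the
parameter is not assumed: `contMDiff_symbol` recovers it from the smoothness of the values. -/
theorem SmoothFam.bider [Nontrivial F] {β : ℝ → Sec I F V →ₗ[ℝ] Sec I F V →ₗ[ℝ] Sec I F V}
    {σ : ∀ (_ : ℝ) (b : B), V b →ₗ[ℝ] TangentSpace I b} (hβ : ∀ t, IsBider (β t) (σ t))
    (hswap : ∀ t s u, β t s u = -β t u s) (hβs : ∀ s u, SmoothFam 𝓘(ℝ, ℝ) fun t => β t s u)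
    {g : Q → ℝ} (hg : ContMDiff JQ 𝓘(ℝ, ℝ) ∞ g) {s u : Q → Sec I F V} (hs : SmoothFam JQ s)
    (hu : SmoothFam JQ u) : SmoothFam JQ fun q => β (g q) (s q) (u q) := by
  have h0 : ∀ s u, SmoothFam JQ fun q => β (g q) s u := fun s u => (hβs s u).comp hg
  have h1 : ∀ s, SmoothFam JQ fun q => β (g q) s (u q) := fun s =>
    SmoothFam.derivation (fun q => (hβ (g q)).deriv s) (h0 s)
      (contMDiff_symbol (fun q => (hβ (g q)).deriv s) (h0 s)) hu
  have h2 : ∀ s, SmoothFam JQ fun q => β (g q) (u q) s := fun s => by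
    simpa only [← hswap] using (h1 s).neg
  have h3 : SmoothFam JQ fun q => β (g q) (u q) (s q) :=
    SmoothFam.derivation (fun q => (hβ (g q)).deriv (u q)) h2
      (contMDiff_symbol (fun q => (hβ (g q)).deriv (u q)) h2) hs
  simpa only [← hswap] using h3.neg

/-- The product rule with bracket and both entries moving: first the diagonal of the two entries
with the bracket frozen at t, then the diagonal of bracket time and entry time. -/
theorem FibDeriv.bider [Nontrivial F] {β : ℝ → Sec I F V →ₗ[ℝ] Sec I F V →ₗ[ℝ] Sec I F V}
    {σ : ∀ (_ : ℝ) (b : B), V b →ₗ[ℝ] TangentSpace I b} (hβ : ∀ t, IsBider (β t) (σ t))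
    (hswap : ∀ t s u, β t s u = -β t u s) (hβs : ∀ s u, SmoothFam 𝓘(ℝ, ℝ) fun t => β t s u)
    {s u : ℝ → Sec I F V} (hs : SmoothFam 𝓘(ℝ, ℝ) s) (hu : SmoothFam 𝓘(ℝ, ℝ) u) {t : ℝ}
    {s' u' w : Sec I F V} (hs' : ∀ b, FibDeriv (fun τ => s τ b) (s' b) t)
    (hu' : ∀ b, FibDeriv (fun τ => u τ b) (u' b) t) {b : B}
    (hw : FibDeriv (fun τ => β τ (s t) (u t) b) (w b) t) :
    FibDeriv (fun τ => β τ (s τ) (u τ) b) ((w + (β t s' (u t) + β t (s t) u')) b) t := by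
  have e1 : ContMDiff (𝓘(ℝ, ℝ).prod 𝓘(ℝ, ℝ)) 𝓘(ℝ, ℝ) ∞ fun p : ℝ × ℝ => p.1 := contMDiff_fst
  have e2 : ContMDiff (𝓘(ℝ, ℝ).prod 𝓘(ℝ, ℝ)) 𝓘(ℝ, ℝ) ∞ fun p : ℝ × ℝ => p.2 := contMDiff_snd
  have hc : ContMDiff (𝓘(ℝ, ℝ).prod 𝓘(ℝ, ℝ)) 𝓘(ℝ, ℝ) ∞ fun _ : ℝ × ℝ => t := contMDiff_const
  have hd : ∀ (c : Sec I F V) {v : ℝ → Sec I F V} {v' : Sec I F V}, SmoothFam 𝓘(ℝ, ℝ) v →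
      (∀ b, FibDeriv (fun τ => v τ b) (v' b) t) →
      FibDeriv (fun τ => β t c (v τ) b) (β t c v' b) t := fun c v v' hv hv' =>
    ((hβ t).deriv c).fibDeriv hv hv' b
  have h1 : FibDeriv (fun τ => β t (s τ) (u τ) b) (β t s' (u t) b + β t (s t) u' b) t := by
    refine fibDeriv_diag (u := fun p : ℝ × ℝ => β t (s p.1) (u p.2))
      (SmoothFam.bider hβ hswap hβs hc (hs.comp (g := fun p : ℝ × ℝ => p.1) e1)
        (hu.comp (g := fun p : ℝ × ℝ => p.2) e2)) ?_ (hd (s t) hu hu')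
    have h4 : ∀ v, β t v (u t) b = -β t (u t) v b := fun v =>
      congrArg (fun w : Sec I F V => w b) (hswap t v (u t))
    simpa only [h4] using (hd (u t) hs hs').neg
  exact fibDeriv_diag (u := fun p : ℝ × ℝ => β p.1 (s p.2) (u p.2))
    (SmoothFam.bider hβ hswap hβs e1 (hs.comp (g := fun p : ℝ × ℝ => p.2) e2)
      (hu.comp (g := fun p : ℝ × ℝ => p.2) e2)) hw h1

/-- A path of brackets that evolves by the generator of a path of automorphisms is transported by
these automorphisms. -/
theorem SmoothAutPath.pullBil_eq [Nontrivial F] {φ : ℝ → VBAut I F V} (h : SmoothAutPath φ)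
    {D : ℝ → Sec I F V →ₗ[ℝ] Sec I F V}
    (hD : ∀ s t b, FibDeriv (fun τ => (φ τ).pullSec s b) ((φ t).pullSec (D t s) b) t)
    {β : ℝ → Sec I F V →ₗ[ℝ] Sec I F V →ₗ[ℝ] Sec I F V}
    {σ : ∀ (_ : ℝ) (b : B), V b →ₗ[ℝ] TangentSpace I b} (hβ : ∀ t, IsBider (β t) (σ t))
    (hswap : ∀ t s u, β t s u = -β t u s) (hβs : ∀ s u, SmoothFam 𝓘(ℝ, ℝ) fun t => β t s u)
    (hβ' : ∀ s u t b, FibDeriv (fun τ => β τ s u b)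
      ((β t (D t s) u + β t s (D t u) - D t (β t s u)) b) t) (s u : Sec I F V) (t t' : ℝ) :
    (φ t).pullBil (β t) s u = (φ t').pullBil (β t') s u := by
  have hP : ∀ s, SmoothFam 𝓘(ℝ, ℝ) fun t => (φ t).symm.pullSec s := fun s =>
    h.symm.pullSec contMDiff_id (smoothFam_const s)
  -- Differentiating φ_t^*((φ_t⁻¹)^* s) = s shows that the inverse path has derivative −D_t
  -- (φ_t⁻¹)^* s.
  have hP' : ∀ s t b, FibDeriv (fun τ => (φ τ).symm.pullSec s b)
      ((-D t ((φ t).symm.pullSec s)) b) t := fun s t b => by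
    obtain ⟨s', -, hs'⟩ := (hP s).exists_deriv
    refine (hs' t b).congr_deriv (congrArg (fun v : Sec I F V => v b) ?_)
    refine eq_neg_of_add_eq_zero_right ((φ t).pullSec_injective ?_)
    ext y
    have h1 := h.fibDeriv_pullSec (hP s) (hs' t) (fun b => hD _ t b) y
    have h2 : (fun τ => (φ τ).pullSec ((φ τ).symm.pullSec s) y) = fun _ => s y :=
      funext fun τ => congrArg (fun v : Sec I F V => v y) ((φ τ).pullSec_symm_pullSec s)
    rw [h2] at h1
    refine (h1.unique (fibDeriv_const _ t)).trans ?_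
    exact congrArg (fun v : Sec I F V => v y) (φ t).pullSecL.map_zero.symm
  have hw : SmoothFam 𝓘(ℝ, ℝ) fun t => β t ((φ t).symm.pullSec s) ((φ t).symm.pullSec u) :=
    SmoothFam.bider hβ hswap hβs (g := fun t : ℝ => t) contMDiff_id (hP s) (hP u)
  ext b
  refine eq_of_fibDeriv_zero (u := fun t => (φ t).pullBil (β t) s u b) (fun t => ?_) t t'
  -- The moving entries cancel the first two terms of the evolution equation and leave −D_t of the
  -- bracket; the derivative of the outer φ_t^* adds the opposite term, so the total derivative is
  -- zero.
  have h1 : ∀ b, FibDeriv (fun τ => β τ ((φ τ).symm.pullSec s) ((φ τ).symm.pullSec u) b)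
      ((-D t (β t ((φ t).symm.pullSec s) ((φ t).symm.pullSec u))) b) t := fun b => by
    refine (FibDeriv.bider hβ hswap hβs (hP s) (hP u) (hP' s t) (hP' u t)
      (hβ' _ _ t b)).congr_deriv (congrArg (fun v : Sec I F V => v b) ?_)
    rw [map_neg, map_neg, LinearMap.neg_apply]
    abel
  refine (h.fibDeriv_pullSec hw h1 (fun b => hD _ t b) b).congr_deriv ?_
  rw [add_neg_cancel]
  exact congrArg (fun v : Sec I F V => v b) (φ t).pullSecL.map_zero

end Transport

/-! ## Isotopies of double vector bundles -/

section DVB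

variable {EM : Type*} [NormedAddCommGroup EM] [NormedSpace ℝ EM] [FiniteDimensional ℝ EM]
  {M : Type*} [TopologicalSpace M] [ChartedSpace EM M] [IsManifold 𝓘(ℝ, EM) ∞ M] [T2Space M]
  {FE : Type*} [NormedAddCommGroup FE] [NormedSpace ℝ FE] [FiniteDimensional ℝ FE]
  {E : M → Type*} [TopologicalSpace (TotalSpace FE E)]
  [∀ x, AddCommGroup (E x)] [∀ x, Module ℝ (E x)] [∀ x, TopologicalSpace (E x)]
  [FiberBundle FE E] [VectorBundle ℝ FE E] [ContMDiffVectorBundle ∞ FE E 𝓘(ℝ, EM)]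
  {FA : Type*} [NormedAddCommGroup FA] [NormedSpace ℝ FA] [FiniteDimensional ℝ FA]
  {A : M → Type*} [TopologicalSpace (TotalSpace FA A)]
  [∀ x, AddCommGroup (A x)] [∀ x, Module ℝ (A x)] [∀ x, TopologicalSpace (A x)]
  [FiberBundle FA A] [VectorBundle ℝ FA A] [ContMDiffVectorBundle ∞ FA A 𝓘(ℝ, EM)]
  {FV : Type*} [NormedAddCommGroup FV] [NormedSpace ℝ FV] [FiniteDimensional ℝ FV]
  {V : TotalSpace FE E → Type*} [TopologicalSpace (TotalSpace FV V)]
  [∀ e, AddCommGroup (V e)] [∀ e, Module ℝ (V e)] [∀ e, TopologicalSpace (V e)]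
  [FiberBundle FV V] [VectorBundle ℝ FV V]
  [ContMDiffVectorBundle ∞ FV V (𝓘(ℝ, EM).prod 𝓘(ℝ, FE))]
  {FU : Type*} [NormedAddCommGroup FU] [NormedSpace ℝ FU] [FiniteDimensional ℝ FU]
  {U : TotalSpace FA A → Type*} [TopologicalSpace (TotalSpace FU U)]
  [∀ a, AddCommGroup (U a)] [∀ a, Module ℝ (U a)] [∀ a, TopologicalSpace (U a)]
  [FiberBundle FU U] [VectorBundle ℝ FU U]
  [ContMDiffVectorBundle ∞ FU U (𝓘(ℝ, EM).prod 𝓘(ℝ, FA))]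
  (D : DoubleVectorBundle EM FE E FA A FV V FU U)

namespace DoubleVectorBundle

/-- A diffeomorphism of the total space of a double vector bundle that commutes with both
multiplications by positive scalars is an automorphism. -/
def DVBAut.ofHomogeneous (Φ : Diffeomorph ((𝓘(ℝ, EM).prod 𝓘(ℝ, FE)).prod 𝓘(ℝ, FV))
      ((𝓘(ℝ, EM).prod 𝓘(ℝ, FE)).prod 𝓘(ℝ, FV)) (TotalSpace FV V) (TotalSpace FV V) ∞)
    (h₁ : ∀ r : ℝ, 0 < r → ∀ w, Φ (scale r w) = scale r (Φ w))
    (h₂ : ∀ (r : ℝ) (hr : 0 < r) (w), Φ ((D.hom r hr.ne').total w) =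
      (D.hom r hr.ne').total (Φ w)) : D.DVBAut :=
  let onW := VBAut.ofHomogeneous Φ h₁
  let onU := VBAut.ofHomogeneous ((D.toA.symm.trans Φ).trans D.toA) fun r hr u => by
    change D.toA (Φ (D.toA.symm (scale r u))) = scale r (D.toA (Φ (D.toA.symm u)))
    have h := h₂ r hr (D.toA.symm u)
    rw [D.hom_apply, D.toA.apply_symm_apply] at h
    rw [h, D.toA_hom]
  { onW := onW
    -- The induced maps of E and A inherit homogeneity: h_r covers multiplication by r on E, and the
    -- scaling of W → E covers multiplication by r on A.
    onE := VBAut.ofHomogeneous onW.base fun r hr e => by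
      have h := congrArg TotalSpace.proj (h₂ r hr ⟨e, 0⟩)
      have e1 := onW.linear.proj ((D.hom r hr.ne').total ⟨e, 0⟩)
      have e2 := (D.hom r hr.ne').linear.proj ⟨e, 0⟩
      have e3 := (D.hom r hr.ne').linear.proj (Φ ⟨e, 0⟩)
      rw [e2] at e1
      exact e1.symm.trans (h.trans e3)
    onA := VBAut.ofHomogeneous onU.base fun r hr a => by
      have e1 : (D.toA (scale r (D.toA.symm ⟨a, 0⟩))).proj = scale r a := by
        refine (D.proj_linear.smul r (D.toA.symm ⟨a, 0⟩)).trans ?_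
        rw [D.toA.apply_symm_apply]
      have e2 := onU.linear.proj (D.toA (scale r (D.toA.symm ⟨a, 0⟩)))
      rw [e1] at e2
      refine e2.symm.trans ?_
      change (D.toA (Φ (D.toA.symm (D.toA (scale r (D.toA.symm ⟨a, 0⟩)))))).proj =
        scale r (D.toA (Φ (D.toA.symm ⟨a, 0⟩))).proj
      rw [D.toA.symm_apply_apply, h₁ r hr]
      exact D.proj_linear.smul r _
    base_onW := rfl
    base_onA := by
      refine Diffeomorph.ext fun m => ?_
      change (D.toA (Φ (D.toA.symm ⟨⟨m, 0⟩, 0⟩))).proj.proj = (Φ ⟨⟨m, 0⟩, 0⟩).proj.proj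
      rw [D.toA_proj_proj, ← D.toA_zero_zero, D.toA.symm_apply_apply]
    linear_toA := onU.linear }

end DoubleVectorBundle

end DVB

/-! ## Gauge equivalent deformations are equivalent -/

section DVB

variable {EM : Type*} [NormedAddCommGroup EM] [NormedSpace ℝ EM] [FiniteDimensional ℝ EM]
  {M : Type*} [TopologicalSpace M] [ChartedSpace EM M] [IsManifold 𝓘(ℝ, EM) ∞ M] [T2Space M]
  {FE : Type*} [NormedAddCommGroup FE] [NormedSpace ℝ FE] [FiniteDimensional ℝ FE]
  {E : M → Type*} [TopologicalSpace (TotalSpace FE E)]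
  [∀ x, AddCommGroup (E x)] [∀ x, Module ℝ (E x)] [∀ x, TopologicalSpace (E x)]
  [FiberBundle FE E] [VectorBundle ℝ FE E] [ContMDiffVectorBundle ∞ FE E 𝓘(ℝ, EM)]
  {FA : Type*} [NormedAddCommGroup FA] [NormedSpace ℝ FA] [FiniteDimensional ℝ FA]
  {A : M → Type*} [TopologicalSpace (TotalSpace FA A)]
  [∀ x, AddCommGroup (A x)] [∀ x, Module ℝ (A x)] [∀ x, TopologicalSpace (A x)]
  [FiberBundle FA A] [VectorBundle ℝ FA A] [ContMDiffVectorBundle ∞ FA A 𝓘(ℝ, EM)]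
  {FV : Type*} [NormedAddCommGroup FV] [NormedSpace ℝ FV] [FiniteDimensional ℝ FV]
  {V : TotalSpace FE E → Type*} [TopologicalSpace (TotalSpace FV V)]
  [∀ e, AddCommGroup (V e)] [∀ e, Module ℝ (V e)] [∀ e, TopologicalSpace (V e)]
  [FiberBundle FV V] [VectorBundle ℝ FV V]
  [ContMDiffVectorBundle ∞ FV V (𝓘(ℝ, EM).prod 𝓘(ℝ, FE))]
  {FU : Type*} [NormedAddCommGroup FU] [NormedSpace ℝ FU] [FiniteDimensional ℝ FU]
  {U : TotalSpace FA A → Type*} [TopologicalSpace (TotalSpace FU U)]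
  [∀ a, AddCommGroup (U a)] [∀ a, Module ℝ (U a)] [∀ a, TopologicalSpace (U a)]
  [FiberBundle FU U] [VectorBundle ℝ FU U]
  [ContMDiffVectorBundle ∞ FU U (𝓘(ℝ, EM).prod 𝓘(ℝ, FA))]
  (D : DoubleVectorBundle EM FE E FA A FV V FU U)

namespace DoubleVectorBundle

variable {D}

/-- A weight zero, periodic time-dependent derivation on a double vector bundle over a compact
manifold generates a path of automorphisms. -/
theorem exists_isotopy [Nontrivial FV] [CompactSpace M] {G : ℝ → D.Γ →ₗ[ℝ] D.Γ}
    {X : ∀ (_ : ℝ) (e : TotalSpace FE E), TangentSpace (𝓘(ℝ, EM).prod 𝓘(ℝ, FE)) e}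
    (hG : ∀ t, IsDerivation (G t) (X t)) (hGs : ∀ s, SmoothFam 𝓘(ℝ, ℝ) fun t => G t s)
    (hGper : Function.Periodic G 2) (hXper : Function.Periodic X 2)
    (hlin : ∀ t (r : ℝ) (hr : 0 < r) s,
      (D.hom r hr.ne').pullSec (G t s) = G t ((D.hom r hr.ne').pullSec s)) :
    ∃ φ : ℝ → D.DVBAut, SmoothAutPath (fun t => (φ t).onW) ∧ (∀ w, (φ 0).onW.total w = w) ∧
      ∀ s t e, FibDeriv (fun τ => (φ τ).onW.pullSec s e) ((φ t).onW.pullSec (G t s) e) t := by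
  obtain ⟨Y, hY, hY₁, hY₂⟩ := exists_totalField hG hGs (contMDiff_symbol hG hGs)
  have hhom : ∀ (r : ℝ) (hr : 0 < r) t w,
      mfderiv ((𝓘(ℝ, EM).prod 𝓘(ℝ, FE)).prod 𝓘(ℝ, FV)) ((𝓘(ℝ, EM).prod 𝓘(ℝ, FE)).prod 𝓘(ℝ, FV))
        (D.hom r hr.ne').total w (Y t w) = Y t ((D.hom r hr.ne').total w) := fun r hr t w =>
    mfderiv_totalField (hG t) (hY₁ t) (hY₂ t) (hlin t r hr) w
  have hscale : ∀ (r : ℝ) (hr : 0 < r) t w,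
      mfderiv ((𝓘(ℝ, EM).prod 𝓘(ℝ, FE)).prod 𝓘(ℝ, FV)) ((𝓘(ℝ, EM).prod 𝓘(ℝ, FE)).prod 𝓘(ℝ, FV))
        (scaleAut (𝓘(ℝ, EM).prod 𝓘(ℝ, FE)) FV V r hr.ne').total w (Y t w) =
      Y t ((scaleAut (𝓘(ℝ, EM).prod 𝓘(ℝ, FE)) FV V r hr.ne').total w) := fun r hr t w =>
    mfderiv_totalField (hG t) (hY₁ t) (hY₂ t) (fun s => by
      rw [scaleAut_pullSec, scaleAut_pullSec, map_smul]) w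
  have hYper : Function.Periodic Y 2 := fun t => by
    funext w
    refine (isCoordFamily_totalSpace (𝓘(ℝ, EM).prod 𝓘(ℝ, FE)) FV V).tangent_ext ?_
    rintro _ (⟨f, rfl⟩ | ⟨L, rfl⟩)
    · rw [hY₁, hY₁, hXper t]
    · obtain ⟨s, hs⟩ := exists_sec_eq (𝓘(ℝ, EM).prod 𝓘(ℝ, FE)) FV w.2
      rw [hY₂ _ w L s hs, hY₂ _ w L s hs, hXper t, hGper t]
  have hz : ContMDiff 𝓘(ℝ, EM) ((𝓘(ℝ, EM).prod 𝓘(ℝ, FE)).prod 𝓘(ℝ, FV)) ∞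
      fun m : M => (⟨⟨m, 0⟩, 0⟩ : TotalSpace FV V) :=
    (Bundle.contMDiff_zeroSection ℝ V).comp (Bundle.contMDiff_zeroSection ℝ E)
  -- The compact set is the double zero section, the image of M in W; this is where compactness of M
  -- enters.
  obtain ⟨Φ, hΦ, hΦ0, hΦd, hΦS⟩ := exists_timeDependentFlow hY hYper
    (K := range fun m : M => (⟨⟨m, 0⟩, 0⟩ : TotalSpace FV V))
    (isCompact_range hz.continuous) (by
    intro O hO hOo w
    have hc : Continuous fun r : ℝ => D.toA.symm (scale r (D.toA (scale r w))) := by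
      refine D.toA.symm.continuous.comp ?_
      refine (contMDiff_scale_prod (𝓘(ℝ, EM).prod 𝓘(ℝ, FA)) FU U).continuous.comp
        (continuous_id.prodMk (D.toA.continuous.comp ?_))
      exact (contMDiff_scale_left (𝓘(ℝ, EM).prod 𝓘(ℝ, FE)) w).continuous
    have h0 : D.toA.symm (scale 0 (D.toA (scale 0 w))) ∈ O := by
      rw [scale_zero_left, scale_zero_left, D.toA_zero_proj, ← D.toA_zero_zero,
        D.toA.symm_apply_apply]
      exact hO ⟨_, rfl⟩
    -- Scaling w by a small r > 0 in both structures moves it into O, as r = 0 gives a double zero.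
    -- The required symmetry is the inverse, both scalings by r⁻¹.
    obtain ⟨r, hrO, hr⟩ : ∃ r : ℝ, D.toA.symm (scale r (D.toA (scale r w))) ∈ O ∧ 0 < r :=
      (((hc.continuousAt.eventually_mem (hOo.mem_nhds h0)).filter_mono
        (nhdsWithin_le_nhds (s := Ioi 0))).and self_mem_nhdsWithin).exists
    refine ⟨(D.hom r⁻¹ (inv_pos.2 hr).ne').total.trans
      (scaleAut (𝓘(ℝ, EM).prod 𝓘(ℝ, FE)) FV V r⁻¹ (inv_pos.2 hr).ne').total, fun t x => ?_, _, hrO, ?_⟩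
    · have h1 := ((scaleAut (𝓘(ℝ, EM).prod 𝓘(ℝ, FE)) FV V r⁻¹ (inv_pos.2 hr).ne').total.contMDiff.mdifferentiable
        (by simp) ((D.hom r⁻¹ (inv_pos.2 hr).ne').total x))
      have h2 := ((D.hom r⁻¹ (inv_pos.2 hr).ne').total.contMDiff.mdifferentiable (by simp) x)
      refine (DFunLike.congr_fun (mfderiv_comp x h1 h2) (Y t x)).trans ?_
      refine Eq.trans ?_ (hscale r⁻¹ (inv_pos.2 hr) t _)
      exact congrArg _ (hhom r⁻¹ (inv_pos.2 hr) t x)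
    · change scale r⁻¹ (D.toA.symm (scale r⁻¹ (D.toA (D.toA.symm (scale r (D.toA (scale r w))))))) = w
      rw [D.toA.apply_symm_apply, scale_scale, inv_mul_cancel₀ hr.ne', scale_one,
        D.toA.symm_apply_apply, scale_scale, inv_mul_cancel₀ hr.ne', scale_one])
  have h₁ : ∀ t, ∀ r : ℝ, 0 < r → ∀ w, Φ t (scale r w) = scale r (Φ t w) := fun t r hr w =>
    hΦS _ (hscale r hr) t w
  have h₂ : ∀ t (r : ℝ) (hr : 0 < r) (w), Φ t ((D.hom r hr.ne').total w) =
      (D.hom r hr.ne').total (Φ t w) := fun t r hr w => hΦS _ (hhom r hr) t w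
  have hψ : SmoothAutPath fun t => (DVBAut.ofHomogeneous D (Φ t) (h₁ t) (h₂ t)).onW := hΦ
  exact ⟨fun t => DVBAut.ofHomogeneous D (Φ t) (h₁ t) (h₂ t), hψ, hΦ0, fun s t e =>
    hψ.fibDeriv_of_flow (hY₁ t) (hY₂ t) (fun g hg w => hΦd g hg t w) s e⟩

theorem SmoothPath.comp_cosRamp {n : ℕ} {c : ℝ → (Fin n → D.Γ) → D.Γ} (h : SmoothPath c)
    (s : Fin n → D.Γ) : SmoothFam 𝓘(ℝ, ℝ) fun t => c (cosRamp t) s := by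
  refine ContMDiffOn.comp_contMDiff
    (g := fun p : ℝ × TotalSpace FE E => (⟨p.2, c p.1 s p.2⟩ : TotalSpace FV V))
    (f := fun p : ℝ × TotalSpace FE E => (cosRamp p.1, p.2)) (h s) ?_ fun p =>
      ⟨cosRamp_mem p.1, mem_univ _⟩
  exact (contDiff_cosRamp.contMDiff.comp contMDiff_fst).prodMk contMDiff_snd

/-- The derivative within [0,1] suffices for the chain rule, endpoints included, since `cosRamp`
never leaves the interval. -/
theorem HasPathDeriv.comp_cosRamp {n : ℕ} {c c' : ℝ → (Fin n → D.Γ) → D.Γ}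
    (h : HasPathDeriv c c') (s : Fin n → D.Γ) (t : ℝ) (e : TotalSpace FE E) :
    FibDeriv (fun τ => c (cosRamp τ) s e) (deriv cosRamp t • c' (cosRamp t) s e) t := by
  rw [fibDeriv_iff_fibreLin (𝓘(ℝ, EM).prod 𝓘(ℝ, FE)) (F := FV)]
  intro L
  have hLc : Continuous (L.at e) :=
    L.smooth.continuous.comp (FiberBundle.totalSpaceMk_isInducing FV V e).continuous
  have h1 := (hLc.tendsto _).comp (h (cosRamp t) (cosRamp_mem t) s e)
  have h2 : HasDerivWithinAt (fun ε => L.at e (c ε s e)) (L.at e (c' (cosRamp t) s e)) (Icc 0 1)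
      (cosRamp t) := by
    rw [hasDerivWithinAt_iff_tendsto_slope]
    refine h1.congr fun ε => ?_
    rw [Function.comp_apply, slope_def_module, map_smul, map_sub]
  have h3 : HasDerivAt cosRamp (deriv cosRamp t) t :=
    (contDiff_cosRamp.differentiable (by simp) t).hasDerivAt
  have h4 := h2.comp_hasDerivAt t h3 (Eventually.of_forall cosRamp_mem)
  refine h4.congr_deriv ?_
  rw [mul_comm]
  exact ((L.at e).map_smul _ _).symm

theorem LinCochain.hom_pullSec (Δ : D.LinCochain 0) {r : ℝ} (hr : 0 < r) (s : D.Γ) :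
    (D.hom r hr.ne').pullSec (linOfAlt Δ.1 s) = linOfAlt Δ.1 ((D.hom r hr.ne').pullSec s) := by
  have h := congrFun (Δ.2.2 r hr) ![(D.hom r hr.ne').pullSec s]
  refine Eq.trans ?_ h
  refine congrArg (D.hom r hr.ne').pullSec (congrArg Δ.1 (funext fun i => ?_))
  fin_cases i
  exact ((D.hom r hr.ne').symm_pullSec_pullSec s).symm

end DoubleVectorBundle

end DVB

/-! ### From a gauge equivalence to an isotopy over compact M -/

section DVB

variable {EM : Type*} [NormedAddCommGroup EM] [NormedSpace ℝ EM] [FiniteDimensional ℝ EM]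
  {M : Type*} [TopologicalSpace M] [ChartedSpace EM M] [IsManifold 𝓘(ℝ, EM) ∞ M] [T2Space M]
  {FE : Type*} [NormedAddCommGroup FE] [NormedSpace ℝ FE] [FiniteDimensional ℝ FE]
  {E : M → Type*} [TopologicalSpace (TotalSpace FE E)]
  [∀ x, AddCommGroup (E x)] [∀ x, Module ℝ (E x)] [∀ x, TopologicalSpace (E x)]
  [FiberBundle FE E] [VectorBundle ℝ FE E] [ContMDiffVectorBundle ∞ FE E 𝓘(ℝ, EM)]
  {FA : Type*} [NormedAddCommGroup FA] [NormedSpace ℝ FA] [FiniteDimensional ℝ FA]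
  {A : M → Type*} [TopologicalSpace (TotalSpace FA A)]
  [∀ x, AddCommGroup (A x)] [∀ x, Module ℝ (A x)] [∀ x, TopologicalSpace (A x)]
  [FiberBundle FA A] [VectorBundle ℝ FA A] [ContMDiffVectorBundle ∞ FA A 𝓘(ℝ, EM)]
  {FV : Type*} [NormedAddCommGroup FV] [NormedSpace ℝ FV] [FiniteDimensional ℝ FV]
  {V : TotalSpace FE E → Type*} [TopologicalSpace (TotalSpace FV V)]
  [∀ e, AddCommGroup (V e)] [∀ e, Module ℝ (V e)] [∀ e, TopologicalSpace (V e)]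
  [FiberBundle FV V] [VectorBundle ℝ FV V]
  [ContMDiffVectorBundle ∞ FV V (𝓘(ℝ, EM).prod 𝓘(ℝ, FE))]
  {FU : Type*} [NormedAddCommGroup FU] [NormedSpace ℝ FU] [FiniteDimensional ℝ FU]
  {U : TotalSpace FA A → Type*} [TopologicalSpace (TotalSpace FU U)]
  [∀ a, AddCommGroup (U a)] [∀ a, Module ℝ (U a)] [∀ a, TopologicalSpace (U a)]
  [FiberBundle FU U] [VectorBundle ℝ FU U]
  [ContMDiffVectorBundle ∞ FU U (𝓘(ℝ, EM).prod 𝓘(ℝ, FA))]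
  (D : DoubleVectorBundle EM FE E FA A FV V FU U)

namespace DoubleVectorBundle

variable {D}

theorem contDiff_deriv_cosRamp : ContDiff ℝ ∞ (deriv cosRamp) :=
  (contDiff_infty_iff_deriv.1 contDiff_cosRamp).2

theorem periodic_cosRamp : Function.Periodic cosRamp 2 := fun t => by
  unfold cosRamp
  rw [show Real.pi * (t + 2) = Real.pi * t + 2 * Real.pi by ring, Real.cos_add_two_pi]

theorem periodic_deriv_cosRamp : Function.Periodic (deriv cosRamp) 2 := fun t => by
  rw [← deriv_comp_add_const]
  exact congrArg (fun f => deriv f t) (funext periodic_cosRamp)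

/-- The reparametrized 0-cochains generate an isotopy, and the gauge equation says that b_W + c_t
evolves by exactly this generator. It is therefore transported by the isotopy from b₀ to b₁. -/
theorem GaugeEquivalent.equivalent_of_nontrivial [Nontrivial FV] [CompactSpace M]
    {W b₀ b₁ : D.VBAlgebroid} {c₀ c₁ : D.LinCochain 1} (h₀ : IsDeformation W c₀ b₀)
    (h₁ : IsDeformation W c₁ b₁) (h : GaugeEquivalent W c₀ c₁) : Equivalent b₀ b₁ := by
  obtain ⟨-, -, c, Δ, hc, hΔ, hc0, hc1, hd⟩ := h
  choose X hX hXs using fun ε => (Δ ε).2.1.exists_isDerivation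
  choose τ hτ using fun ε => (c ε).2.1.exists_isBider
  -- The factor `deriv cosRamp t` is the chain rule for the reparametrized gauge equation; it also
  -- keeps the generator smooth and 2-periodic on ℝ.
  let G : ℝ → D.Γ →ₗ[ℝ] D.Γ := fun t => deriv cosRamp t • linOfAlt (Δ (cosRamp t)).1
  have hGd : ∀ t, IsDerivation (G t) fun e => deriv cosRamp t • X (cosRamp t) e := fun t f s e => by
    have e1 : dirDeriv (deriv cosRamp t • X (cosRamp t) e) f =
        deriv cosRamp t * dirDeriv (X (cosRamp t) e) f :=
      (mfderiv (𝓘(ℝ, EM).prod 𝓘(ℝ, FE)) 𝓘(ℝ, ℝ) f e).map_smul _ _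
    change deriv cosRamp t • linOfAlt (Δ (cosRamp t)).1 (fsmul f s) e =
      _ + f e • deriv cosRamp t • linOfAlt (Δ (cosRamp t)).1 s e
    rw [hX, e1]
    module
  have hGs : ∀ s, SmoothFam 𝓘(ℝ, ℝ) fun t => G t s := fun s =>
    SmoothFam.smul contDiff_deriv_cosRamp.contMDiff (hΔ.comp_cosRamp ![s])
  obtain ⟨φ, hφ, hφ0, hφG⟩ := exists_isotopy (D := D) hGd hGs
    (fun t => by
      change deriv cosRamp (t + 2) • linOfAlt (Δ (cosRamp (t + 2))).1 = _
      rw [periodic_deriv_cosRamp, periodic_cosRamp])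
    (fun t => by
      change (fun e => deriv cosRamp (t + 2) • X (cosRamp (t + 2)) e) = _
      rw [periodic_deriv_cosRamp, periodic_cosRamp])
    (fun t r hr s => by
      refine ((D.hom r hr.ne').pullSecL.map_smul _ _).trans ?_
      exact congrArg (fun v : D.Γ => deriv cosRamp t • v) ((Δ (cosRamp t)).hom_pullSec hr s))
  let β : ℝ → D.Γ →ₗ[ℝ] D.Γ →ₗ[ℝ] D.Γ := fun t => W.bracket + bilOfAlt (c (cosRamp t)).1
  have hβ : ∀ t s u, β t s u = W.bracket s u + (c (cosRamp t)).fn ![s, u] := fun _ _ _ => rfl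
  have hβd : ∀ t, ∃ σ, IsBider (β t) σ := fun t => by
    -- The sum b_W + c is written as b_W − ((b_W − c) − b_W), so that `IsBider.sub` applies.
    have h := W.isBider.sub ((W.isBider.sub (hτ (cosRamp t))).sub W.isBider)
    have e1 : W.bracket - (W.bracket - bilOfAlt (c (cosRamp t)).1 - W.bracket) = β t := by
      change _ = W.bracket + bilOfAlt (c (cosRamp t)).1
      abel
    rw [e1] at h
    exact ⟨_, h⟩
  choose σ hσ using hβd
  have hswap : ∀ t s u, β t s u = -β t u s := fun t s u => by
    have h := alt_pair_swap (c (cosRamp t)).1 s u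
    change W.bracket s u + (c (cosRamp t)).1 ![s, u] =
      -(W.bracket u s + (c (cosRamp t)).1 ![u, s])
    rw [h, W.bracket_swap]
    abel
  have hβs : ∀ s u, SmoothFam 𝓘(ℝ, ℝ) fun t => β t s u := fun s u =>
    (smoothFam_const _).add (hc.comp_cosRamp ![s, u])
  have hβ' : ∀ s u t e, FibDeriv (fun τ => β τ s u e)
      ((β t (G t s) u + β t s (G t u) - G t (β t s u)) e) t := fun s u t e => by
    refine ((fibDeriv_const (W.bracket s u e) t).add
      (hd.comp_cosRamp ![s, u] t e)).congr_deriv ?_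
    rw [zero_add]
    refine congrArg (fun v : D.Γ => v e) (?_ : deriv cosRamp t • (_ : D.Γ) = _)
    set ε := cosRamp t with hε
    have h2 := gerst_one_zero W.brk (Δ ε).fn ![s, u]
    have h3 := gerst_one_zero (c ε).fn (Δ ε).fn ![s, u]
    refine (congrArg (fun v : D.Γ => deriv cosRamp t • v) (congrArg₂ (· + ·) h2 h3)).trans ?_
    have h4 : ∀ x y, (c ε).fn ![x, y] = bilOfAlt (c ε).1 x y := fun x y => rfl
    have h5 : ∀ x, (Δ ε).fn ![x] = linOfAlt (Δ ε).1 x := fun x => rfl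
    have h6 : ∀ x y, W.brk ![x, y] = W.bracket x y := fun x y => rfl
    have h7 : ∀ x, G t x = deriv cosRamp t • linOfAlt (Δ ε).1 x := fun x => rfl
    have h8 : bilOfAlt (c ε).1 (linOfAlt (Δ ε).1 u) s = -bilOfAlt (c ε).1 s (linOfAlt (Δ ε).1 u) :=
      alt_pair_swap (c ε).1 _ _
    have h9 := W.bracket_swap (linOfAlt (Δ ε).1 u) s
    simp only [Matrix.cons_val_zero, Matrix.cons_val_one, h4, h5, h6, hβ, h7, ← hε, map_smul,
      LinearMap.smul_apply, map_add, h8, h9]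
    module
  refine ⟨φ, ContMDiff.contMDiffOn hφ, hφ0, ?_⟩
  funext s
  -- Comparison of times 1 and 0: φ₁^* b₁ = φ₀^* b₀ = b₀, since φ₀ is the identity.
  have h2 := hφ.pullBil_eq hφG hσ hswap hβs hβ' (s 0) (s 1) 1 0
  have hβ1 : ∀ x y, b₁.bracket x y = β 1 x y := fun x y => by
    rw [hβ, cosRamp_one, hc1]
    exact congrFun h₁ ![x, y]
  have hβ0 : b₀.bracket (s 0) (s 1) = β 0 (s 0) (s 1) := by
    rw [hβ, cosRamp_zero, hc0]
    exact congrFun h₀ ![s 0, s 1]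
  refine (congrArg (φ 1).onW.pullSec (hβ1 _ _)).trans (h2.trans (Eq.trans ?_ hβ0.symm))
  have hid := VBAut.pullSec_of_total_eq hφ0
  have hid' : ∀ s, (φ 0).onW.symm.pullSec s = s := fun s => by
    refine (φ 0).onW.pullSec_injective ?_
    rw [(φ 0).onW.pullSec_symm_pullSec, hid]
  rw [VBAut.pullBil_apply, hid, hid', hid']

/-- In rank zero the fibres of W → E are trivial, so all brackets coincide and the constant identity
isotopy works; in positive rank the flow argument applies. -/
theorem GaugeEquivalent.equivalent [CompactSpace M] {W b₀ b₁ : D.VBAlgebroid}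
    {c₀ c₁ : D.LinCochain 1} (h₀ : IsDeformation W c₀ b₀) (h₁ : IsDeformation W c₁ b₁)
    (h : GaugeEquivalent W c₀ c₁) : Equivalent b₀ b₁ := by
  obtain hF | hF := subsingleton_or_nontrivial FV
  · refine ⟨fun _ => DVBAut.ofHomogeneous D (Diffeomorph.refl _ _ ∞) (fun _ _ _ => rfl)
      fun _ _ _ => rfl, contMDiffOn_snd, fun _ => rfl, ?_⟩
    funext s
    ext e
    obtain ⟨A⟩ := exists_linearEquiv_fibre (F := FV) V e
    have := A.toEquiv.subsingleton
    exact Subsingleton.elim _ _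
  · exact h.equivalent_of_nontrivial h₀ h₁

end DoubleVectorBundle

end DVB

end VBDef

end

/-- Let `(W → E; A → M)` be a double vector bundle with a VB-algebroid structure `bW`, and let
`b₀ = bW + c₀`, `b₁ = bW + c₁` be linear deformations of `bW`. If `b₀` and `b₁` are equivalent, then
`c₀` and `c₁` are gauge equivalent; the converse holds if `M` is compact. -/
theorem mainTheorem10
    {EM : Type*} [NormedAddCommGroup EM] [NormedSpace ℝ EM] [FiniteDimensional ℝ EM]
    {M : Type*} [TopologicalSpace M] [ChartedSpace EM M] [IsManifold 𝓘(ℝ, EM) ∞ M]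
    [T2Space M] [SecondCountableTopology M]
    {FE : Type*} [NormedAddCommGroup FE] [NormedSpace ℝ FE] [FiniteDimensional ℝ FE]
    {E : M → Type*} [TopologicalSpace (TotalSpace FE E)]
    [∀ x, AddCommGroup (E x)] [∀ x, Module ℝ (E x)] [∀ x, TopologicalSpace (E x)]
    [FiberBundle FE E] [VectorBundle ℝ FE E] [ContMDiffVectorBundle ∞ FE E 𝓘(ℝ, EM)]
    {FA : Type*} [NormedAddCommGroup FA] [NormedSpace ℝ FA] [FiniteDimensional ℝ FA]
    {A : M → Type*} [TopologicalSpace (TotalSpace FA A)]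
    [∀ x, AddCommGroup (A x)] [∀ x, Module ℝ (A x)] [∀ x, TopologicalSpace (A x)]
    [FiberBundle FA A] [VectorBundle ℝ FA A] [ContMDiffVectorBundle ∞ FA A 𝓘(ℝ, EM)]
    {FV : Type*} [NormedAddCommGroup FV] [NormedSpace ℝ FV] [FiniteDimensional ℝ FV]
    {V : TotalSpace FE E → Type*} [TopologicalSpace (TotalSpace FV V)]
    [∀ e, AddCommGroup (V e)] [∀ e, Module ℝ (V e)] [∀ e, TopologicalSpace (V e)]
    [FiberBundle FV V] [VectorBundle ℝ FV V]
    [ContMDiffVectorBundle ∞ FV V (𝓘(ℝ, EM).prod 𝓘(ℝ, FE))]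
    {FU : Type*} [NormedAddCommGroup FU] [NormedSpace ℝ FU] [FiniteDimensional ℝ FU]
    {U : TotalSpace FA A → Type*} [TopologicalSpace (TotalSpace FU U)]
    [∀ a, AddCommGroup (U a)] [∀ a, Module ℝ (U a)] [∀ a, TopologicalSpace (U a)]
    [FiberBundle FU U] [VectorBundle ℝ FU U]
    [ContMDiffVectorBundle ∞ FU U (𝓘(ℝ, EM).prod 𝓘(ℝ, FA))]
    (D : VBDef.DoubleVectorBundle EM FE E FA A FV V FU U)
    (bW b₀ b₁ : D.VBAlgebroid) (c₀ c₁ : D.LinCochain 1)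
    (h₀ : VBDef.DoubleVectorBundle.IsDeformation bW c₀ b₀)
    (h₁ : VBDef.DoubleVectorBundle.IsDeformation bW c₁ b₁) :
    (VBDef.DoubleVectorBundle.Equivalent b₀ b₁ →
      VBDef.DoubleVectorBundle.GaugeEquivalent bW c₀ c₁) ∧
    (CompactSpace M → VBDef.DoubleVectorBundle.GaugeEquivalent bW c₀ c₁ →
      VBDef.DoubleVectorBundle.Equivalent b₀ b₁) := by
  exact ⟨fun h => h.gaugeEquivalent h₀ h₁, fun _ h => h.equivalent h₀ h₁⟩
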